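/- Let $\mathbf F\in\{\mathbf R,\mathbf C\}$, let $\operatorname{U}(d)$ denote the group of $d\times d$ matrices $g$ over $\mathbf F$ with $g^*g=I$ (so $\operatorname{O}(d)$ if $\mathbf F=\mathbf R$), acting diagonally on the set $(\operatorname{Gr}(r,\mathbf F^d))^n$ of $n$-tuples of $r$-dimensional subspaces of $\mathbf F^d$. An orthobasis of a tuple $(V_i)_{i\in[n]}$ is a tuple $(A_i)_{i\in[n]}$ of matrices $A_i\in\mathbf F^{d\times r}$ with $A_i^*A_i=I$ and $\operatorname{im}A_i=V_i$; put $A=[A_1\cdots A_n]$, so that its Gramian is $A^*A\in\mathbf F^{rn\times rn}$. Let $\Pi_i$ be the orthogonal projection of $\mathbf F^{rn}$ onto the $i$th block of $r$ coordinates, and put $A_{ij}:=\Pi_iA^*A\,\Pi_j$. The cross Gramian algebra of $A$ is the smallest unital subalgebra of $\mathbf F^{rn\times rn}$ that contains all $A_{ij}$, $i,j\in[n]$. (a) Let $A$ and $B$ come from orthobases of tuples $(V_i)_{i\in[n]}$ and $(W_i)_{i\in[n]}$ in $(\operatorname{Gr}(r,\mathbf F^d))^n$, with blocks $A_{ij}$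 and $B_{ij}$. A unitary (orthogonal if $\mathbf F=\mathbf R$) $rn\times rn$ matrix $U$ satisfies $UA_{ij}U^*=B_{ij}$ for all $i,j\in[n]$ if and only if $U$ is block diagonal with $r\times r$ blocks and $UA^*AU^*=B^*B$. Such a $U$ exists if and only if there is $g\in\operatorname{U}(d)$ with $gV_i=W_i$ for all $i\in[n]$. (b) There are a single program $P$ and a constant $C$, not depending on $r,n,d$, such that for all $r,n\ge1$ and all $d$ there is a function $f$ on $(\operatorname{Gr}(r,\mathbf F^d))^n$ with the following properties. It is an injective invariant modulo $\operatorname{U}(d)$: $f(V)=f(W)$ if and only if $V$ and $W$ lie in the same $\operatorname{U}(d)$-orbit. Its value $f(V)$ is a finite list of pairs $(w,t)$, where $w$ is a word in noncommuting letters $x_{ij}$, $i,j\in[n]$, and $t\in\mathbf F$. For every orthobasis of $V$, with $A$ as above, each pair $(w,t)$ in $f(V)$ satisfies $t=\operatorname{tr}w((A_{ij})_{i,j\in[n]})$, and the evaluations $w((A_{ij})_{i,j\in[n]})$ of the words that occur in $f(V)$ span the cross Gramian algebra of $A$. Finally, on input $r$, $n$ and the Gramian $A^*A$ of any orthobasis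 of $V$, the program $P$ outputs $f(V)$ after at most $C\,(r^8n^5+r^9n^3)$ operations. Here a program is a finite program with finitely many unbounded, indirectly addressed, zero-initialized arrays of natural numbers and of elements of $\mathbf F$, built from assignments, output commands, sequencing, branching on $a\le b$ for natural numbers and on $x=0$ for elements of $\mathbf F$, and counting loops. It uses no constants from $\mathbf F$ other than $0$ and $1$. One operation is charged for each command, each test, each pass through a loop, each constant, each array access, each addition, (truncated) subtraction or multiplication of natural numbers, and each exact addition, subtraction, multiplication, division (with $x/0=0$) or conjugation in $\mathbf F$. A pair $(w,t)$ is output as the sequence of the indices $i,j$ of the successive letters $x_{ij}$ of $w$, followed by $t$. -/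

import Mathlib

namespace CrossGramian

/-! ### Grassmannians, group actions and invariants -/

/-- The Grassmannian of `r`-dimensional linear subspaces of `𝕜 ^ d`. -/
@[ext]
structure Gr (𝕜 : Type*) [RCLike 𝕜] (r d : ℕ) where
  carrier : Submodule 𝕜 (Fin d → 𝕜)
  finrank_eq : Module.finrank 𝕜 carrier = r

/-- The isometry group of the standard Hermitian form on `𝕜 ^ d`:
`O(d)` for `𝕜 = ℝ` and `U(d)` for `𝕜 = ℂ`. -/
abbrev UGroup (𝕜 : Type*) [RCLike 𝕜] (d : ℕ) := Matrix.unitaryGroup (Fin d) 𝕜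

theorem mulVecLin_injective {𝕜 : Type*} [RCLike 𝕜] {d : ℕ} (g : UGroup 𝕜 d) :
    Function.Injective (Matrix.mulVecLin (g : Matrix (Fin d) (Fin d) 𝕜)) := by
  intro x y h
  have h2 := congrArg (Matrix.mulVec (star (g : Matrix (Fin d) (Fin d) 𝕜))) h
  simpa [Matrix.mulVec_mulVec, Matrix.mem_unitaryGroup_iff'.1 g.2] using h2

/-- The action of the isometry group on the Grassmannian, `g • V = {g v : v ∈ V}`.
The product `Fin n → Gr 𝕜 r d` then carries the diagonal action `g • V = (g • V i)_i`. -/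
instance {𝕜 : Type*} [RCLike 𝕜] {r d : ℕ} : MulAction (UGroup 𝕜 d) (Gr 𝕜 r d) where
  smul g V :=
    { carrier := V.carrier.map (Matrix.mulVecLin (g : Matrix (Fin d) (Fin d) 𝕜))
      finrank_eq := by
        exact (LinearEquiv.finrank_eq
          (Submodule.equivMapOfInjective _ (mulVecLin_injective g) V.carrier)).symm.trans
            V.finrank_eq }
  one_smul V := by
    apply Gr.ext
    change V.carrier.map (Matrix.mulVecLin ((1 : UGroup 𝕜 d) : Matrix (Fin d) (Fin d) 𝕜)) = _
    simp
  mul_smul g h V := by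
    apply Gr.ext
    change V.carrier.map (Matrix.mulVecLin ((g * h : UGroup 𝕜 d) : Matrix (Fin d) (Fin d) 𝕜)) =
      (V.carrier.map (Matrix.mulVecLin (h : Matrix (Fin d) (Fin d) 𝕜))).map
        (Matrix.mulVecLin (g : Matrix (Fin d) (Fin d) 𝕜))
    rw [← Submodule.map_comp, ← Matrix.mulVecLin_mul]
    rfl

/-- An injective invariant of a `G`-set: constant on orbits, with different values on
different orbits. -/
structure IsInjectiveInvariant (G : Type*) {X S : Type*} [Group G] [MulAction G X]
    (f : X → S) : Prop where
  invariant : ∀ (g : G) (x : X), f (g • x) = f x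
  injective : ∀ x y : X, f x = f y → ∃ g : G, g • x = y

/-! ### Orthobases, Gramians and the cross Gramian algebra -/

section Gramians

variable {𝕜 : Type*} [RCLike 𝕜] {r d n : ℕ}

/-- The columns of `A i` form an orthonormal basis of the `i`-th subspace `V i`. -/
def IsOrthobasis (A : Fin n → Matrix (Fin d) (Fin r) 𝕜) (V : Fin n → Gr 𝕜 r d) : Prop :=
  ∀ i, (A i).conjTranspose * A i = 1 ∧ (V i).carrier = LinearMap.range (A i).mulVecLin

/-- The block matrix `[A_1 ⋯ A_n]`; its columns are indexed by pairs (block, column in block). -/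
def concat (A : Fin n → Matrix (Fin d) (Fin r) 𝕜) : Matrix (Fin d) (Fin n × Fin r) 𝕜 :=
  Matrix.of fun k p => A p.1 k p.2

/-- The Gramian `A^* A` of `A = [A_1 ⋯ A_n]`. -/
def gramian (A : Fin n → Matrix (Fin d) (Fin r) 𝕜) :
    Matrix (Fin n × Fin r) (Fin n × Fin r) 𝕜 :=
  (concat A).conjTranspose * concat A

/-- The orthogonal projection `Π_i` onto the `i`-th block of `r` coordinates. -/
def blockProj (𝕜 : Type*) [RCLike 𝕜] {r n : ℕ} (i : Fin n) :
    Matrix (Fin n × Fin r) (Fin n × Fin r) 𝕜 :=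
  Matrix.diagonal fun p => if p.1 = i then 1 else 0

/-- The matrix `Π_i G Π_j`. -/
def crossBlock (G : Matrix (Fin n × Fin r) (Fin n × Fin r) 𝕜) (i j : Fin n) :
    Matrix (Fin n × Fin r) (Fin n × Fin r) 𝕜 :=
  blockProj 𝕜 i * G * blockProj 𝕜 j

/-- The cross Gramian algebra: the smallest unital subalgebra containing all `Π_i G Π_j`. -/
def crossAlgebra (G : Matrix (Fin n × Fin r) (Fin n × Fin r) 𝕜) :
    Subalgebra 𝕜 (Matrix (Fin n × Fin r) (Fin n × Fin r) 𝕜) :=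
  Algebra.adjoin 𝕜 {M | ∃ i j, M = crossBlock G i j}

/-- Block diagonal matrices, with `n` diagonal blocks of size `r × r`. -/
def IsBlockDiagonal (M : Matrix (Fin n × Fin r) (Fin n × Fin r) 𝕜) : Prop :=
  ∀ p q, p.1 ≠ q.1 → M p q = 0

/-- Words in the noncommuting letters `x_{ij}`, `i, j ∈ [n]`. -/
abbrev Word (n : ℕ) := List (Fin n × Fin n)

/-- Evaluation of a word at `x_{ij} = Π_i G Π_j`; the empty word evaluates to the identity. -/
def evalWord (G : Matrix (Fin n × Fin r) (Fin n × Fin r) 𝕜) (w : Word n) :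
    Matrix (Fin n × Fin r) (Fin n × Fin r) 𝕜 :=
  (w.map fun x => crossBlock G x.1 x.2).prod

end Gramians

/-! ### A random access machine over a field with involution

Programs are finite, use no field constants except `0` and `1`, and work on finitely many
unbounded arrays of natural numbers and of field elements, with indirect addressing. They
append their results to an output tape. All field arithmetic is exact; division by zero
gives zero, and subtraction of natural numbers is truncated. -/

/-- Natural number expressions; `get a e` reads the natural number array `a` at index `e`. -/
inductive NatExpr where
  | const (k : ℕ)
  | get (a : ℕ) (e : NatExpr)
  | plus (e₁ e₂ : NatExpr)
  | minus (e₁ e₂ : NatExpr)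
  | times (e₁ e₂ : NatExpr)

/-- Field expressions; `get a e` reads the field array `a` at index `e`. -/
inductive FldExpr where
  | zero
  | one
  | get (a : ℕ) (e : NatExpr)
  | plus (e₁ e₂ : FldExpr)
  | minus (e₁ e₂ : FldExpr)
  | times (e₁ e₂ : FldExpr)
  | divide (e₁ e₂ : FldExpr)
  | conj (e : FldExpr)

/-- Programs. -/
inductive Prog where
  /-- do nothing -/
  | skip
  /-- write the value of `e` into the natural number array `a` at index `i` -/
  | setNat (a : ℕ) (i e : NatExpr)
  /-- write the value of `e` into the field array `a` at index `i` -/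
  | setFld (a : ℕ) (i : NatExpr) (e : FldExpr)
  /-- append a natural number to the output -/
  | outNat (e : NatExpr)
  /-- append a field element to the output -/
  | outFld (e : FldExpr)
  /-- run `p`, then `q` -/
  | seq (p q : Prog)
  /-- if `e₁ ≤ e₂` then `p` else `q` -/
  | ifLe (e₁ e₂ : NatExpr) (p q : Prog)
  /-- if `e = 0` then `p` else `q` -/
  | ifZero (e : FldExpr) (p q : Prog)
  /-- let `N` be the value of `e`; for `k = 0, …, N - 1`, write `k` into the natural number
  array `a` at index `0` and run `p` -/
  | loop (a : ℕ) (e : NatExpr) (p : Prog)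

/-- The state of the machine: arrays, output tape, and number of steps executed so far. -/
structure State (𝕜 : Type*) where
  nat : ℕ → ℕ → ℕ
  fld : ℕ → ℕ → 𝕜
  out : List (ℕ ⊕ 𝕜)
  time : ℕ

def NatExpr.eval (m : ℕ → ℕ → ℕ) : NatExpr → ℕ
  | const k => k
  | get a e => m a (e.eval m)
  | plus e₁ e₂ => e₁.eval m + e₂.eval m
  | minus e₁ e₂ => e₁.eval m - e₂.eval m
  | times e₁ e₂ => e₁.eval m * e₂.eval m

/-- The number of operations performed to evaluate an expression: one for every constant,
every array access and every arithmetic operation. -/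
def NatExpr.cost : NatExpr → ℕ
  | const _ => 1
  | get _ e => e.cost + 1
  | plus e₁ e₂ => e₁.cost + e₂.cost + 1
  | minus e₁ e₂ => e₁.cost + e₂.cost + 1
  | times e₁ e₂ => e₁.cost + e₂.cost + 1

def FldExpr.eval {𝕜 : Type*} [RCLike 𝕜] (m : ℕ → ℕ → ℕ) (f : ℕ → ℕ → 𝕜) : FldExpr → 𝕜
  | zero => 0
  | one => 1
  | get a e => f a (e.eval m)
  | plus e₁ e₂ => e₁.eval m f + e₂.eval m f
  | minus e₁ e₂ => e₁.eval m f - e₂.eval m f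
  | times e₁ e₂ => e₁.eval m f * e₂.eval m f
  | divide e₁ e₂ => e₁.eval m f / e₂.eval m f
  | conj e => star (e.eval m f)

/-- The number of operations performed to evaluate an expression: one for every constant,
every array access, every arithmetic operation and every conjugation. -/
def FldExpr.cost : FldExpr → ℕ
  | zero => 1
  | one => 1
  | get _ e => e.cost + 1
  | plus e₁ e₂ => e₁.cost + e₂.cost + 1
  | minus e₁ e₂ => e₁.cost + e₂.cost + 1
  | times e₁ e₂ => e₁.cost + e₂.cost + 1
  | divide e₁ e₂ => e₁.cost + e₂.cost + 1
  | conj e => e.cost + 1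

namespace State

variable {𝕜 : Type*}

/-- Count `k` more steps. -/
def tick (s : State 𝕜) (k : ℕ) : State 𝕜 := { s with time := s.time + k }

/-- Write a natural number. -/
def writeNat (s : State 𝕜) (a i v : ℕ) : State 𝕜 :=
  { s with nat := Function.update s.nat a (Function.update (s.nat a) i v) }

/-- Write a field element. -/
def writeFld (s : State 𝕜) (a i : ℕ) (v : 𝕜) : State 𝕜 :=
  { s with fld := Function.update s.fld a (Function.update (s.fld a) i v) }

/-- Append to the output tape. -/
def emit (s : State 𝕜) (x : ℕ ⊕ 𝕜) : State 𝕜 := { s with out := s.out ++ [x] }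

end State

open Classical in
/-- The effect of a program on a state. Every command, every test and every pass through a
loop costs one step in addition to the cost of the expressions that it evaluates. -/
noncomputable def Prog.run {𝕜 : Type*} [RCLike 𝕜] : Prog → State 𝕜 → State 𝕜
  | skip, s => s.tick 1
  | setNat a i e, s =>
      (s.writeNat a (i.eval s.nat) (e.eval s.nat)).tick (i.cost + e.cost + 1)
  | setFld a i e, s =>
      (s.writeFld a (i.eval s.nat) (e.eval s.nat s.fld)).tick (i.cost + e.cost + 1)
  | outNat e, s => (s.emit (Sum.inl (e.eval s.nat))).tick (e.cost + 1)
  | outFld e, s => (s.emit (Sum.inr (e.eval s.nat s.fld))).tick (e.cost + 1)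
  | seq p q, s => q.run (p.run s)
  | ifLe e₁ e₂ p q, s =>
      if e₁.eval s.nat ≤ e₂.eval s.nat then p.run (s.tick (e₁.cost + e₂.cost + 1))
      else q.run (s.tick (e₁.cost + e₂.cost + 1))
  | ifZero e p q, s =>
      if e.eval s.nat s.fld = 0 then p.run (s.tick (e.cost + 1))
      else q.run (s.tick (e.cost + 1))
  | loop a e p, s =>
      (List.range (e.eval s.nat)).foldl (fun t k => p.run ((t.writeNat a 0 k).tick 1))
        (s.tick (e.cost + 1))

/-- The initial state on input `(r, n, G)`: natural number array `0` holds `r` at index `0`,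
natural number array `1` holds `n` at index `0`, field array `0` holds the `n r × n r` matrix
`G` in row-major order, and everything else is zero. -/
def input {𝕜 : Type*} [RCLike 𝕜] (r n : ℕ)
    (G : Matrix (Fin n × Fin r) (Fin n × Fin r) 𝕜) : State 𝕜 where
  nat a k := if a = 0 ∧ k = 0 then r else if a = 1 ∧ k = 0 then n else 0
  fld a k :=
    if h : a = 0 ∧ k < (n * r) * (n * r) then
      G (finProdFinEquiv.symm (finProdFinEquiv.symm ⟨k, h.2⟩).1)
        (finProdFinEquiv.symm (finProdFinEquiv.symm ⟨k, h.2⟩).2)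
    else 0
  out := []
  time := 0

/-- How a list of pairs (word, scalar) is written on the output tape: for each pair, the
indices `i, j` of the successive letters `x_{ij}` of the word, followed by the scalar. -/
def encode {𝕜 : Type*} {n : ℕ} (L : List (Word n × 𝕜)) : List (ℕ ⊕ 𝕜) :=
  L.flatMap fun e =>
    (e.1.flatMap fun x => [Sum.inl (x.1 : ℕ), Sum.inl (x.2 : ℕ)]) ++ [Sum.inr e.2]

end CrossGramian

/-! Write `G` for the Gramian and `x_{ij} = Π_i G Π_j`. For an orthobasis `x_{ii} = Π_i`, because
each `A_i` has orthonormal columns. Hence a unitary `U` that conjugates all cross blocks commutes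
with the `Π_i`, so it is block diagonal, and summing the blocks gives `U G U* = G'`
(`conj_crossBlock_iff`). Then `A` and `B U` have equal Gramians and differ by some `g` in the
unitary group; comparing blocks shows `g V_i = W_i` (`exists_smul_eq_iff`).

For the algorithm, `x_{ij} x_{kl} = 0` unless `j = k`, so only words along paths of vertices matter.
A path ending at `i` evaluates to a matrix supported in the `i`-th block column, which has `n r²`
entries. For each `i`, start with `[i, i]`, which evaluates to `Π_i`, prepend vertices to the
recorded paths, and record a result if it is linearly independent of the earlier ones, as tested by
Gram–Schmidt. At most `n r²` paths are recorded, and their span is closed under left multiplication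
by letters (`searchPaths_spec`, `crossBlock_mul_mem_pathSpan`). The spans for all `i` add up to the
cross Gramian algebra (`crossAlgebra_eq_span`). The output consists of the trace of each recorded
word `X_t`, and the trace of `X_s* G X_t` for each two recorded paths with the same end.

The output is invariant because unitary conjugation changes neither the independence tests nor the
traces (`fullReport_eq_of_conj`). It is complete because `X_s* X_t` and `X_s* x_{kj} X_t` are each
either zero or equal to `X_s* G X_t`. The listed traces therefore give all inner products of the
recorded words and the matrix coefficients of the letters acting on them. If two outputs agree,
sending each recorded word for `G` to the same word for `G'` is an isometry that commutes with the
letters (`crossBlock_mul_mem_pairSpan`), so all words have equal traces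
(`trace_evalWord_eq_of_fullReport_eq`). A theorem of Specht type (`exists_intertwiner`) turns equal
traces into unitary equivalence, over both fields at once.

The program has loop bounds that depend only on `r` and `n`, so its cost is bounded syntactically
(`Prog.time_run_le`). Its correctness is proved apart from the cost, by loop invariants for a
semantics without a clock (`Prog.run_mem`, `Alg.main_spec`). -/

namespace CrossGramian

/-! ### Semantics of programs without the step counter -/

section Semantics

variable {𝕜 : Type*}

/-- The arrays and the output tape of the machine. -/
structure Mem (𝕜 : Type*) where
  nat : ℕ → ℕ → ℕ
  fld : ℕ → ℕ → 𝕜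
  out : List (ℕ ⊕ 𝕜)

namespace Mem

/-- Write a natural number. -/
def setNat (m : Mem 𝕜) (a i v : ℕ) : Mem 𝕜 :=
  { m with nat := Function.update m.nat a (Function.update (m.nat a) i v) }

/-- Write a field element. -/
def setFld (m : Mem 𝕜) (a i : ℕ) (v : 𝕜) : Mem 𝕜 :=
  { m with fld := Function.update m.fld a (Function.update (m.fld a) i v) }

/-- Append to the output tape. -/
def emit (m : Mem 𝕜) (x : ℕ ⊕ 𝕜) : Mem 𝕜 := { m with out := m.out ++ [x] }

@[simp] theorem setNat_nat (m : Mem 𝕜) (a i v b j : ℕ) :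
    (m.setNat a i v).nat b j = if b = a ∧ j = i then v else m.nat b j := by
  by_cases h : b = a
  · subst h; by_cases h' : j = i <;> simp [setNat, h']
  · simp [setNat, h]

theorem setNat_nat_of_ne (m : Mem 𝕜) {a b : ℕ} (i v : ℕ) (h : b ≠ a) :
    (m.setNat a i v).nat b = m.nat b := by
  simp [setNat, h]

@[simp] theorem setNat_fld (m : Mem 𝕜) (a i v : ℕ) : (m.setNat a i v).fld = m.fld := rfl

@[simp] theorem setFld_fld (m : Mem 𝕜) (a i : ℕ) (v : 𝕜) (b j : ℕ) :
    (m.setFld a i v).fld b j = if b = a ∧ j = i then v else m.fld b j := by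
  by_cases h : b = a
  · subst h; by_cases h' : j = i <;> simp [setFld, h']
  · simp [setFld, h]

theorem setFld_fld_of_ne (m : Mem 𝕜) {a b : ℕ} (i : ℕ) (v : 𝕜) (h : b ≠ a) :
    (m.setFld a i v).fld b = m.fld b := by
  simp [setFld, h]

@[simp] theorem setFld_nat (m : Mem 𝕜) (a i : ℕ) (v : 𝕜) : (m.setFld a i v).nat = m.nat := rfl

@[simp] theorem emit_nat (m : Mem 𝕜) (x : ℕ ⊕ 𝕜) : (m.emit x).nat = m.nat := rfl

@[simp] theorem emit_out (m : Mem 𝕜) (x : ℕ ⊕ 𝕜) : (m.emit x).out = m.out ++ [x] := rfl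

end Mem

/-- Forget the step counter. -/
def State.mem (s : State 𝕜) : Mem 𝕜 := ⟨s.nat, s.fld, s.out⟩

attribute [simp] NatExpr.eval FldExpr.eval

variable [RCLike 𝕜]

open Classical in
/-- The effect of a program on the memory. -/
noncomputable def Prog.exec : Prog → Mem 𝕜 → Mem 𝕜
  | skip, m => m
  | setNat a i e, m => m.setNat a (i.eval m.nat) (e.eval m.nat)
  | setFld a i e, m => m.setFld a (i.eval m.nat) (e.eval m.nat m.fld)
  | outNat e, m => m.emit (Sum.inl (e.eval m.nat))
  | outFld e, m => m.emit (Sum.inr (e.eval m.nat m.fld))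
  | seq p q, m => q.exec (p.exec m)
  | ifLe e₁ e₂ p q, m => if e₁.eval m.nat ≤ e₂.eval m.nat then p.exec m else q.exec m
  | ifZero e p q, m => if e.eval m.nat m.fld = 0 then p.exec m else q.exec m
  | loop a e p, m => (List.range (e.eval m.nat)).foldl (fun t k => p.exec (t.setNat a 0 k)) m

/-- The clock never influences the arrays or the tape, so correctness can be proved for `exec` and
the cost bounded separately. -/
theorem Prog.run_mem (p : Prog) (s : State 𝕜) : (p.run s).mem = p.exec s.mem := by
  induction p generalizing s with
  | skip => rfl
  | setNat a i e => rfl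
  | setFld a i e => rfl
  | outNat e => rfl
  | outFld e => rfl
  | seq p q hp hq => rw [run, exec, hq, hp]
  | ifLe e₁ e₂ p q hp hq =>
    rw [run, exec]
    change (if e₁.eval s.nat ≤ e₂.eval s.nat then _ else _ : State 𝕜).mem =
      if e₁.eval s.nat ≤ e₂.eval s.nat then _ else _
    split_ifs
    · rw [hp]; rfl
    · rw [hq]; rfl
  | ifZero e p q hp hq =>
    rw [run, exec]
    change (if e.eval s.nat s.fld = 0 then _ else _ : State 𝕜).mem =
      if e.eval s.nat s.fld = 0 then _ else _
    split_ifs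
    · rw [hp]; rfl
    · rw [hq]; rfl
  | loop a e p hp =>
    rw [run, exec]
    change _ = (List.range (e.eval s.nat)).foldl _ (s.tick (e.cost + 1)).mem
    generalize s.tick (e.cost + 1) = t
    induction List.range (e.eval s.nat) generalizing t with
    | nil => rfl
    | cons k l ih =>
      rw [List.foldl_cons, List.foldl_cons, ih, hp]
      rfl

/-! ### Frame conditions -/

/-- Whether a program may write the natural number array `b`. -/
def Prog.writesNat (b : ℕ) : Prog → Bool
  | setNat a _ _ => a == b
  | seq p q => p.writesNat b || q.writesNat b
  | ifLe _ _ p q => p.writesNat b || q.writesNat b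
  | ifZero _ p q => p.writesNat b || q.writesNat b
  | loop a _ p => a == b || p.writesNat b
  | _ => false

/-- Whether a program may write the field array `b`. -/
def Prog.writesFld (b : ℕ) : Prog → Bool
  | setFld a _ _ => a == b
  | seq p q => p.writesFld b || q.writesFld b
  | ifLe _ _ p q => p.writesFld b || q.writesFld b
  | ifZero _ p q => p.writesFld b || q.writesFld b
  | loop _ _ p => p.writesFld b
  | _ => false

/-- Whether a program may write to the output tape. -/
def Prog.writesOut : Prog → Bool
  | outNat _ => true
  | outFld _ => true
  | seq p q => p.writesOut || q.writesOut
  | ifLe _ _ p q => p.writesOut || q.writesOut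
  | ifZero _ p q => p.writesOut || q.writesOut
  | loop _ _ p => p.writesOut
  | _ => false

theorem foldl_preserves {α β γ : Type*} (φ : β → γ) (f : β → α → β)
    (h : ∀ t k, φ (f t k) = φ t) (l : List α) (t : β) : φ (l.foldl f t) = φ t := by
  induction l generalizing t with
  | nil => rfl
  | cons k l ih => rw [List.foldl_cons, ih, h]

theorem Prog.exec_nat_of_not_writes {p : Prog} {b : ℕ} (h : p.writesNat b = false) (m : Mem 𝕜) :
    (p.exec m).nat b = m.nat b := by
  induction p generalizing m with
  | skip => rfl
  | setNat a i e =>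
    exact Mem.setNat_nat_of_ne _ _ _ (by rintro rfl; simp [writesNat] at h)
  | setFld a i e => rfl
  | outNat e => rfl
  | outFld e => rfl
  | seq p q hp hq =>
    simp only [writesNat, Bool.or_eq_false_iff] at h
    rw [exec, hq h.2, hp h.1]
  | ifLe e₁ e₂ p q hp hq =>
    simp only [writesNat, Bool.or_eq_false_iff] at h
    rw [exec]
    split_ifs
    · exact hp h.1 m
    · exact hq h.2 m
  | ifZero e p q hp hq =>
    simp only [writesNat, Bool.or_eq_false_iff] at h
    rw [exec]
    split_ifs
    · exact hp h.1 m
    · exact hq h.2 m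
  | loop a e p hp =>
    simp only [writesNat, Bool.or_eq_false_iff, beq_eq_false_iff_ne] at h
    exact foldl_preserves (fun t : Mem 𝕜 => t.nat b) _
      (fun t k => by rw [hp h.2, Mem.setNat_nat_of_ne _ _ _ h.1.symm]) _ _

theorem Prog.exec_fld_of_not_writes {p : Prog} {b : ℕ} (h : p.writesFld b = false) (m : Mem 𝕜) :
    (p.exec m).fld b = m.fld b := by
  induction p generalizing m with
  | skip => rfl
  | setNat a i e => rfl
  | setFld a i e =>
    exact Mem.setFld_fld_of_ne _ _ _ (by rintro rfl; simp [writesFld] at h)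
  | outNat e => rfl
  | outFld e => rfl
  | seq p q hp hq =>
    simp only [writesFld, Bool.or_eq_false_iff] at h
    rw [exec, hq h.2, hp h.1]
  | ifLe e₁ e₂ p q hp hq =>
    simp only [writesFld, Bool.or_eq_false_iff] at h
    rw [exec]
    split_ifs
    · exact hp h.1 m
    · exact hq h.2 m
  | ifZero e p q hp hq =>
    simp only [writesFld, Bool.or_eq_false_iff] at h
    rw [exec]
    split_ifs
    · exact hp h.1 m
    · exact hq h.2 m
  | loop a e p hp =>
    simp only [writesFld] at h
    exact foldl_preserves (fun t : Mem 𝕜 => t.fld b) _ (fun t k => by rw [hp h]; rfl) _ _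

theorem Prog.exec_out_of_not_writes {p : Prog} (h : p.writesOut = false) (m : Mem 𝕜) :
    (p.exec m).out = m.out := by
  induction p generalizing m with
  | skip => rfl
  | setNat a i e => rfl
  | setFld a i e => rfl
  | outNat e => simp [writesOut] at h
  | outFld e => simp [writesOut] at h
  | seq p q hp hq =>
    simp only [writesOut, Bool.or_eq_false_iff] at h
    rw [exec, hq h.2, hp h.1]
  | ifLe e₁ e₂ p q hp hq =>
    simp only [writesOut, Bool.or_eq_false_iff] at h
    rw [exec]
    split_ifs
    · exact hp h.1 m
    · exact hq h.2 m
  | ifZero e p q hp hq =>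
    simp only [writesOut, Bool.or_eq_false_iff] at h
    rw [exec]
    split_ifs
    · exact hp h.1 m
    · exact hq h.2 m
  | loop a e p hp =>
    simp only [writesOut] at h
    exact foldl_preserves (fun t : Mem 𝕜 => t.out) _ (fun t k => by rw [hp h]; rfl) _ _

/-- The invariant rule for counting loops. -/
theorem Prog.exec_loop {a : ℕ} {e : NatExpr} {p : Prog} {m : Mem 𝕜} (N : ℕ)
    (hN : e.eval m.nat = N) (I : ℕ → Mem 𝕜 → Prop) (h0 : I 0 m)
    (hs : ∀ k < N, ∀ t : Mem 𝕜, (∀ b, (loop a e p).writesNat b = false → t.nat b = m.nat b) →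
      (∀ b, p.writesFld b = false → t.fld b = m.fld b) →
      (p.writesOut = false → t.out = m.out) → I k t → I (k + 1) (p.exec (t.setNat a 0 k))) :
    I N ((loop a e p).exec m) := by
  suffices h : ∀ K ≤ N, I K ((List.range K).foldl (fun t k => p.exec (t.setNat a 0 k)) m) by
    rw [exec, hN]; exact h N le_rfl
  intro K hK
  induction K with
  | zero => exact h0
  | succ K ih =>
    rw [List.range_succ, List.foldl_append, List.foldl_cons, List.foldl_nil]
    refine hs K hK _ (fun b hb => ?_) (fun b hb => ?_) (fun hb => ?_) (ih (by omega))
    · simp only [writesNat, Bool.or_eq_false_iff, beq_eq_false_iff_ne] at hb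
      exact foldl_preserves (fun t : Mem 𝕜 => t.nat b) _
        (fun t k => by rw [exec_nat_of_not_writes hb.2, Mem.setNat_nat_of_ne _ _ _ hb.1.symm]) _ _
    · exact foldl_preserves (fun t : Mem 𝕜 => t.fld b) _
        (fun t k => by rw [exec_fld_of_not_writes hb]; rfl) _ _
    · exact foldl_preserves (fun t : Mem 𝕜 => t.out) _
        (fun t k => by rw [exec_out_of_not_writes hb]; rfl) _ _

/-- A loop around a single assignment to distinct cells of one array. -/
theorem Prog.exec_loop_setFld {a b : ℕ} {e ix : NatExpr} {E : FldExpr} {m : Mem 𝕜} (N : ℕ)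
    (hN : e.eval m.nat = N) (idx : ℕ → ℕ) (F : ℕ → 𝕜)
    (hinj : ∀ k < N, ∀ l < N, idx k = idx l → k = l)
    (hix : ∀ k < N, ix.eval (m.setNat a 0 k).nat = idx k)
    (hE : ∀ k < N, ∀ f : ℕ → ℕ → 𝕜, (∀ c, c ≠ b → f c = m.fld c) →
      f b (idx k) = m.fld b (idx k) → E.eval (m.setNat a 0 k).nat f = F k) :
    (∀ k < N, ((loop a e (setFld b ix E)).exec m).fld b (idx k) = F k) ∧
    ∀ x, (∀ k < N, x ≠ idx k) → ((loop a e (setFld b ix E)).exec m).fld b x = m.fld b x := by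
  -- The counter cell is the only natural number that changes, and overwriting it erases the
  -- difference to `m`.
  have key := Prog.exec_loop (a := a) (p := setFld b ix E) N hN (fun K t =>
    (∀ k < N, (t.setNat a 0 k).nat = (m.setNat a 0 k).nat) ∧
    (∀ k < K, t.fld b (idx k) = F k) ∧
    ∀ x, (∀ k < K, x ≠ idx k) → t.fld b x = m.fld b x) ⟨by simp, by simp, by simp⟩ ?_
  · exact key.2
  · rintro k hk t - hf - ⟨h1, h2, h3⟩
    have hv : E.eval (m.setNat a 0 k).nat t.fld = F k := by
      refine hE k hk _ (fun c hc => hf c ?_) (h3 _ fun l hl h => ?_)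
      · simpa [writesFld] using hc.symm
      · have := hinj k hk l (by omega) h
        omega
    refine ⟨fun l hl => ?_, fun l hl => ?_, fun x hx => ?_⟩
    · have := h1 l hl
      simp only [exec, Mem.setNat, Mem.setFld, Function.update_self] at this ⊢
      simpa using this
    · simp only [exec, Mem.setFld_fld, Mem.setNat_fld, true_and]
      rw [h1 k hk, hix k hk]
      split_ifs with h
      · rw [hv, hinj l (by omega) k hk h]
      · exact h2 l (by by_contra h'; exact h (by rw [show l = k by omega]))
    · simp only [exec, Mem.setFld_fld, Mem.setNat_fld, true_and]
      rw [h1 k hk, hix k hk, if_neg (hx k (by omega))]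
      exact h3 x fun l hl => hx l (by omega)

/-- A loop whose body adds to the field array `b`. -/
theorem Prog.exec_loop_add {a b : ℕ} {e : NatExpr} {p : Prog} {m : Mem 𝕜} (N : ℕ)
    (hN : e.eval m.nat = N) (Δ : ℕ → ℕ → 𝕜) (hb : ∀ c, c ≠ b → p.writesFld c = false)
    (h : ∀ k < N, ∀ t : Mem 𝕜, (∀ c, (loop a e p).writesNat c = false → t.nat c = m.nat c) →
      (∀ c, c ≠ b → t.fld c = m.fld c) → t.nat a 0 = k →
      ∀ x, (p.exec t).fld b x = t.fld b x + Δ k x) (x : ℕ) :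
    ((loop a e p).exec m).fld b x = m.fld b x + ∑ k ∈ Finset.range N, Δ k x := by
  refine Prog.exec_loop (a := a) (p := p) N hN (fun K t =>
    ∀ x, t.fld b x = m.fld b x + ∑ k ∈ Finset.range K, Δ k x) (by simp) ?_ x
  intro k hk t hn hf _ ht x
  rw [Finset.sum_range_succ, ← add_assoc, ← ht]
  refine h k hk (t.setNat a 0 k) (fun c hc => ?_) (fun c hc => hf c (hb c hc)) (by simp) x
  rw [Mem.setNat_nat_of_ne, hn c hc]
  simp only [writesNat, Bool.or_eq_false_iff, beq_eq_false_iff_ne] at hc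
  exact hc.1.symm

/-- The increment is stated for every cell, with an `if`, so that nested loops become nested sums
through `Prog.exec_loop_add`. -/
theorem Prog.exec_setFld_add {b : ℕ} {ix : NatExpr} {E : FldExpr} (m : Mem 𝕜) (x : ℕ) :
    ((setFld b ix (.plus (.get b ix) E)).exec m).fld b x =
      m.fld b x + if x = ix.eval m.nat then E.eval m.nat m.fld else 0 := by
  simp only [exec, Mem.setFld_fld, true_and, FldExpr.eval]
  split_ifs with h
  · rw [h]
  · simp

/-- A loop around a program that is executed only for counters below a bound. -/
theorem Prog.exec_loop_guard {a : ℕ} {e c : NatExpr} {p : Prog} {m : Mem 𝕜} (N L : ℕ)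
    (hN : e.eval m.nat = N) (hL : L ≤ N)
    (hc : ∀ t : Mem 𝕜, (∀ b, (loop a e p).writesNat b = false → t.nat b = m.nat b) →
      c.eval t.nat = L)
    (I : ℕ → Mem 𝕜 → Prop) (h0 : I 0 m)
    (hI : ∀ k v t, I k t → I k (t.setNat a 0 v))
    (hs : ∀ k < L, ∀ t : Mem 𝕜, (∀ b, (loop a e p).writesNat b = false → t.nat b = m.nat b) →
      (∀ b, p.writesFld b = false → t.fld b = m.fld b) →
      (p.writesOut = false → t.out = m.out) → t.nat a 0 = k → I k t → I (k + 1) (p.exec t)) :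
    I L ((loop a e (ifLe c (.get a (.const 0)) skip p)).exec m) := by
  -- Once the counter reaches `L` the body is skipped and the invariant stays at stage `L`; `hI`
  -- absorbs the remaining writes of the counter.
  have key := Prog.exec_loop (a := a) (p := ifLe c (.get a (.const 0)) skip p) (m := m) N hN
    (fun k t => I (min k L) t) (by simpa using h0) ?_
  · simpa [hL] using key
  · intro k hk t hn hf ho ht
    simp only [writesNat, writesFld, writesOut, Bool.false_or] at hn hf ho
    have hn' : ∀ b, (loop a e p).writesNat b = false → (t.setNat a 0 k).nat b = m.nat b := by
      intro b hb
      rw [Mem.setNat_nat_of_ne, hn b hb]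
      simp only [writesNat, Bool.or_eq_false_iff, beq_eq_false_iff_ne] at hb
      exact hb.1.symm
    have h1 : (NatExpr.get a (.const 0)).eval (t.setNat a 0 k).nat = k := by simp
    rw [exec, hc _ hn', h1]
    split_ifs with h
    · rw [min_eq_right h] at ht
      rw [min_eq_right (by omega)]
      exact hI _ _ _ ht
    · rw [min_eq_left (by omega)] at ht
      rw [min_eq_left (by omega)]
      exact hs k (by omega) _ hn' hf ho (by simp) (hI _ _ _ ht)

/-! ### A static bound for the number of steps -/

/-- Whether an expression reads only the natural number arrays `0` and `1`. -/
def NatExpr.static : NatExpr → Bool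
  | const _ => true
  | get a e => decide (a < 2) && e.static
  | plus e₁ e₂ => e₁.static && e₂.static
  | minus e₁ e₂ => e₁.static && e₂.static
  | times e₁ e₂ => e₁.static && e₂.static

/-- Whether a program never writes to the natural number arrays `0` and `1`, and all loop
bounds depend only on these arrays. -/
def Prog.static : Prog → Bool
  | setNat a _ _ => decide (2 ≤ a)
  | seq p q => p.static && q.static
  | ifLe _ _ p q => p.static && q.static
  | ifZero _ p q => p.static && q.static
  | loop a e p => decide (2 ≤ a) && e.static && p.static
  | _ => true

/-- A bound for the number of steps of a static program. -/
def Prog.bound (ν : ℕ → ℕ → ℕ) : Prog → ℕ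
  | skip => 1
  | setNat _ i e => i.cost + e.cost + 1
  | setFld _ i e => i.cost + e.cost + 1
  | outNat e => e.cost + 1
  | outFld e => e.cost + 1
  | seq p q => p.bound ν + q.bound ν
  | ifLe e₁ e₂ p q => e₁.cost + e₂.cost + 1 + (p.bound ν + q.bound ν)
  | ifZero e p q => e.cost + 1 + (p.bound ν + q.bound ν)
  | loop _ e p => e.cost + 1 + e.eval ν * (1 + p.bound ν)

theorem NatExpr.eval_static {e : NatExpr} (he : e.static = true) {ν ν' : ℕ → ℕ → ℕ}
    (h : ∀ a < 2, ν a = ν' a) : e.eval ν = e.eval ν' := by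
  induction e with
  | const k => rfl
  | get a e ih =>
    simp only [static, Bool.and_eq_true, decide_eq_true_eq] at he
    rw [eval, eval, ih he.2, h a he.1]
  | plus e₁ e₂ h₁ h₂ =>
    simp only [static, Bool.and_eq_true] at he
    rw [eval, eval, h₁ he.1, h₂ he.2]
  | minus e₁ e₂ h₁ h₂ =>
    simp only [static, Bool.and_eq_true] at he
    rw [eval, eval, h₁ he.1, h₂ he.2]
  | times e₁ e₂ h₁ h₂ =>
    simp only [static, Bool.and_eq_true] at he
    rw [eval, eval, h₁ he.1, h₂ he.2]

/-- A static program never writes the arrays that its loop bounds read, so every loop count is known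
from the input; at each test both branches are charged. For this reason the loops of the program run
over a full range and skip by a guard. -/
theorem Prog.time_run_le {p : Prog} (hp : p.static = true) (ν : ℕ → ℕ → ℕ) (s : State 𝕜)
    (hs : ∀ a < 2, s.nat a = ν a) :
    (∀ a < 2, (p.run s).nat a = ν a) ∧ (p.run s).time ≤ s.time + p.bound ν := by
  induction p generalizing s with
  | skip => exact ⟨hs, le_rfl⟩
  | setNat a i e =>
    refine ⟨fun b hb => ?_, le_rfl⟩
    simp only [static, decide_eq_true_eq] at hp
    rw [← hs b hb]
    simp [run, State.tick, State.writeNat, show b ≠ a by omega]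
  | setFld a i e => exact ⟨hs, le_rfl⟩
  | outNat e => exact ⟨hs, le_rfl⟩
  | outFld e => exact ⟨hs, le_rfl⟩
  | seq p q ihp ihq =>
    simp only [static, Bool.and_eq_true] at hp
    obtain ⟨h1, h2⟩ := ihp hp.1 s hs
    obtain ⟨h3, h4⟩ := ihq hp.2 _ h1
    refine ⟨h3, h4.trans ?_⟩
    rw [bound]
    omega
  | ifLe e₁ e₂ p q ihp ihq =>
    simp only [static, Bool.and_eq_true] at hp
    rw [run, bound]
    split_ifs
    · obtain ⟨h1, h2⟩ := ihp hp.1 (s.tick (e₁.cost + e₂.cost + 1)) hs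
      refine ⟨h1, h2.trans ?_⟩
      simp only [State.tick]
      omega
    · obtain ⟨h1, h2⟩ := ihq hp.2 (s.tick (e₁.cost + e₂.cost + 1)) hs
      refine ⟨h1, h2.trans ?_⟩
      simp only [State.tick]
      omega
  | ifZero e p q ihp ihq =>
    simp only [static, Bool.and_eq_true] at hp
    rw [run, bound]
    split_ifs
    · obtain ⟨h1, h2⟩ := ihp hp.1 (s.tick (e.cost + 1)) hs
      refine ⟨h1, h2.trans ?_⟩
      simp only [State.tick]
      omega
    · obtain ⟨h1, h2⟩ := ihq hp.2 (s.tick (e.cost + 1)) hs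
      refine ⟨h1, h2.trans ?_⟩
      simp only [State.tick]
      omega
  | loop a e p ih =>
    simp only [static, Bool.and_eq_true, decide_eq_true_eq] at hp
    rw [run, bound, NatExpr.eval_static hp.1.2 hs]
    have key : ∀ (l : List ℕ) (t : State 𝕜), (∀ b < 2, t.nat b = ν b) →
        (∀ b < 2, (l.foldl (fun t k => p.run ((t.writeNat a 0 k).tick 1)) t).nat b = ν b) ∧
        (l.foldl (fun t k => p.run ((t.writeNat a 0 k).tick 1)) t).time ≤
          t.time + l.length * (1 + p.bound ν) := by
      intro l
      induction l with
      | nil => exact fun t ht => ⟨ht, by simp⟩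
      | cons k l ihl =>
        intro t ht
        obtain ⟨h1, h2⟩ := ih hp.2 ((t.writeNat a 0 k).tick 1) fun b hb => by
          rw [← ht b hb]
          simp [State.tick, State.writeNat, show b ≠ a by omega]
        obtain ⟨h3, h4⟩ := ihl _ h1
        refine ⟨h3, h4.trans ?_⟩
        simp only [State.tick, State.writeNat] at h2
        rw [List.length_cons, add_mul, one_mul]
        simp only [State.tick, State.writeNat]
        omega
    obtain ⟨h1, h2⟩ := key (List.range (e.eval ν)) (s.tick (e.cost + 1)) hs
    refine ⟨h1, h2.trans ?_⟩
    rw [List.length_range, State.tick]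
    simp only
    omega

end Semantics

end CrossGramian

namespace CrossGramian

/-! ### The program -/

namespace Alg

open NatExpr

/-- The value of the scalar variable `a`. -/
abbrev var (a : ℕ) : NatExpr := get a (const 0)

/-- `n r`, the size of the Gramian. -/
abbrev eN : NatExpr := times (var 1) (var 0)

/-- `n r r`, the number of entries of a block column. -/
abbrev eM : NatExpr := times eN (var 0)

/-- The length `n r r + 2` of a path record. -/
abbrev eS : NatExpr := plus eM (const 2)

/-- Index of the entry `x` of the `e`-th vector. -/
abbrev vecIx (e x : NatExpr) : NatExpr := plus (times e eM) x

/-- Index of the entry `c` of the `e`-th path. -/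
abbrev pathIx (e c : NatExpr) : NatExpr := plus (times e eS) c

/-- Index of the entry `(p, q)` of a block column. -/
abbrev colIx (p q : NatExpr) : NatExpr := plus (times p (var 0)) q

/-- Add to a field array. -/
abbrev addFld (a : ℕ) (ix : NatExpr) (E : FldExpr) : Prog := .setFld a ix (.plus (.get a ix) E)

/-- Index of the row `p` in the block `i`. -/
abbrev rowIx (i p : NatExpr) : NatExpr := plus (times i (var 0)) p

abbrev zeroW : Prog := .loop 7 eM (.setFld 1 (var 7) .zero)

abbrev oneW : Prog := .loop 9 (var 0) (.setFld 1 (colIx (rowIx (var 2) (var 9)) (var 9)) .one)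

abbrev copyWB : Prog := .loop 7 eM (.setFld 2 (var 7) (.get 1 (var 7)))

/-- Start with the path `[i, i]`. -/
def start : Prog :=
  .seq zeroW <| .seq oneW <| .seq copyWB <|
  .seq (.setNat 3 (const 0) (const 1)) <| .seq (.setNat 11 (const 0) (const 1)) <|
  .seq (.setNat 12 (const 0) (var 2)) (.setNat 12 (const 1) (var 2))

/-- Compute the block column of the path obtained by prepending `k` to the `e`-th path. -/
def candidate : Prog :=
  .seq (.loop 7 eM (.setFld 3 (var 7) .zero)) <|
  .loop 8 (var 0) <| .loop 9 (var 0) <| .loop 10 eN <|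
    addFld 3 (colIx (rowIx (var 5) (var 8)) (var 9))
      (.times (.get 0 (plus (times (rowIx (var 5) (var 8)) eN) (var 10)))
        (.get 1 (vecIx (var 4) (colIx (var 10) (var 9)))))

/-- Subtract from `u` its component along the `l`-th orthogonal vector. -/
def project : Prog :=
  .seq (.setFld 5 (const 0) .zero) <| .seq (.setFld 6 (const 0) .zero) <|
  .seq (.loop 7 eM (addFld 5 (const 0)
    (.times (.conj (.get 2 (vecIx (var 6) (var 7)))) (.get 4 (var 7))))) <|
  .seq (.loop 7 eM (addFld 6 (const 0)
    (.times (.conj (.get 2 (vecIx (var 6) (var 7)))) (.get 2 (vecIx (var 6) (var 7)))))) <|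
  .loop 7 eM (.setFld 4 (var 7) (.minus (.get 4 (var 7))
    (.times (.divide (.get 5 (const 0)) (.get 6 (const 0))) (.get 2 (vecIx (var 6) (var 7))))))

/-- Compute the component `u` of the candidate orthogonal to all recorded vectors. -/
def residual : Prog :=
  .seq (.loop 7 eM (.setFld 4 (var 7) (.get 3 (var 7))))
    (.loop 6 eM (.ifLe (var 3) (var 6) .skip project))

/-- The squared norm of `u`. -/
def normSq : Prog :=
  .seq (.setFld 6 (const 0) .zero)
    (.loop 7 eM (addFld 6 (const 0) (.times (.conj (.get 4 (var 7))) (.get 4 (var 7)))))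

/-- Record the candidate. -/
def append : Prog :=
  .seq (.loop 7 eM (.setFld 1 (vecIx (var 3) (var 7)) (.get 3 (var 7)))) <|
  .seq (.loop 7 eM (.setFld 2 (vecIx (var 3) (var 7)) (.get 4 (var 7)))) <|
  .seq (.loop 14 eS (.setNat 12 (pathIx (var 3) (var 14))
    (get 12 (pathIx (var 4) (var 14))))) <|
  .seq (.setNat 12 (pathIx (var 3) (plus (get 11 (var 4)) (const 1))) (var 5)) <|
  .seq (.setNat 11 (var 3) (plus (get 11 (var 4)) (const 1)))
    (.setNat 3 (const 0) (plus (var 3) (const 1)))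

/-- Prepend `k` to the `e`-th path, and record the result if it is independent. -/
def tryAppend : Prog :=
  .seq candidate <| .seq residual <| .seq normSq (.ifZero (.get 6 (const 0)) .skip append)

/-- Find all paths. -/
def search : Prog :=
  .loop 4 eM (.loop 5 (var 1) (.ifLe (var 3) (var 4) .skip tryAppend))

/-- Output the word of the path at `e`. -/
def outWord (e : NatExpr) : Prog :=
  .loop 14 eS (.ifLe (get 11 e) (var 14) .skip
    (.seq (.outNat (get 12 (minus (pathIx e (get 11 e)) (var 14))))
      (.outNat (get 12 (minus (pathIx e (get 11 e)) (plus (var 14) (const 1)))))))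

/-- Output the adjoint of the word of the path at `e`. -/
def outAdjWord (e : NatExpr) : Prog :=
  .loop 14 eS (.ifLe (get 11 e) (var 14) .skip
    (.seq (.outNat (get 12 (pathIx e (var 14))))
      (.outNat (get 12 (pathIx e (plus (var 14) (const 1)))))))

/-- Compute the trace of the word of the `e`-th path. -/
def traceWord : Prog :=
  .seq (.setFld 7 (const 0) .zero) <|
  .loop 9 (var 0) (addFld 7 (const 0)
    (.get 1 (vecIx (var 4) (colIx (rowIx (var 2) (var 9)) (var 9)))))

/-- Compute the trace of the product of the adjoint of the `s`-th word, the letter joining the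
two words, and the `e`-th word. -/
def tracePair : Prog :=
  .seq (.setFld 7 (const 0) .zero) <|
  .loop 8 eN <| .loop 10 eN <| .loop 9 (var 0) <| addFld 7 (const 0)
    (.times (.times (.conj (.get 1 (vecIx (var 13) (colIx (var 8) (var 9)))))
      (.get 0 (plus (times (var 8) eN) (var 10))))
      (.get 1 (vecIx (var 4) (colIx (var 10) (var 9)))))

/-- Output the word of the `e`-th path and its trace. -/
def outSingle : Prog :=
  .seq (outWord (var 4)) <| .seq traceWord (.outFld (.get 7 (const 0)))

/-- Output the word made of the paths `s` and `e`, and its trace. -/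
def outPair : Prog :=
  .seq (outAdjWord (var 13)) <|
  .seq (.outNat (get 12 (pathIx (var 13) (get 11 (var 13))))) <|
  .seq (.outNat (get 12 (pathIx (var 4) (get 11 (var 4))))) <|
  .seq (outWord (var 4)) <| .seq tracePair (.outFld (.get 7 (const 0)))

/-- Output all words and traces for the current end vertex. -/
def report : Prog :=
  .loop 4 eM (.ifLe (var 3) (var 4) .skip
    (.seq outSingle (.loop 13 eM (.ifLe (var 3) (var 13) .skip outPair))))

/-- The whole program. -/
def main : Prog := .loop 2 (var 1) (.seq start (.seq search report))

theorem static_main : main.static = true := by decide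

/-- The bound is a polynomial in `n` and `r` with small coefficients. Its leading term comes from
`tracePair`: `n² r³` products for each of `n` end vertices and `(n r²)²` pairs of paths, that is `n⁵
r⁷`. Each monomial is treated as an atom bounded by `T`, and `10000` exceeds the sum of the
coefficients. -/
theorem bound_main_le_of_le (ν : ℕ → ℕ → ℕ) {r n T : ℕ} (hr : ν 0 0 = r) (hn : ν 1 0 = n)
    (hm : ∀ a b, a ≤ 5 → b ≤ 8 → n ^ a * r ^ b ≤ T) : main.bound ν ≤ 10000 * T := by
  simp only [main, start, search, report, outSingle, outPair, outWord, outAdjWord, tracePair,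
    traceWord, tryAppend, append, normSq, residual, project, candidate, Prog.bound, NatExpr.cost,
    FldExpr.cost, NatExpr.eval, hr, hn]
  have e0 := hm 0 0 (by norm_num) (by norm_num)
  have e1 := hm 1 0 (by norm_num) (by norm_num)
  have e2 := hm 1 1 (by norm_num) (by norm_num)
  have e3 := hm 2 2 (by norm_num) (by norm_num)
  have e4 := hm 2 3 (by norm_num) (by norm_num)
  have e5 := hm 3 2 (by norm_num) (by norm_num)
  have e6 := hm 3 3 (by norm_num) (by norm_num)
  have e7 := hm 3 4 (by norm_num) (by norm_num)
  have e8 := hm 4 4 (by norm_num) (by norm_num)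
  have e9 := hm 4 5 (by norm_num) (by norm_num)
  have e10 := hm 4 6 (by norm_num) (by norm_num)
  have e11 := hm 5 4 (by norm_num) (by norm_num)
  have e12 := hm 5 5 (by norm_num) (by norm_num)
  have e13 := hm 5 6 (by norm_num) (by norm_num)
  have e14 := hm 5 7 (by norm_num) (by norm_num)
  ring_nf at e0 e1 e2 e3 e4 e5 e6 e7 e8 e9 e10 e11 e12 e13 e14 ⊢
  omega

theorem bound_main_le (ν : ℕ → ℕ → ℕ) {r n : ℕ} (hr : ν 0 0 = r) (hn : ν 1 0 = n) (h1 : 1 ≤ r)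
    (h2 : 1 ≤ n) : main.bound ν ≤ 10000 * (r ^ 8 * n ^ 5 + r ^ 9 * n ^ 3) := by
  refine bound_main_le_of_le ν hr hn fun a b ha hb => ?_
  calc n ^ a * r ^ b ≤ n ^ 5 * r ^ 8 :=
        Nat.mul_le_mul (Nat.pow_le_pow_right h2 ha) (Nat.pow_le_pow_right h1 hb)
    _ = r ^ 8 * n ^ 5 := mul_comm _ _
    -- The first summand alone dominates; the second is slack.
    _ ≤ _ := Nat.le_add_right _ _

end Alg

end CrossGramian

namespace CrossGramian

/-! ### Flat indices -/

section Index

variable {n r : ℕ}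

/-- The flat index of a row. -/
def rowIdx (p : Fin n × Fin r) : ℕ := p.1 * r + p.2

/-- The flat index of an entry of a block column. -/
def colIdx (κ : (Fin n × Fin r) × Fin r) : ℕ := rowIdx κ.1 * r + κ.2

theorem rowIdx_eq (p : Fin n × Fin r) : rowIdx p = (finProdFinEquiv p : ℕ) := by
  rw [rowIdx, finProdFinEquiv_apply_val]
  ring

theorem colIdx_eq (κ : (Fin n × Fin r) × Fin r) :
    colIdx κ = (finProdFinEquiv (finProdFinEquiv κ.1, κ.2) : ℕ) := by
  rw [colIdx, finProdFinEquiv_apply_val, rowIdx_eq]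
  ring

theorem colIdx_lt (κ : (Fin n × Fin r) × Fin r) : colIdx κ < n * r * r := by
  rw [colIdx_eq]; exact (finProdFinEquiv (finProdFinEquiv κ.1, κ.2)).2

theorem colIdx_injective : Function.Injective (colIdx : (Fin n × Fin r) × Fin r → ℕ) := by
  intro κ l h
  rw [colIdx_eq, colIdx_eq] at h
  have := finProdFinEquiv.injective (Fin.ext h)
  simp only [Prod.mk.injEq, EmbeddingLike.apply_eq_iff_eq] at this
  exact Prod.ext this.1 this.2

theorem sum_range_rowIdx {A : Type*} [AddCommMonoid A] (F : ℕ → A) :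
    ∑ x ∈ Finset.range (n * r), F x = ∑ p : Fin n × Fin r, F (rowIdx p) := by
  rw [← Fin.sum_univ_eq_sum_range, ← Equiv.sum_comp finProdFinEquiv]
  simp only [rowIdx_eq]

theorem sum_range_colIdx {A : Type*} [AddCommMonoid A] (F : ℕ → A) :
    ∑ x ∈ Finset.range (n * r * r), F x = ∑ κ : (Fin n × Fin r) × Fin r, F (colIdx κ) := by
  rw [← Fin.sum_univ_eq_sum_range, ← Equiv.sum_comp finProdFinEquiv,
    ← Equiv.sum_comp (finProdFinEquiv.prodCongr (Equiv.refl (Fin r)))]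
  simp only [colIdx_eq]
  rfl

end Index

/-! ### Block columns in memory: the initial path and the candidate column -/

section Fragments

variable {𝕜 : Type*} [RCLike 𝕜] {r n : ℕ}

theorem Prog.exec_seq (p q : Prog) (m : Mem 𝕜) : (seq p q).exec m = q.exec (p.exec m) := rfl

theorem Prog.exec_setNat (a : ℕ) (i e : NatExpr) (m : Mem 𝕜) :
    (Prog.setNat a i e).exec m = m.setNat a (i.eval m.nat) (e.eval m.nat) := rfl

theorem Prog.exec_setFld (a : ℕ) (i : NatExpr) (e : FldExpr) (m : Mem 𝕜) :
    (Prog.setFld a i e).exec m = m.setFld a (i.eval m.nat) (e.eval m.nat m.fld) := rfl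

theorem Prog.exec_outNat (e : NatExpr) (m : Mem 𝕜) :
    (Prog.outNat e).exec m = m.emit (Sum.inl (e.eval m.nat)) := rfl

theorem Prog.exec_outFld (e : FldExpr) (m : Mem 𝕜) :
    (Prog.outFld e).exec m = m.emit (Sum.inr (e.eval m.nat m.fld)) := rfl

/-- The input parameters `r` and `n` are in place. -/
structure Sized (r n : ℕ) (m : Mem 𝕜) : Prop where
  rank : m.nat 0 0 = r
  num : m.nat 1 0 = n

omit [RCLike 𝕜] in
theorem Sized.of_eq {m t : Mem 𝕜} (h : Sized r n m) (h0 : t.nat 0 = m.nat 0)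
    (h1 : t.nat 1 = m.nat 1) : Sized r n t :=
  ⟨by rw [h0, h.rank], by rw [h1, h.num]⟩

theorem Sized.exec {m : Mem 𝕜} (h : Sized r n m) {p : Prog} (h0 : p.writesNat 0 = false)
    (h1 : p.writesNat 1 = false) : Sized r n (p.exec m) :=
  ⟨by rw [Prog.exec_nat_of_not_writes h0, h.rank], by rw [Prog.exec_nat_of_not_writes h1, h.num]⟩

/-- The array `f` holds the block column `v` from index `o` on. -/
def Holds (f : ℕ → 𝕜) (o : ℕ) (v : (Fin n × Fin r) × Fin r → 𝕜) : Prop :=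
  ∀ κ, f (o + colIdx κ) = v κ

/-- The array `f` holds the matrix `G`. -/
def HoldsMat (f : ℕ → 𝕜) (G : Matrix (Fin n × Fin r) (Fin n × Fin r) 𝕜) : Prop :=
  ∀ p q, f (rowIdx p * (n * r) + rowIdx q) = G p q

namespace Alg

/-- The block column of the identity matrix. -/
def unitCol (𝕜 : Type*) [RCLike 𝕜] (r : ℕ) {n : ℕ} (i : Fin n) : (Fin n × Fin r) × Fin r → 𝕜 :=
  fun κ => if κ.1 = (i, κ.2) then 1 else 0

/-- The block column of `Π_i` serves both as the first recorded word and as the first vector of the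
orthogonal family. -/
theorem start_spec {m : Mem 𝕜} (hm : Sized r n m) {i : Fin n} (hi : m.nat 2 0 = i) :
    (start.exec m).nat 3 0 = 1 ∧ (start.exec m).nat 11 0 = 1 ∧ (start.exec m).nat 12 0 = i ∧
      (start.exec m).nat 12 1 = i ∧ Holds ((start.exec m).fld 1) 0 (unitCol 𝕜 r i) ∧
      Holds ((start.exec m).fld 2) 0 (unitCol 𝕜 r i) := by
  have hr := hm.rank
  have hn := hm.num
  simp only [start, Prog.exec_seq]
  set m₁ := zeroW.exec m with hm₁
  have hi₁ : m₁.nat 2 0 = i := by rw [hm₁, Prog.exec_nat_of_not_writes (by decide), hi]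
  have hs₁ : Sized r n m₁ := hm.exec (by decide) (by decide)
  have hr₁ := hs₁.rank
  have f₁ : ∀ x < n * r * r, m₁.fld 1 x = 0 := by
    refine (Prog.exec_loop_setFld (n * r * r) (by simp [hr, hn]) id (fun _ => 0)
      (fun _ _ _ _ h => h) (by simp) (by simp)).1
  clear_value m₁
  set m₂ := oneW.exec m₁ with hm₂
  have hi₂ : m₂.nat 2 0 = i := by rw [hm₂, Prog.exec_nat_of_not_writes (by decide), hi₁]
  have hs₂ : Sized r n m₂ := hs₁.exec (by decide) (by decide)
  have hr₂ := hs₂.rank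
  have hn₂ := hs₂.num
  have f₂ := Prog.exec_loop_setFld (m := m₁) (a := 9) (b := 1) (e := var 0)
    (ix := colIx (rowIx (var 2) (var 9)) (var 9)) (E := .one) r (by simp [hr₁])
    (fun q => (i * r + q) * r + q) (fun _ => 1)
    (fun k hk l hl h => by
      have := @colIdx_injective n r ((i, ⟨k, hk⟩), ⟨k, hk⟩) ((i, ⟨l, hl⟩), ⟨l, hl⟩) h
      simpa using this) (by simp [hi₁, hr₁]) (by simp)
  have h₂ : Holds (m₂.fld 1) 0 (unitCol 𝕜 r i) := by
    rintro ⟨⟨k, a⟩, q⟩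
    rw [zero_add, unitCol]
    split_ifs with h
    · simp only [Prod.mk.injEq] at h
      obtain ⟨rfl, rfl⟩ := h
      exact f₂.1 a a.2
    · refine (f₂.2 _ fun q' hq' h' => h ?_).trans (f₁ _ (colIdx_lt _))
      have := @colIdx_injective n r ((k, a), q) ((i, ⟨q', hq'⟩), ⟨q', hq'⟩) h'
      simp only [Prod.mk.injEq] at this ⊢
      refine ⟨this.1.1, this.1.2.trans this.2.symm⟩
  clear_value m₂
  set m₃ := copyWB.exec m₂ with hm₃
  have hi₃ : m₃.nat 2 0 = i := by rw [hm₃, Prog.exec_nat_of_not_writes (by decide), hi₂]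
  have hf₃ : m₃.fld 1 = m₂.fld 1 := Prog.exec_fld_of_not_writes (by decide) _
  have f₃ : ∀ x < n * r * r, m₃.fld 2 x = m₂.fld 1 x := by
    refine (Prog.exec_loop_setFld (n * r * r) (by simp [hr₂, hn₂]) id (fun x => m₂.fld 1 x)
      (fun _ _ _ _ h => h) (by simp) ?_).1
    intro k hk f hf _
    simp [hf 1 (by decide)]
  clear_value m₃
  simp only [Prog.exec_setNat]
  refine ⟨by simp, by simp, by simp [hi₃], by simp [hi₃], ?_, ?_⟩
  · simpa [hf₃] using h₂
  · intro κ
    rw [← h₂ κ]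
    simpa using f₃ _ (colIdx_lt κ)

/-- Left multiplication by `Π_k` kills all rows outside block `k`, so only the `r` rows of that
block are computed and the others keep the value zero. This takes `n r³` products. -/
theorem candidate_spec {m : Mem 𝕜} (hm : Sized r n m) {k : Fin n} (hk : m.nat 5 0 = k) {e : ℕ}
    (he : m.nat 4 0 = e) {G : Matrix (Fin n × Fin r) (Fin n × Fin r) 𝕜}
    (hG : HoldsMat (m.fld 0) G) {X : Matrix (Fin n × Fin r) (Fin r) 𝕜}
    (hX : Holds (m.fld 1) (e * (n * r * r)) (fun κ => X κ.1 κ.2)) :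
    Holds ((candidate.exec m).fld 3) 0 
      (fun κ => (blockProj 𝕜 k * G * X : Matrix (Fin n × Fin r) (Fin r) 𝕜) κ.1 κ.2) := by
  have hr := hm.rank
  have hn := hm.num
  simp only [candidate, Prog.exec_seq]
  set m₁ := Prog.exec (.loop 7 eM (.setFld 3 (var 7) .zero)) m with hm₁
  have hs₁ : Sized r n m₁ := hm.exec (by decide) (by decide)
  have hk₁ : m₁.nat 5 0 = k := by rw [hm₁, Prog.exec_nat_of_not_writes (by decide), hk]
  have he₁ : m₁.nat 4 0 = e := by rw [hm₁, Prog.exec_nat_of_not_writes (by decide), he]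
  have hG₁ : m₁.fld 0 = m.fld 0 := Prog.exec_fld_of_not_writes (by decide) _
  have hW₁ : m₁.fld 1 = m.fld 1 := Prog.exec_fld_of_not_writes (by decide) _
  have f₁ : ∀ x < n * r * r, m₁.fld 3 x = 0 := by
    refine (Prog.exec_loop_setFld (n * r * r) (by simp [hr, hn]) id (fun _ => 0)
      (fun _ _ _ _ h => h) (by simp) (by simp)).1
  clear_value m₁
  rw [← hG₁] at hG
  rw [← hW₁] at hX
  have key := Prog.exec_loop_add (m := m₁) (a := 8) (b := 3) (e := var 0) (p :=
    .loop 9 (var 0) <| .loop 10 eN <|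
    addFld 3 (colIx (rowIx (var 5) (var 8)) (var 9))
      (.times (.get 0 (.plus (.times (rowIx (var 5) (var 8)) eN) (var 10)))
        (.get 1 (vecIx (var 4) (colIx (var 10) (var 9)))))) r (by simp [hs₁.rank])
    (fun p x => ∑ q ∈ Finset.range r, ∑ s ∈ Finset.range (n * r),
      if x = (k * r + p) * r + q then m₁.fld 0 ((k * r + p) * (n * r) + s) *
        m₁.fld 1 (e * (n * r * r) + (s * r + q)) else 0)
    (by intro c hc; simp [Prog.writesFld, hc.symm]) ?_
  · rintro ⟨⟨k', a⟩, q⟩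
    rw [zero_add, key, f₁ _ (colIdx_lt _), zero_add]
    beta_reduce
    rw [blockProj, Matrix.mul_assoc, Matrix.diagonal_mul]
    simp only
    split_ifs with h
    · subst h
      -- By injectivity of `colIdx`, only the terms with the row and the column of this cell
      -- contribute to it.
      rw [Finset.sum_eq_single a.1, Finset.sum_eq_single q.1, one_mul, Matrix.mul_apply,
        sum_range_rowIdx]
      · refine Finset.sum_congr rfl fun s _ => ?_
        exact (if_pos rfl).trans (congrArg₂ (· * ·) (hG (k', a) s) (hX (s, q)))
      · intro q' hq' hne
        refine Finset.sum_eq_zero fun s _ => if_neg fun h => hne ?_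
        have := @colIdx_injective n r ((k', a), q) ((k', a), ⟨q', by simpa using hq'⟩) h
        simp only [Prod.mk.injEq, true_and, Fin.ext_iff] at this
        exact this.symm
      · simp
      · intro a' ha' hne
        refine Finset.sum_eq_zero fun q' hq' => Finset.sum_eq_zero fun s _ =>
          if_neg fun h => hne ?_
        have := @colIdx_injective n r ((k', a), q) ((k', ⟨a', by simpa using ha'⟩),
          ⟨q', by simpa using hq'⟩) h
        simp only [Prod.mk.injEq, true_and, Fin.ext_iff] at this
        exact this.1.symm
      · simp
    · rw [zero_mul]
      refine Finset.sum_eq_zero fun a' ha' => Finset.sum_eq_zero fun q' hq' =>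
        Finset.sum_eq_zero fun s _ => if_neg fun h' => h ?_
      have := @colIdx_injective n r ((k', a), q) ((k, ⟨a', by simpa using ha'⟩),
          ⟨q', by simpa using hq'⟩) h'
      simp only [Prod.mk.injEq] at this
      exact this.1.1
  · intro p hp t ht hf hpt
    have hs_t := hs₁.of_eq (ht 0 (by decide)) (ht 1 (by decide))
    refine Prog.exec_loop_add (m := t) r (by simp [hs_t.rank]) _
      (by intro c hc; simp [Prog.writesFld, hc.symm]) ?_
    intro q hq u hu hfu hqu
    have hs_u := hs_t.of_eq (hu 0 (by decide)) (hu 1 (by decide))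
    refine Prog.exec_loop_add (m := u) (n * r) (by simp [hs_u.rank, hs_u.num]) _
      (by intro c hc; simp [Prog.writesFld, hc.symm]) ?_
    intro s hs w hw hfw hsw x
    have hs_w := hs_u.of_eq (hw 0 (by decide)) (hw 1 (by decide))
    rw [Prog.exec_setFld_add]
    have g5 : w.nat 5 0 = k := by
      rw [hw 5 (by decide), hu 5 (by decide), ht 5 (by decide), hk₁]
    have g4 : w.nat 4 0 = e := by
      rw [hw 4 (by decide), hu 4 (by decide), ht 4 (by decide), he₁]
    have g8 : w.nat 8 0 = p := by rw [hw 8 (by decide), hu 8 (by decide), hpt]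
    have g9 : w.nat 9 0 = q := by rw [hw 9 (by decide), hqu]
    have gf0 : w.fld 0 = m₁.fld 0 := by
      rw [hfw 0 (by decide), hfu 0 (by decide), hf 0 (by decide)]
    have gf1 : w.fld 1 = m₁.fld 1 := by
      rw [hfw 1 (by decide), hfu 1 (by decide), hf 1 (by decide)]
    simp [hs_w.rank, hs_w.num, g5, g4, g8, g9, hsw, gf0, gf1]

end Alg

end Fragments

end CrossGramian

/-! ### Orthogonal projection and the recording of a path in memory -/

namespace CrossGramian

open Matrix in
/-- Subtract from `u` its component along `b`. -/
noncomputable def reduce {𝕜 κ : Type*} [RCLike 𝕜] [Fintype κ] (u b : κ → 𝕜) : κ → 𝕜 :=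
  u - ((star b ⬝ᵥ u) / (star b ⬝ᵥ b)) • b

namespace Alg

open Matrix

variable {𝕜 : Type*} [RCLike 𝕜] {r n : ℕ}

/-- Covers the two inner products of `project` and that of `normSq`; the offsets are arbitrary so
that recorded vectors and the work vector are treated alike. -/
theorem dot_spec {m : Mem 𝕜} (hm : Sized r n m) {a b : ℕ} {e₁ e₂ : NatExpr} {o₁ o₂ c : ℕ}
    {u v : (Fin n × Fin r) × Fin r → 𝕜}
    (hc₁ : a ≠ c) (hc₂ : b ≠ c) (hu : Holds (m.fld a) o₁ u) (hv : Holds (m.fld b) o₂ v)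
    (h₁ : ∀ t : Mem 𝕜, (∀ c, c ≠ 7 → t.nat c = m.nat c) →
      e₁.eval t.nat = o₁ + t.nat 7 0)
    (h₂ : ∀ t : Mem 𝕜, (∀ c, c ≠ 7 → t.nat c = m.nat c) →
      e₂.eval t.nat = o₂ + t.nat 7 0) :
    ((Prog.loop 7 eM (addFld c (.const 0)
      (.times (.conj (.get a e₁)) (.get b e₂)))).exec m).fld c 0 =
      m.fld c 0 + star u ⬝ᵥ v := by
  rw [Prog.exec_loop_add (n * r * r) (by simp [hm.rank, hm.num])
    (fun k x => if x = 0 then star (m.fld a (o₁ + k)) * m.fld b (o₂ + k) else 0)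
    (by intro c hc; simp [Prog.writesFld, hc.symm]) ?_ 0]
  · simp only [if_true, sum_range_colIdx, dotProduct]
    congr 1
    exact Finset.sum_congr rfl fun κ _ => by rw [hu, hv, Pi.star_apply]
  · intro k hk t ht hf htk x
    have ht' : ∀ c, c ≠ 7 → t.nat c = m.nat c := by
      intro c hc
      exact ht c (by simp [Prog.writesNat, hc.symm])
    rw [Prog.exec_setFld_add]
    simp [h₁ t ht', h₂ t ht', htk, hf a hc₁, hf b hc₂]

theorem project_spec {m : Mem 𝕜} (hm : Sized r n m) {l : ℕ} (hl : m.nat 6 0 = l)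
    {u b : (Fin n × Fin r) × Fin r → 𝕜} (hu : Holds (m.fld 4) 0 u)
    (hb : Holds (m.fld 2) (l * (n * r * r)) b) :
    Holds ((project.exec m).fld 4) 0 (reduce u b) := by
  simp only [project, Prog.exec_seq]
  set m₁ := Prog.exec (.setFld 6 (.const 0) .zero) (Prog.exec (.setFld 5 (.const 0) .zero) m)
    with hm₁
  have hs₁ : Sized r n m₁ := hm.of_eq rfl rfl
  have hl₁ : m₁.nat 6 0 = l := hl
  have c₁ : m₁.fld 5 0 = 0 := by simp [hm₁, Prog.exec_setFld]
  have d₁ : m₁.fld 6 0 = 0 := by simp [hm₁, Prog.exec_setFld]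
  have hu₁ : Holds (m₁.fld 4) 0 u := by
    intro κ; rw [← hu κ]; simp [hm₁, Prog.exec_setFld]
  have hb₁ : Holds (m₁.fld 2) (l * (n * r * r)) b := by
    intro κ; rw [← hb κ]; simp [hm₁, Prog.exec_setFld]
  clear_value m₁
  set m₂ := Prog.exec (.loop 7 eM (addFld 5 (.const 0)
    (.times (.conj (.get 2 (vecIx (var 6) (var 7)))) (.get 4 (var 7))))) m₁ with hm₂
  have hs₂ : Sized r n m₂ := hs₁.exec (by decide) (by decide)
  have hl₂ : m₂.nat 6 0 = l := by rw [hm₂, Prog.exec_nat_of_not_writes (by decide), hl₁]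
  have c₂ : m₂.fld 5 0 = star b ⬝ᵥ u := by
    rw [hm₂, dot_spec hs₁ (by decide) (by decide) hb₁ hu₁ ?_ ?_, c₁, zero_add]
    · intro t ht
      simp [ht 6 (by decide), ht 0 (by decide), ht 1 (by decide), hl₁, hs₁.rank, hs₁.num]
    · intro t ht
      simp
  have d₂ : m₂.fld 6 0 = 0 := by rw [hm₂, Prog.exec_fld_of_not_writes (by decide), d₁]
  have hu₂ : Holds (m₂.fld 4) 0 u := by
    rw [hm₂, Prog.exec_fld_of_not_writes (by decide)]; exact hu₁
  have hb₂ : Holds (m₂.fld 2) (l * (n * r * r)) b := by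
    rw [hm₂, Prog.exec_fld_of_not_writes (by decide)]; exact hb₁
  clear_value m₂
  set m₃ := Prog.exec (.loop 7 eM (addFld 6 (.const 0)
    (.times (.conj (.get 2 (vecIx (var 6) (var 7)))) (.get 2 (vecIx (var 6) (var 7)))))) m₂
    with hm₃
  have hs₃ : Sized r n m₃ := hs₂.exec (by decide) (by decide)
  have hl₃ : m₃.nat 6 0 = l := by rw [hm₃, Prog.exec_nat_of_not_writes (by decide), hl₂]
  have d₃ : m₃.fld 6 0 = star b ⬝ᵥ b := by
    rw [hm₃, dot_spec hs₂ (by decide) (by decide) hb₂ hb₂ ?_ ?_, d₂, zero_add]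
    all_goals
      intro t ht
      simp [ht 6 (by decide), ht 0 (by decide), ht 1 (by decide), hl₂, hs₂.rank, hs₂.num]
  have c₃ : m₃.fld 5 0 = star b ⬝ᵥ u := by
    rw [hm₃, Prog.exec_fld_of_not_writes (by decide), c₂]
  have hu₃ : Holds (m₃.fld 4) 0 u := by
    rw [hm₃, Prog.exec_fld_of_not_writes (by decide)]; exact hu₂
  have hb₃ : Holds (m₃.fld 2) (l * (n * r * r)) b := by
    rw [hm₃, Prog.exec_fld_of_not_writes (by decide)]; exact hb₂
  clear_value m₃
  have key := (Prog.exec_loop_setFld (m := m₃) (a := 7) (b := 4) (e := eM) (ix := var 7)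
    (E := .minus (.get 4 (var 7)) (.times (.divide (.get 5 (.const 0)) (.get 6 (.const 0)))
      (.get 2 (vecIx (var 6) (var 7))))) (n * r * r) (by simp [hs₃.rank, hs₃.num]) id
    (fun x => m₃.fld 4 x - star b ⬝ᵥ u / star b ⬝ᵥ b * m₃.fld 2 (l * (n * r * r) + x))
    (fun _ _ _ _ h => h) (by simp) ?_).1
  · intro κ
    rw [zero_add]
    refine (key _ (colIdx_lt κ)).trans ?_
    rw [hb₃ κ, ← zero_add (colIdx κ), hu₃ κ]
    rfl
  · intro k hk f hf hfk
    simp only [id] at hfk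
    simp [hf 2 (by decide), hf 5 (by decide), hf 6 (by decide), hl₃, hs₃.rank, hs₃.num, hfk,
      c₃, d₃]

/-- The components are subtracted one at a time from the running residual, as in modified
Gram–Schmidt; after `k` active passes the first `k` vectors have been treated. -/
theorem residual_spec {m : Mem 𝕜} (hm : Sized r n m) {v : (Fin n × Fin r) × Fin r → 𝕜}
    (bs : List ((Fin n × Fin r) × Fin r → 𝕜)) (hc : m.nat 3 0 = bs.length)
    (hle : bs.length ≤ n * r * r) (hv : Holds (m.fld 3) 0 v)
    (hb : ∀ (l : ℕ) (h : l < bs.length), Holds (m.fld 2) (l * (n * r * r)) bs[l]) :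
    Holds ((residual.exec m).fld 4) 0 (bs.foldl reduce v) := by
  simp only [residual, Prog.exec_seq]
  set m₁ := Prog.exec (.loop 7 eM (.setFld 4 (var 7) (.get 3 (var 7)))) m with hm₁
  have hs₁ : Sized r n m₁ := hm.exec (by decide) (by decide)
  have hc₁ : m₁.nat 3 0 = bs.length := by
    rw [hm₁, Prog.exec_nat_of_not_writes (by decide), hc]
  have hB₁ : m₁.fld 2 = m.fld 2 := Prog.exec_fld_of_not_writes (by decide) _
  have hu₁ : Holds (m₁.fld 4) 0 v := by
    intro κ
    rw [← hv κ, zero_add]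
    refine (Prog.exec_loop_setFld (n * r * r) (by simp [hm.rank, hm.num]) id (fun x => m.fld 3 x)
      (fun _ _ _ _ h => h) (by simp) ?_).1 _ (colIdx_lt κ)
    intro k hk f hf _
    simp [hf 3 (by decide)]
  clear_value m₁
  have key := Prog.exec_loop_guard (m := m₁) (a := 6) (e := eM) (c := var 3) (p := project)
    (n * r * r) bs.length (by simp [hs₁.rank, hs₁.num]) hle
    (fun t ht => by simp [ht 3 (by decide), hc₁])
    (fun k t => Holds (t.fld 4) 0 ((bs.take k).foldl reduce v)) (by simpa using hu₁)
    (fun _ _ _ h => h) ?_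
  · simpa using key
  · intro k hk t ht hf _ hkt h
    have := project_spec (hs₁.of_eq (ht 0 (by decide)) (ht 1 (by decide))) hkt h
      (b := bs[k]) (by rw [hf 2 (by decide), hB₁]; exact hb k hk)
    rw [List.take_add_one, List.foldl_append, List.getElem?_eq_getElem hk]
    exact this

theorem normSq_spec {m : Mem 𝕜} (hm : Sized r n m) {u : (Fin n × Fin r) × Fin r → 𝕜}
    (hu : Holds (m.fld 4) 0 u) : (normSq.exec m).fld 6 0 = star u ⬝ᵥ u := by
  simp only [normSq, Prog.exec_seq]
  set m₁ := Prog.exec (.setFld 6 (.const 0) .zero) m with hm₁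
  have hs₁ : Sized r n m₁ := hm.of_eq rfl rfl
  have d₁ : m₁.fld 6 0 = 0 := by simp [hm₁, Prog.exec_setFld]
  have hu₁ : Holds (m₁.fld 4) 0 u := by
    intro κ; rw [← hu κ]; simp [hm₁, Prog.exec_setFld]
  clear_value m₁
  rw [dot_spec hs₁ (by decide) (by decide) hu₁ hu₁ (by simp) (by simp), d₁, zero_add]

/-- A path is stored from its end vertex backwards, so prepending `k` means copying the old record
and writing one cell behind its last vertex. The array `11` holds the number of letters, one less
than the number of vertices, whence the index `L + 1`. -/
theorem append_spec {m : Mem 𝕜} (hm : Sized r n m) {c e k L : ℕ} (hc : m.nat 3 0 = c)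
    (he : m.nat 4 0 = e) (hec : e < c) (hk : m.nat 5 0 = k) (hL : m.nat 11 e = L)
    {u v : (Fin n × Fin r) × Fin r → 𝕜} (hv : Holds (m.fld 3) 0 v) (hu : Holds (m.fld 4) 0 u) :
    (append.exec m).nat 3 0 = c + 1 ∧ (append.exec m).nat 11 c = L + 1 ∧
    (∀ x < c, (append.exec m).nat 11 x = m.nat 11 x) ∧
    (append.exec m).nat 12 (c * (n * r * r + 2) + (L + 1)) = k ∧
    (∀ x < n * r * r + 2, x ≠ L + 1 → (append.exec m).nat 12 (c * (n * r * r + 2) + x) =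
      m.nat 12 (e * (n * r * r + 2) + x)) ∧
    (∀ x < c * (n * r * r + 2), (append.exec m).nat 12 x = m.nat 12 x) ∧
    Holds ((append.exec m).fld 1) (c * (n * r * r)) v ∧
    (∀ x < c * (n * r * r), (append.exec m).fld 1 x = m.fld 1 x) ∧
    Holds ((append.exec m).fld 2) (c * (n * r * r)) u ∧
    (∀ x < c * (n * r * r), (append.exec m).fld 2 x = m.fld 2 x) := by
  simp only [append, Prog.exec_seq]
  set m₁ := Prog.exec (.loop 7 eM (.setFld 1 (vecIx (var 3) (var 7)) (.get 3 (var 7)))) m with hm₁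
  have hs₁ : Sized r n m₁ := hm.exec (by decide) (by decide)
  have hn₁ : ∀ b, b ≠ 7 → m₁.nat b = m.nat b := fun b hb =>
    Prog.exec_nat_of_not_writes (by simp [Prog.writesNat, hb.symm]) _
  have hf₁ : ∀ b, b ≠ 1 → m₁.fld b = m.fld b := fun b hb =>
    Prog.exec_fld_of_not_writes (by simp [Prog.writesFld, hb.symm]) _
  have W₁ := Prog.exec_loop_setFld (m := m) (a := 7) (b := 1) (e := eM)
    (ix := vecIx (var 3) (var 7)) (E := .get 3 (var 7)) (n * r * r)
    (by simp [hm.rank, hm.num]) (fun x => c * (n * r * r) + x) (fun x => m.fld 3 x)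
    (fun _ _ _ _ h => by simpa using h) (by simp [hc, hm.rank, hm.num])
    (fun k hk f hf _ => by simp [hf 3 (by decide)])
  rw [← hm₁] at W₁
  clear_value m₁
  set m₂ := Prog.exec (.loop 7 eM (.setFld 2 (vecIx (var 3) (var 7)) (.get 4 (var 7)))) m₁
    with hm₂
  have hs₂ : Sized r n m₂ := hs₁.exec (by decide) (by decide)
  have hn₂ : ∀ b, b ≠ 7 → m₂.nat b = m.nat b := fun b hb =>
    (Prog.exec_nat_of_not_writes (by simp [Prog.writesNat, hb.symm]) _).trans (hn₁ b hb)
  have hf₂ : ∀ b, b ≠ 2 → m₂.fld b = m₁.fld b := fun b hb =>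
    Prog.exec_fld_of_not_writes (by simp [Prog.writesFld, hb.symm]) _
  have B₂ := Prog.exec_loop_setFld (m := m₁) (a := 7) (b := 2) (e := eM)
    (ix := vecIx (var 3) (var 7)) (E := .get 4 (var 7)) (n * r * r)
    (by simp [hs₁.rank, hs₁.num]) (fun x => c * (n * r * r) + x) (fun x => m.fld 4 x)
    (fun _ _ _ _ h => by simpa using h) (by simp [hn₁ 3 (by decide), hc, hs₁.rank, hs₁.num])
    (fun k hk f hf _ => by simp [hf 4 (by decide), hf₁ 4 (by decide)])
  rw [← hm₂] at B₂
  clear_value m₂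
  set p₃ : Prog := .loop 14 eS (.setNat 12 (pathIx (var 3) (var 14))
    (.get 12 (pathIx (var 4) (var 14)))) with hp₃
  set m₃ := p₃.exec m₂ with hm₃
  have hs₃ : Sized r n m₃ := hs₂.exec (by decide) (by decide)
  have hn₃ : ∀ b, b ≠ 7 → b ≠ 14 → b ≠ 12 → m₃.nat b = m.nat b := fun b hb hb' hb'' =>
    (Prog.exec_nat_of_not_writes (by simp [hp₃, Prog.writesNat, hb'.symm, hb''.symm]) _).trans
      (hn₂ b hb)
  have hf₃ : m₃.fld = m₂.fld := funext fun b => Prog.exec_fld_of_not_writes rfl _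
  have R₃ : (∀ x < n * r * r + 2, m₃.nat 12 (c * (n * r * r + 2) + x) =
      m.nat 12 (e * (n * r * r + 2) + x)) ∧
      ∀ x < c * (n * r * r + 2), m₃.nat 12 x = m.nat 12 x := by
    refine Prog.exec_loop (n * r * r + 2) (by simp [hs₂.rank, hs₂.num]) (fun K t =>
      (∀ x < K, t.nat 12 (c * (n * r * r + 2) + x) = m.nat 12 (e * (n * r * r + 2) + x)) ∧
      ∀ x < c * (n * r * r + 2), t.nat 12 x = m.nat 12 x) ⟨by simp, by simp [hn₂]⟩ ?_
    rintro K hK t ht - - ⟨h1, h2⟩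
    have e3 : t.nat 3 0 = c := by rw [ht 3 (by decide), hn₂ 3 (by decide), hc]
    have e4 : t.nat 4 0 = e := by rw [ht 4 (by decide), hn₂ 4 (by decide), he]
    have hst := hs₂.of_eq (ht 0 (by decide)) (ht 1 (by decide))
    -- As `e < c`, the source record lies before the target record, so the copy never reads a cell
    -- that it has overwritten.
    have hlt : e * (n * r * r + 2) + K < c * (n * r * r + 2) := by
      calc _ < (e + 1) * (n * r * r + 2) := by rw [add_mul]; omega
        _ ≤ _ := Nat.mul_le_mul_right _ hec
    rw [Prog.exec_setNat]
    simp only [NatExpr.eval, Mem.setNat_nat, e3, e4, hst.rank, hst.num]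
    simp only [Nat.reduceEqDiff, and_true, false_and, if_false, if_true, true_and]
    refine ⟨fun x hx => ?_, fun x hx => ?_⟩
    · split_ifs with h
      · rw [h2 _ hlt, show x = K by omega]
      · exact h1 x (by omega)
    · rw [if_neg (by omega)]
      exact h2 x hx
  clear_value m₃
  have e3 : m₃.nat 3 0 = c := by rw [hn₃ 3 (by decide) (by decide) (by decide), hc]
  have e4 : m₃.nat 4 0 = e := by rw [hn₃ 4 (by decide) (by decide) (by decide), he]
  have e5 : m₃.nat 5 0 = k := by rw [hn₃ 5 (by decide) (by decide) (by decide), hk]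
  have e11 : m₃.nat 11 = m.nat 11 := hn₃ 11 (by decide) (by decide) (by decide)
  have hW : (m₃.fld 1) = m₁.fld 1 := by rw [hf₃, hf₂ 1 (by decide)]
  simp only [Prog.exec_setNat]
  refine ⟨by simp [e3], by simp [e3, e4, e11, hL], fun x hx => ?_, ?_, fun x hx hxL => ?_,
    fun x hx => ?_, fun κ => ?_, fun x hx => ?_, fun κ => ?_, fun x hx => ?_⟩
  · simp [e3, hx.ne, e11]
  · simp [e3, e4, e5, e11, hL, hs₃.rank, hs₃.num]
  · simpa [e3, e4, e5, e11, hL, hs₃.rank, hs₃.num, hxL] using R₃.1 x hx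
  · have : x ≠ c * (n * r * r + 2) + (L + 1) := by omega
    simpa [e3, e4, e5, e11, hL, hs₃.rank, hs₃.num, this] using R₃.2 x hx
  · simp only [Mem.setNat_fld, hW]
    rw [W₁.1 _ (colIdx_lt κ), ← hv κ, zero_add]
  · simp only [Mem.setNat_fld, hW]
    exact W₁.2 x fun y _ => by omega
  · simp only [Mem.setNat_fld, hf₃]
    rw [B₂.1 _ (colIdx_lt κ), ← hu κ, zero_add]
  · simp only [Mem.setNat_fld, hf₃]
    rw [B₂.2 x fun y _ => by omega, hf₁ 2 (by decide)]

end Alg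

end CrossGramian

namespace CrossGramian

open Matrix

/-! ### Gram–Schmidt orthogonalization -/

section GramSchmidt

variable {𝕜 κ : Type*} [RCLike 𝕜] [Fintype κ]

theorem dotProduct_star_comm_eq_zero {a b : κ → 𝕜} (h : star a ⬝ᵥ b = 0) : star b ⬝ᵥ a = 0 := by
  rw [star_dotProduct, dotProduct_comm, dotProduct_comm, h, star_zero]

theorem dotProduct_eq_zero_of_mem_span {S : Set (κ → 𝕜)} {b v : κ → 𝕜}
    (h : ∀ c ∈ S, star b ⬝ᵥ c = 0) (hv : v ∈ Submodule.span 𝕜 S) : star b ⬝ᵥ v = 0 := by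
  induction hv using Submodule.span_induction with
  | mem x hx => exact h x hx
  | zero => simp
  | add x y _ _ hx hy => rw [dotProduct_add, hx, hy, add_zero]
  | smul c x _ hx => rw [dotProduct_smul, hx, smul_zero]

theorem star_dotProduct_self_eq_zero {v : κ → 𝕜} : star v ⬝ᵥ v = 0 ↔ v = 0 := by
  classical
  have h : star v ⬝ᵥ v = ((∑ i, ‖v i‖ ^ 2 : ℝ) : 𝕜) := by
    simp [dotProduct, RCLike.conj_mul]
  rw [h, RCLike.ofReal_eq_zero, Finset.sum_eq_zero_iff_of_nonneg (fun _ _ => by positivity)]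
  simp [funext_iff]

/-- The case of a zero denominator is harmless: then `b = 0` by definiteness. -/
theorem dotProduct_reduce (u b : κ → 𝕜) : star b ⬝ᵥ reduce u b = 0 := by
  rw [reduce, dotProduct_sub, dotProduct_smul, smul_eq_mul]
  by_cases h : star b ⬝ᵥ b = 0
  · rw [star_dotProduct_self_eq_zero] at h
    simp [h]
  · rw [div_mul_cancel₀ _ h, sub_self]

/-- One pass suffices because the family is orthogonal: subtracting multiples of later vectors does
not disturb the orthogonality to an earlier one. -/
theorem foldl_reduce_spec (bs : List (κ → 𝕜)) (hbs : bs.Pairwise fun b c => star b ⬝ᵥ c = 0)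
    (v : κ → 𝕜) :
    v - bs.foldl reduce v ∈ Submodule.span 𝕜 {b | b ∈ bs} ∧
      ∀ b ∈ bs, star b ⬝ᵥ bs.foldl reduce v = 0 := by
  induction bs generalizing v with
  | nil => simp
  | cons b bs ih =>
    rw [List.pairwise_cons] at hbs
    obtain ⟨h1, h2⟩ := ih hbs.2 (reduce v b)
    rw [List.foldl_cons]
    have hb : v - reduce v b ∈ Submodule.span 𝕜 {c | c ∈ b :: bs} := by
      rw [reduce, sub_sub_cancel]
      exact Submodule.smul_mem _ _ (Submodule.subset_span (by simp))
    refine ⟨?_, fun c hc => ?_⟩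
    · rw [← sub_add_sub_cancel v (reduce v b)]
      exact Submodule.add_mem _ hb (Submodule.span_mono (fun c hc => by simp_all) h1)
    · rcases List.mem_cons.1 hc with rfl | hc
      · have := dotProduct_eq_zero_of_mem_span hbs.1 h1
        rw [dotProduct_sub, dotProduct_reduce, zero_sub, neg_eq_zero] at this
        exact this
      · exact h2 c hc

/-- If `v` lies in the span, so does its residual, which is orthogonal to the span and hence to
itself. Together with definiteness this makes the vanishing of the squared norm a test for linear
dependence. -/
theorem foldl_reduce_eq_zero_iff {bs : List (κ → 𝕜)}
    (hbs : bs.Pairwise fun b c => star b ⬝ᵥ c = 0) (v : κ → 𝕜) :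
    bs.foldl reduce v = 0 ↔ v ∈ Submodule.span 𝕜 {b | b ∈ bs} := by
  obtain ⟨h1, h2⟩ := foldl_reduce_spec bs hbs v
  refine ⟨fun h => by simpa [h] using h1, fun h => ?_⟩
  rw [← star_dotProduct_self_eq_zero]
  refine dotProduct_eq_zero_of_mem_span (S := {b | b ∈ bs})
    (fun c hc => dotProduct_star_comm_eq_zero (h2 c hc)) ?_
  simpa using Submodule.sub_mem _ h h1

end GramSchmidt

/-! ### Paths and their words -/

section Paths

variable {𝕜 : Type*} [RCLike 𝕜] {r n : ℕ} {G : Matrix (Fin n × Fin r) (Fin n × Fin r) 𝕜}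

/-- The word `x_{ab} x_{bc} ⋯` of a path `a, b, c, …`. -/
def pathWord : List (Fin n) → Word n
  | a :: b :: l => (a, b) :: pathWord (b :: l)
  | _ => []

/-- The properties of the Gramian of an orthobasis that are used below. -/
structure IsCross (G : Matrix (Fin n × Fin r) (Fin n × Fin r) 𝕜) : Prop where
  isHermitian : G.IsHermitian
  diag : ∀ i, crossBlock G i i = blockProj 𝕜 i

theorem blockProj_mul_self (i : Fin n) :
    (blockProj 𝕜 i * blockProj 𝕜 i : Matrix (Fin n × Fin r) _ 𝕜) = blockProj 𝕜 i := by
  simp [blockProj]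

theorem blockProj_mul_of_ne {i j : Fin n} (h : i ≠ j) :
    (blockProj 𝕜 i * blockProj 𝕜 j : Matrix (Fin n × Fin r) _ 𝕜) = 0 := by
  rw [blockProj, blockProj, diagonal_mul_diagonal, ← diagonal_zero]
  congr 1
  ext p
  by_cases hp : p.1 = i <;> simp [hp, h]

theorem sum_blockProj : ∑ i, (blockProj 𝕜 i : Matrix (Fin n × Fin r) _ 𝕜) = 1 := by
  ext p q
  rw [Matrix.sum_apply]
  by_cases h : p = q
  · subst h; simp [blockProj]
  · simp [blockProj, h]

theorem blockProj_isHermitian (i : Fin n) :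
    (blockProj 𝕜 i : Matrix (Fin n × Fin r) _ 𝕜)ᴴ = blockProj 𝕜 i := by
  rw [blockProj, diagonal_conjTranspose]
  congr 1
  ext p
  simp only [Pi.star_apply]
  split_ifs <;> simp

theorem evalWord_cons (x : Fin n × Fin n) (w : Word n) :
    evalWord G (x :: w) = crossBlock G x.1 x.2 * evalWord G w := by
  simp [evalWord]

theorem evalWord_append (v w : Word n) : evalWord G (v ++ w) = evalWord G v * evalWord G w := by
  simp [evalWord]

theorem blockProj_mul_evalWord_cons (a b : Fin n) (w : Word n) :
    blockProj 𝕜 a * evalWord G ((a, b) :: w) = evalWord G ((a, b) :: w) := by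
  rw [evalWord_cons, crossBlock]
  simp only [← Matrix.mul_assoc, blockProj_mul_self]

theorem blockProj_mul_evalWord_pathWord {a : Fin n} {l : List (Fin n)} (hl : l ≠ []) :
    blockProj 𝕜 a * evalWord G (pathWord (a :: l)) = evalWord G (pathWord (a :: l)) := by
  obtain ⟨b, l, rfl⟩ := List.exists_cons_of_ne_nil hl
  exact blockProj_mul_evalWord_cons a b _

/-- The last letter of such a word ends in `Π_i`. Paths with one vertex are excluded because their
word is empty and evaluates to `1`. -/
theorem evalWord_pathWord_mul_blockProj {i : Fin n} {p : List (Fin n)} (hp : 2 ≤ p.length)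
    (hi : p.getLast? = some i) :
    evalWord G (pathWord p) * blockProj 𝕜 i = evalWord G (pathWord p) := by
  induction p with
  | nil => simp at hp
  | cons a l ih =>
    match l, hp, hi, ih with
    | [b], _, hi, _ =>
      simp only [List.getLast?_cons_cons, List.getLast?_singleton, Option.some.injEq] at hi
      subst hi
      simp [pathWord, evalWord, crossBlock, Matrix.mul_assoc, blockProj_mul_self]
    | b :: c :: l, _, hi, ih =>
      rw [pathWord, evalWord_cons, Matrix.mul_assoc, ih (by simp) (by simpa using hi)]

/-- The right projection of the new letter is absorbed by the word that follows, so the program need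
not know the first vertex of `p`. -/
theorem evalWord_pathWord_cons (k : Fin n) {p : List (Fin n)} (hp : 2 ≤ p.length) :
    evalWord G (pathWord (k :: p)) = blockProj 𝕜 k * G * evalWord G (pathWord p) := by
  match p, hp with
  | a :: b :: l, _ =>
    rw [pathWord, evalWord_cons, crossBlock, Matrix.mul_assoc,
      blockProj_mul_evalWord_pathWord (by simp)]

/-- The adjoint of a word. -/
def adjWord (w : Word n) : Word n := (w.map Prod.swap).reverse

theorem crossBlock_conjTranspose (hG : IsCross G) (i j : Fin n) :
    (crossBlock G i j)ᴴ = crossBlock G j i := by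
  rw [crossBlock, conjTranspose_mul, conjTranspose_mul, hG.isHermitian.eq, blockProj_isHermitian,
    blockProj_isHermitian, crossBlock, Matrix.mul_assoc]

theorem evalWord_adjWord (hG : IsCross G) (w : Word n) :
    evalWord G (adjWord w) = (evalWord G w)ᴴ := by
  induction w with
  | nil => simp [evalWord, adjWord]
  | cons x w ih =>
    rw [evalWord_cons, conjTranspose_mul, crossBlock_conjTranspose hG, ← ih, adjWord, List.map_cons,
      List.reverse_cons, evalWord_append]
    simp [evalWord, adjWord]

/-! ### The search for a spanning set of paths -/

/-- The span of the evaluations of the words of a list of paths. -/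
def pathSpan (G : Matrix (Fin n × Fin r) (Fin n × Fin r) 𝕜) (L : List (List (Fin n))) :
    Submodule 𝕜 (Matrix (Fin n × Fin r) (Fin n × Fin r) 𝕜) :=
  Submodule.span 𝕜 {M | ∃ p ∈ L, M = evalWord G (pathWord p)}

theorem mem_pathSpan {L : List (List (Fin n))} {p : List (Fin n)} (hp : p ∈ L) :
    evalWord G (pathWord p) ∈ pathSpan G L :=
  Submodule.subset_span ⟨p, hp, rfl⟩

theorem pathSpan_mono {L L' : List (List (Fin n))} (h : L ⊆ L') : pathSpan G L ≤ pathSpan G L' :=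
  Submodule.span_mono fun _ ⟨p, hp, e⟩ => ⟨p, h hp, e⟩

theorem pathSpan_concat (L : List (List (Fin n))) (p : List (Fin n)) :
    pathSpan G (L ++ [p]) = pathSpan G L ⊔ Submodule.span 𝕜 {evalWord G (pathWord p)} := by
  rw [pathSpan, pathSpan, ← Submodule.span_union]
  congr 1
  ext M
  simp [or_and_right, exists_or, or_comm]

open Classical in
/-- Append a path, provided that its word is linearly independent of the others. -/
noncomputable def extend (G : Matrix (Fin n × Fin r) (Fin n × Fin r) 𝕜) (L : List (List (Fin n)))
    (p : List (Fin n)) : List (List (Fin n)) :=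
  if evalWord G (pathWord p) ∈ pathSpan G L then L else L ++ [p]

/-- Try to append `k :: p`, where `p` is the `e`-th path. -/
noncomputable def expand (G : Matrix (Fin n × Fin r) (Fin n × Fin r) 𝕜) (e : ℕ)
    (L : List (List (Fin n))) (k : Fin n) : List (List (Fin n)) :=
  (L[e]?).elim L fun p => extend G L (k :: p)

/-- The list of paths after `E` rounds of the search. -/
noncomputable def searchPaths (G : Matrix (Fin n × Fin r) (Fin n × Fin r) 𝕜) (i : Fin n) :
    ℕ → List (List (Fin n))
  | 0 => [[i, i]]
  | E + 1 => (List.finRange n).foldl (expand G E) (searchPaths G i E)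

/-- The properties of the list of paths that are preserved by the search. -/
structure IsPathList (G : Matrix (Fin n × Fin r) (Fin n × Fin r) 𝕜) (i : Fin n)
    (L : List (List (Fin n))) : Prop where
  root : [i, i] ∈ L
  length_le : ∀ e p, L[e]? = some p → p.length ≤ e + 2
  two_le : ∀ p ∈ L, 2 ≤ p.length
  getLast : ∀ p ∈ L, p.getLast? = some i
  finrank : Module.finrank 𝕜 (pathSpan G L) = L.length

theorem getElem?_of_prefix {α : Type*} {L L' : List α} (h : L <+: L') {e : ℕ} {p : α}
    (hp : L[e]? = some p) : L'[e]? = some p := by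
  obtain ⟨t, rfl⟩ := h
  rw [List.getElem?_append_left (List.getElem?_eq_some_iff.1 hp).1, hp]

theorem prefix_extend (L : List (List (Fin n))) (p : List (Fin n)) : L <+: extend G L p := by
  rw [extend]
  split_ifs
  · exact List.prefix_rfl
  · exact List.prefix_append _ _

theorem mem_pathSpan_extend (L : List (List (Fin n))) (p : List (Fin n)) :
    evalWord G (pathWord p) ∈ pathSpan G (extend G L p) := by
  rw [extend]
  split_ifs with h
  · exact h
  · exact mem_pathSpan (by simp)

/-- The bound on lengths survives because a new path has one vertex more than the `e`-th path and an
index `L.length` larger than `e`. -/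
theorem IsPathList.extend {i : Fin n} {L : List (List (Fin n))} (hL : IsPathList G i L) {e : ℕ}
    {p : List (Fin n)} (hp : L[e]? = some p) (k : Fin n) :
    IsPathList G i (extend G L (k :: p)) := by
  rw [CrossGramian.extend]
  split_ifs with h
  · exact hL
  have hpL : p ∈ L := List.mem_of_getElem? hp
  have heL : e < L.length := (List.getElem?_eq_some_iff.1 hp).1
  refine ⟨by simp [hL.root], fun f q hq => ?_, fun q hq => ?_, fun q hq => ?_, ?_⟩
  · rw [List.getElem?_append] at hq
    split_ifs at hq with hf
    · exact hL.length_le f q hq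
    · have h1 := hL.length_le e p hp
      obtain ⟨h2, h3⟩ := List.getElem?_eq_some_iff.1 hq
      simp only [List.getElem_singleton] at h3
      rw [← h3, List.length_cons]
      omega
  · rcases List.mem_append.1 hq with hq | hq
    · exact hL.two_le q hq
    · have := hL.two_le p hpL
      rw [List.mem_singleton.1 hq, List.length_cons]
      omega
  · rcases List.mem_append.1 hq with hq | hq
    · exact hL.getLast q hq
    · have := hL.getLast p hpL
      rw [List.mem_singleton.1 hq, List.getLast?_cons, this]
      rfl
  · have hd : Disjoint (pathSpan G L) (Submodule.span 𝕜 {evalWord G (pathWord (k :: p))}) :=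
      Submodule.disjoint_span_singleton_of_notMem h
    have h0 : evalWord G (pathWord (k :: p)) ≠ 0 := fun h0 => h (h0 ▸ Submodule.zero_mem _)
    have := Submodule.finrank_sup_add_finrank_inf_eq (pathSpan G L)
      (Submodule.span 𝕜 {evalWord G (pathWord (k :: p))})
    rw [disjoint_iff.1 hd, finrank_bot, hL.finrank, finrank_span_singleton h0] at this
    rw [pathSpan_concat, List.length_append, List.length_singleton]
    exact this

theorem prefix_expand (e : ℕ) (L : List (List (Fin n))) (k : Fin n) : L <+: expand G e L k := by
  rw [expand]
  rcases L[e]? with _ | p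
  · exact List.prefix_rfl
  · exact prefix_extend _ _

theorem IsPathList.expand {i : Fin n} {L : List (List (Fin n))} (hL : IsPathList G i L) (e : ℕ)
    (k : Fin n) : IsPathList G i (expand G e L k) := by
  rw [CrossGramian.expand]
  rcases h : L[e]? with _ | p
  · exact hL
  · exact hL.extend h k

/-- The list grows only at its end, so `e` denotes the same path throughout the round, and later
additions can only enlarge the span. -/
theorem foldl_expand_spec {i : Fin n} {L : List (List (Fin n))} (hL : IsPathList G i L) (e : ℕ)
    (l : List (Fin n)) :
    IsPathList G i (l.foldl (expand G e) L) ∧ L <+: l.foldl (expand G e) L ∧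
      ∀ p, L[e]? = some p → ∀ k ∈ l,
        evalWord G (pathWord (k :: p)) ∈ pathSpan G (l.foldl (expand G e) L) := by
  induction l generalizing L with
  | nil => exact ⟨hL, List.prefix_rfl, by simp⟩
  | cons k l ih =>
    obtain ⟨h1, h2, h3⟩ := ih (hL.expand e k)
    have hpre : L <+: CrossGramian.expand G e L k := prefix_expand e L k
    refine ⟨h1, hpre.trans h2, fun p hp k' hk' => ?_⟩
    rcases List.mem_cons.1 hk' with rfl | hk'
    · refine pathSpan_mono h2.subset ?_
      rw [CrossGramian.expand, hp]
      exact mem_pathSpan_extend _ _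
    · exact h3 p (getElem?_of_prefix hpre hp) k' hk'

/-- The root is `[i, i]` and not `[i]`, whose empty word evaluates to `1` instead of `Π_i`. The
hypothesis `1 ≤ r` makes `Π_i` nonzero, hence independent. -/
theorem isPathList_root (hG : IsCross G) (hr : 1 ≤ r) (i : Fin n) : IsPathList G i [[i, i]] := by
  refine ⟨by simp, fun e p hp => ?_, by simp, by simp, ?_⟩
  · obtain ⟨h2, h3⟩ := List.getElem?_eq_some_iff.1 hp
    simp only [List.getElem_singleton] at h3
    simp [← h3]
  · have : evalWord G (pathWord [i, i]) = blockProj 𝕜 i := by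
      simp [pathWord, evalWord, hG.diag]
    have h0 : (blockProj 𝕜 i : Matrix (Fin n × Fin r) _ 𝕜) ≠ 0 := fun h => by
      have := congrFun (congrFun h (i, ⟨0, hr⟩)) (i, ⟨0, hr⟩)
      simp [blockProj] at this
    have hs : {M | ∃ p ∈ [[i, i]], M = evalWord G (pathWord p)} = {blockProj 𝕜 i} := by
      ext M
      simp only [List.mem_singleton, exists_eq_left, this]
      rfl
    rw [pathSpan, hs, finrank_span_singleton h0, List.length_singleton]

/-- All prolongations of the paths treated so far lie in the span. Once `E` reaches the length of
the list this applies to every path, and the span is closed under left multiplication by letters. -/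
theorem searchPaths_spec (hG : IsCross G) (hr : 1 ≤ r) (i : Fin n) (E : ℕ) :
    IsPathList G i (searchPaths G i E) ∧
      ∀ e < E, ∀ p, (searchPaths G i E)[e]? = some p → ∀ k,
        evalWord G (pathWord (k :: p)) ∈ pathSpan G (searchPaths G i E) := by
  induction E with
  | zero => exact ⟨isPathList_root hG hr i, by simp⟩
  | succ E ih =>
    obtain ⟨h1, h2, h3⟩ := foldl_expand_spec ih.1 E (List.finRange n)
    refine ⟨h1, fun e he p hp k => ?_⟩
    rw [searchPaths] at hp ⊢
    by_cases hE : E < (searchPaths G i E).length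
    · have hp' : (searchPaths G i E)[e]? = some p := by
        rw [List.getElem?_eq_getElem (by omega), ← hp]
        exact (getElem?_of_prefix h2 (List.getElem?_eq_getElem (by omega))).symm
      rcases Nat.lt_succ_iff_lt_or_eq.1 he with he | rfl
      · exact pathSpan_mono h2.subset (ih.2 e he p hp' k)
      · exact h3 p hp' k (List.mem_finRange k)
    -- The search is already exhausted, and further rounds change nothing.
    · have hstep : ∀ l : List (Fin n), l.foldl (expand G E) (searchPaths G i E) =
          searchPaths G i E := by
        intro l
        induction l with
        | nil => rfl
        | cons k l ihl =>
          rw [List.foldl_cons, expand, List.getElem?_eq_none (by omega)]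
          exact ihl
      rw [hstep] at hp ⊢
      have := (List.getElem?_eq_some_iff.1 hp).1
      exact ih.2 e (by omega) p hp k

/-- The `i`-th block column of a matrix. -/
def colMap (𝕜 : Type*) [RCLike 𝕜] {r n : ℕ} (i : Fin n) :
    Matrix (Fin n × Fin r) (Fin n × Fin r) 𝕜 →ₗ[𝕜] ((Fin n × Fin r) × Fin r → 𝕜) where
  toFun X κ := X κ.1 (i, κ.2)
  map_add' _ _ := rfl
  map_smul' _ _ := rfl

theorem colMap_apply (i : Fin n) (X : Matrix (Fin n × Fin r) (Fin n × Fin r) 𝕜)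
    (κ : (Fin n × Fin r) × Fin r) : colMap 𝕜 i X κ = X κ.1 (i, κ.2) := rfl

theorem IsPathList.mul_blockProj {i : Fin n} {L : List (List (Fin n))} (hL : IsPathList G i L)
    {X : Matrix (Fin n × Fin r) (Fin n × Fin r) 𝕜} (hX : X ∈ pathSpan G L) :
    X * blockProj 𝕜 i = X := by
  induction hX using Submodule.span_induction with
  | mem x hx =>
    obtain ⟨p, hp, rfl⟩ := hx
    exact evalWord_pathWord_mul_blockProj (hL.two_le p hp) (hL.getLast p hp)
  | zero => simp
  | add x y _ _ hx hy => rw [Matrix.add_mul, hx, hy]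
  | smul c x _ hx => rw [Matrix.smul_mul, hx]

theorem eq_of_colMap_eq {i : Fin n} {X Y : Matrix (Fin n × Fin r) (Fin n × Fin r) 𝕜}
    (hX : X * blockProj 𝕜 i = X) (hY : Y * blockProj 𝕜 i = Y) (h : colMap 𝕜 i X = colMap 𝕜 i Y) :
    X = Y := by
  rw [← hX, ← hY]
  ext p ⟨j, q⟩
  by_cases hj : j = i
  · subst hj
    have := congrFun h (p, q)
    rw [colMap_apply, colMap_apply] at this
    simpa [blockProj] using this
  · simp [blockProj, hj]

/-- The recorded words are independent, and each is determined by its `i`-th block column, which has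
`n r · r` entries. This is why `n r r` rounds are enough. -/
theorem IsPathList.length_le_card {i : Fin n} {L : List (List (Fin n))} (hL : IsPathList G i L) :
    L.length ≤ n * r * r := by
  have hinj : Function.Injective ((colMap 𝕜 i).domRestrict (pathSpan G L)) := by
    rintro ⟨X, hX⟩ ⟨Y, hY⟩ h
    exact Subtype.ext (eq_of_colMap_eq (hL.mul_blockProj hX) (hL.mul_blockProj hY) h)
  have := LinearMap.finrank_le_finrank_of_injective hinj
  rw [hL.finrank] at this
  simpa using this

/-- Linear dependence of words can be tested on block columns, the only part of the matrices that
the machine stores. -/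
theorem IsPathList.colMap_mem_iff {i : Fin n} {L : List (List (Fin n))} (hL : IsPathList G i L)
    {X : Matrix (Fin n × Fin r) (Fin n × Fin r) 𝕜} (hX : X * blockProj 𝕜 i = X) :
    colMap 𝕜 i X ∈ (pathSpan G L).map (colMap 𝕜 i) ↔ X ∈ pathSpan G L := by
  refine ⟨fun ⟨Y, hY, h⟩ => ?_, fun h => ⟨X, h, rfl⟩⟩
  rw [← eq_of_colMap_eq (hL.mul_blockProj hY) hX h]
  exact hY

end Paths

end CrossGramian

namespace CrossGramian

open Matrix

/-! ### Correctness of the search -/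

section Search

variable {𝕜 : Type*} [RCLike 𝕜] {r n : ℕ} {G : Matrix (Fin n × Fin r) (Fin n × Fin r) 𝕜}

/-- The memory holds the list of paths `L` with end vertex `i`. -/
structure Records (G : Matrix (Fin n × Fin r) (Fin n × Fin r) 𝕜) (i : Fin n)
    (L : List (List (Fin n))) (m : Mem 𝕜) : Prop where
  sized : Sized r n m
  gram : HoldsMat (m.fld 0) G
  vertex : m.nat 2 0 = i
  count : m.nat 3 0 = L.length
  len : ∀ e p, L[e]? = some p → m.nat 11 e + 1 = p.length
  path : ∀ e p, L[e]? = some p → ∀ (c : ℕ) (j : Fin n), p.reverse[c]? = some j →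
    m.nat 12 (e * (n * r * r + 2) + c) = (j : ℕ)
  col : ∀ e p, L[e]? = some p →
    Holds (m.fld 1) (e * (n * r * r)) (colMap 𝕜 i (evalWord G (pathWord p)))
  orth : ∃ bs : List ((Fin n × Fin r) × Fin r → 𝕜), bs.length = L.length ∧
    (∀ (l : ℕ) (h : l < bs.length), Holds (m.fld 2) (l * (n * r * r)) bs[l]) ∧
    bs.Pairwise (fun b c => star b ⬝ᵥ c = 0) ∧
    Submodule.span 𝕜 {b | b ∈ bs} = (pathSpan G L).map (colMap 𝕜 i)

theorem Records.of_eq {i : Fin n} {L : List (List (Fin n))} {m t : Mem 𝕜}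
    (h : Records G i L m) (h0 : t.nat 0 = m.nat 0) (h1 : t.nat 1 = m.nat 1)
    (h2 : t.nat 2 = m.nat 2) (h3 : t.nat 3 = m.nat 3) (h11 : t.nat 11 = m.nat 11)
    (h12 : t.nat 12 = m.nat 12) (f0 : t.fld 0 = m.fld 0) (f1 : t.fld 1 = m.fld 1)
    (f2 : t.fld 2 = m.fld 2) : Records G i L t where
  sized := h.sized.of_eq h0 h1
  gram := f0 ▸ h.gram
  vertex := h2 ▸ h.vertex
  count := h3 ▸ h.count
  len := h11 ▸ h.len
  path := h12 ▸ h.path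
  col := f1 ▸ h.col
  orth := f2 ▸ h.orth

theorem Records.exec {i : Fin n} {L : List (List (Fin n))} {m : Mem 𝕜}
    (h : Records G i L m) {p : Prog}
    (hn : ∀ b ∈ [0, 1, 2, 3, 11, 12], p.writesNat b = false)
    (hf : ∀ b ∈ [0, 1, 2], p.writesFld b = false) : Records G i L (p.exec m) :=
  h.of_eq (Prog.exec_nat_of_not_writes (hn 0 (by decide)) _)
    (Prog.exec_nat_of_not_writes (hn 1 (by decide)) _)
    (Prog.exec_nat_of_not_writes (hn 2 (by decide)) _)
    (Prog.exec_nat_of_not_writes (hn 3 (by decide)) _)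
    (Prog.exec_nat_of_not_writes (hn 11 (by decide)) _)
    (Prog.exec_nat_of_not_writes (hn 12 (by decide)) _)
    (Prog.exec_fld_of_not_writes (hf 0 (by decide)) _)
    (Prog.exec_fld_of_not_writes (hf 1 (by decide)) _)
    (Prog.exec_fld_of_not_writes (hf 2 (by decide)) _)

theorem Records.setNat {i : Fin n} {L : List (List (Fin n))} {m : Mem 𝕜}
    (h : Records G i L m) {b : ℕ} (hb : b ∉ [0, 1, 2, 3, 11, 12]) (j v : ℕ) :
    Records G i L (m.setNat b j v) := by
  simp only [List.mem_cons, not_or, List.not_mem_nil, not_false_eq_true, and_true] at hb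
  exact h.of_eq (Mem.setNat_nat_of_ne _ _ _ (Ne.symm hb.1))
    (Mem.setNat_nat_of_ne _ _ _ (Ne.symm hb.2.1)) (Mem.setNat_nat_of_ne _ _ _ (Ne.symm hb.2.2.1))
    (Mem.setNat_nat_of_ne _ _ _ (Ne.symm hb.2.2.2.1))
    (Mem.setNat_nat_of_ne _ _ _ (Ne.symm hb.2.2.2.2.1))
    (Mem.setNat_nat_of_ne _ _ _ (Ne.symm hb.2.2.2.2.2)) rfl rfl rfl

namespace Alg

theorem start_records (hG : IsCross G) {m : Mem 𝕜} (hm : Sized r n m) {i : Fin n}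
    (hi : m.nat 2 0 = i) (hg : HoldsMat (m.fld 0) G) :
    Records G i [[i, i]] (start.exec m) := by
  obtain ⟨h3, h11, h12, h12', hW, hB⟩ := start_spec (n := n) (𝕜 := 𝕜) hm hi
  have hv : evalWord G (pathWord [i, i]) = blockProj 𝕜 i := by
    simp [pathWord, evalWord, hG.diag]
  have hu : unitCol 𝕜 r i = colMap 𝕜 i (evalWord G (pathWord [i, i])) := by
    ext κ
    rw [hv, colMap_apply, unitCol, blockProj, diagonal_apply]
    by_cases h : κ.1 = (i, κ.2) <;> simp [h]
  refine ⟨hm.exec (by decide) (by decide), ?_, ?_, ?_, ?_, ?_, ?_, [unitCol 𝕜 r i], ?_, ?_, ?_, ?_⟩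
  · rw [Prog.exec_fld_of_not_writes (by decide)]; exact hg
  · rw [Prog.exec_nat_of_not_writes (by decide)]; exact hi
  · exact h3
  · intro e p hp
    obtain ⟨h1, h2⟩ := List.getElem?_eq_some_iff.1 hp
    simp only [List.getElem_singleton, List.length_singleton, Nat.lt_one_iff] at h1 h2
    subst h1 h2
    rw [h11]; rfl
  · intro e p hp c j hj
    obtain ⟨h1, h2⟩ := List.getElem?_eq_some_iff.1 hp
    simp only [List.getElem_singleton, List.length_singleton, Nat.lt_one_iff] at h1 h2
    subst h1 h2
    rw [zero_mul, zero_add]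
    match c with
    | 0 => simp only [List.reverse_cons, List.reverse_nil, List.nil_append, List.cons_append, List.getElem?_cons_zero, Option.some.injEq] at hj; rw [h12, hj]
    | 1 => simp only [List.reverse_cons, List.reverse_nil, List.nil_append, List.cons_append, List.getElem?_cons_zero, List.getElem?_cons_succ, Option.some.injEq] at hj; rw [h12', hj]
    | c + 2 => simp at hj
  · intro e p hp
    obtain ⟨h1, h2⟩ := List.getElem?_eq_some_iff.1 hp
    simp only [List.getElem_singleton, List.length_singleton, Nat.lt_one_iff] at h1 h2
    subst h1 h2
    rw [zero_mul, ← hu]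
    exact hW
  · rfl
  · intro l hl
    simp only [List.length_singleton, Nat.lt_one_iff] at hl
    subst hl
    rw [zero_mul]
    exact hB
  · simp
  · have hs : {M | ∃ p ∈ [[i, i]], M = evalWord G (pathWord p)} =
        {evalWord G (pathWord [i, i])} := by
      ext M
      simp only [List.mem_singleton, exists_eq_left]
      rfl
    rw [pathSpan, hs, Submodule.map_span, Set.image_singleton, ← hu]
    congr 1
    ext b
    simp

/-- The residual vanishes exactly when the new word depends on the recorded ones, so the machine
branches as `extend` does; a nonzero residual enlarges the orthogonal family. -/
theorem tryAppend_records {m : Mem 𝕜} {i : Fin n} {L : List (List (Fin n))}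
    (hL : IsPathList G i L) (hm : Records G i L m) {e : ℕ} {p : List (Fin n)}
    (hp : L[e]? = some p) (he : m.nat 4 0 = e) {k : Fin n} (hk : m.nat 5 0 = k) :
    Records G i (extend G L (k :: p)) (tryAppend.exec m) := by
  have hpL : p ∈ L := List.mem_of_getElem? hp
  have heL : e < L.length := (List.getElem?_eq_some_iff.1 hp).1
  have hcard := hL.length_le_card
  simp only [tryAppend, Prog.exec_seq]
  set m₁ := candidate.exec m with hm₁
  have h₁ : Records G i L m₁ := hm.exec (by decide) (by decide)
  have he₁ : m₁.nat 4 0 = e := by rw [hm₁, Prog.exec_nat_of_not_writes (by decide), he]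
  have hk₁ : m₁.nat 5 0 = k := by rw [hm₁, Prog.exec_nat_of_not_writes (by decide), hk]
  have v₁ : Holds (m₁.fld 3) 0 (colMap 𝕜 i (evalWord G (pathWord (k :: p)))) := by
    rw [evalWord_pathWord_cons k (hL.two_le p hpL)]
    exact candidate_spec hm.sized hk he hm.gram
      (X := fun a q => evalWord G (pathWord p) a (i, q)) (hm.col e p hp)
  clear_value m₁
  obtain ⟨bs, hbl, hB, hpw, hspan⟩ := h₁.orth
  set m₂ := residual.exec m₁ with hm₂
  have h₂ : Records G i L m₂ := h₁.exec (by decide) (by decide)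
  have he₂ : m₂.nat 4 0 = e := by rw [hm₂, Prog.exec_nat_of_not_writes (by decide), he₁]
  have hk₂ : m₂.nat 5 0 = k := by rw [hm₂, Prog.exec_nat_of_not_writes (by decide), hk₁]
  have v₂ : Holds (m₂.fld 3) 0 (colMap 𝕜 i (evalWord G (pathWord (k :: p)))) := by
    rw [hm₂, Prog.exec_fld_of_not_writes (by decide)]; exact v₁
  have B₂ : m₂.fld 2 = m₁.fld 2 := Prog.exec_fld_of_not_writes (by decide) _
  have u₂ := residual_spec h₁.sized bs (h₁.count.trans hbl.symm) (hbl ▸ hcard) v₁ hB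
  rw [← hm₂] at u₂
  clear_value m₂
  set u := bs.foldl reduce (colMap 𝕜 i (evalWord G (pathWord (k :: p)))) with hu
  have hmem : u = 0 ↔ evalWord G (pathWord (k :: p)) ∈ pathSpan G L := by
    rw [hu, foldl_reduce_eq_zero_iff hpw, hspan, hL.colMap_mem_iff]
    exact evalWord_pathWord_mul_blockProj (by have := hL.two_le p hpL; simp; omega)
      (by rw [List.getLast?_cons, hL.getLast p hpL]; rfl)
  set m₃ := normSq.exec m₂ with hm₃
  have h₃ : Records G i L m₃ := h₂.exec (by decide) (by decide)
  have he₃ : m₃.nat 4 0 = e := by rw [hm₃, Prog.exec_nat_of_not_writes (by decide), he₂]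
  have hk₃ : m₃.nat 5 0 = k := by rw [hm₃, Prog.exec_nat_of_not_writes (by decide), hk₂]
  have v₃ : Holds (m₃.fld 3) 0 (colMap 𝕜 i (evalWord G (pathWord (k :: p)))) := by
    rw [hm₃, Prog.exec_fld_of_not_writes (by decide)]; exact v₂
  have u₃ : Holds (m₃.fld 4) 0 u := by
    rw [hm₃, Prog.exec_fld_of_not_writes (by decide)]; exact u₂
  have B₃ : m₃.fld 2 = m₁.fld 2 := by rw [← B₂]; exact Prog.exec_fld_of_not_writes (by decide) _
  have d₃ := normSq_spec h₂.sized u₂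
  rw [← hm₃] at d₃
  clear_value m₃
  have hz : (Prog.ifZero (.get 6 (.const 0)) .skip append).exec m₃ =
      if u = 0 then m₃ else append.exec m₃ := by
    simp only [Prog.exec, FldExpr.eval, NatExpr.eval, d₃, star_dotProduct_self_eq_zero]
  rw [hz, extend]
  by_cases h : u = 0
  · rw [if_pos h, if_pos (hmem.1 h)]
    exact h₃
  rw [if_neg h, if_neg (mt hmem.2 h)]
  have hlen := h₃.len e p hp
  obtain ⟨a3, a11, a11', a12, a12', a12'', aW, aW', aB, aB'⟩ := append_spec h₃.sized
    (c := L.length) (L := m₃.nat 11 e) h₃.count he₃ heL hk₃ rfl v₃ u₃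
  have hcon : ∀ f q, (L ++ [k :: p])[f]? = some q → f < L.length ∧ L[f]? = some q ∨
      f = L.length ∧ q = k :: p := by
    intro f q hq
    rw [List.getElem?_append] at hq
    split_ifs at hq with hf
    · exact Or.inl ⟨hf, hq⟩
    · obtain ⟨h2, h3⟩ := List.getElem?_eq_some_iff.1 hq
      simp only [List.getElem_singleton, List.length_singleton] at h2 h3
      exact Or.inr ⟨by omega, h3.symm⟩
  have hple := hL.length_le e p hp
  refine ⟨h₃.sized.exec (by decide) (by decide), ?_, ?_, by simpa using a3, ?_, ?_, ?_,
    bs ++ [u], by simp [hbl], ?_, ?_, ?_⟩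
  · rw [Prog.exec_fld_of_not_writes (by decide)]; exact h₃.gram
  · rw [Prog.exec_nat_of_not_writes (by decide)]; exact h₃.vertex
  · intro f q hq
    rcases hcon f q hq with ⟨hf, hq⟩ | ⟨rfl, rfl⟩
    · rw [a11' f hf, h₃.len f q hq]
    · rw [a11, List.length_cons, hlen]
  · intro f q hq c j hj
    rcases hcon f q hq with ⟨hf, hq⟩ | ⟨rfl, rfl⟩
    -- The bound on path lengths keeps every record within its `n r r + 2` cells, so the older
    -- records lie below the cells that are written.
    · have hc := (List.getElem?_eq_some_iff.1 hj).1
      have := hL.length_le f q hq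
      rw [List.length_reverse] at hc
      rw [a12'', h₃.path f q hq c j hj]
      calc _ < (f + 1) * (n * r * r + 2) := by rw [add_mul]; omega
        _ ≤ _ := Nat.mul_le_mul_right _ hf
    · rw [List.reverse_cons, List.getElem?_append] at hj
      split_ifs at hj with hc
      · rw [List.length_reverse] at hc
        rw [a12' c (by omega) (by omega), h₃.path e p hp c j hj]
      · obtain ⟨h2, h3⟩ := List.getElem?_eq_some_iff.1 hj
        simp only [List.getElem_singleton, List.length_singleton, List.length_reverse] at h2 h3 hc
        rw [show c = m₃.nat 11 e + 1 by omega, a12, h3]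
  · intro f q hq
    rcases hcon f q hq with ⟨hf, hq⟩ | ⟨rfl, rfl⟩
    · intro κ
      rw [aW', h₃.col f q hq κ]
      calc _ < (f + 1) * (n * r * r) := by rw [add_mul]; have := colIdx_lt κ; omega
        _ ≤ _ := Nat.mul_le_mul_right _ hf
    · exact aW
  · intro l hl κ
    rw [List.getElem_append]
    split_ifs with hlb
    · rw [aB', B₃, hB l hlb κ]
      calc _ < (l + 1) * (n * r * r) := by rw [add_mul]; have := colIdx_lt κ; omega
        _ ≤ _ := Nat.mul_le_mul_right _ (by omega)
    · rw [List.getElem_singleton]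
      rw [List.length_append, List.length_singleton] at hl
      rw [show l = L.length by omega]
      exact aB κ
  · rw [List.pairwise_append]
    refine ⟨hpw, by simp, fun b hb c hc => ?_⟩
    rw [List.mem_singleton.1 hc]
    exact (foldl_reduce_spec bs hpw _).2 b hb
  -- The residual and the new column differ by an element of the old span, so adjoining either gives
  -- the same space.
  · have h1 := (foldl_reduce_spec bs hpw (colMap 𝕜 i (evalWord G (pathWord (k :: p))))).1
    rw [← hu, hspan] at h1
    rw [pathSpan_concat, Submodule.map_sup, ← hspan, Submodule.map_span, Set.image_singleton,
      show {b | b ∈ bs ++ [u]} = {b | b ∈ bs} ∪ {u} by ext; simp [or_comm],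
      Submodule.span_union]
    rw [hspan]
    refine le_antisymm (sup_le le_sup_left ?_) (sup_le le_sup_left ?_)
    · rw [Submodule.span_singleton_le_iff_mem]
      have := Submodule.sub_mem _ (Submodule.mem_sup_right (Submodule.mem_span_singleton_self
        (colMap 𝕜 i (evalWord G (pathWord (k :: p)))))) (Submodule.mem_sup_left h1)
      simpa using this
    · rw [Submodule.span_singleton_le_iff_mem]
      have := Submodule.add_mem _ (Submodule.mem_sup_left h1) (Submodule.mem_sup_right
        (Submodule.mem_span_singleton_self u))
      simpa using this

theorem search_records (hG : IsCross G) (hr : 1 ≤ r) {m : Mem 𝕜} {i : Fin n}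
    (hm : Records G i [[i, i]] m) :
    Records G i (searchPaths G i (n * r * r)) (search.exec m) := by
  refine Prog.exec_loop (n * r * r) (by simp [hm.sized.rank, hm.sized.num])
    (fun E t => Records G i (searchPaths G i E) t) hm ?_
  intro E hE t _ _ _ ht
  have ht' := ht.setNat (b := 4) (by decide) 0 E
  have hE' : (t.setNat 4 0 E).nat 4 0 = E := by simp
  generalize t.setNat 4 0 E = s at ht' hE'
  have key := Prog.exec_loop (m := s) (a := 5) (e := var 1)
    (p := .ifLe (var 3) (var 4) .skip tryAppend) n (by simp [ht'.sized.num])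
    -- Being a path list is carried along because `tryAppend_records` needs it in the middle of a
    -- round.
    (fun K t => IsPathList G i (((List.finRange n).take K).foldl (expand G E)
        (searchPaths G i E)) ∧
      Records G i (((List.finRange n).take K).foldl (expand G E) (searchPaths G i E)) t)
    ⟨(searchPaths_spec hG hr i E).1, ht'⟩ ?_
  · rw [List.take_of_length_le (by simp)] at key
    exact key.2
  · rintro K hK w hw - - ⟨h1, h2⟩
    have hK' : K < (List.finRange n).length := by simpa using hK
    rw [List.take_add_one, List.foldl_append, List.getElem?_eq_getElem hK']
    simp only [Option.toList_some, List.foldl_cons, List.foldl_nil, List.getElem_finRange]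
    set L := ((List.finRange n).take K).foldl (expand G E) (searchPaths G i E)
    refine ⟨h1.expand E _, ?_⟩
    have h2' := h2.setNat (b := 5) (by decide) 0 K
    have e4 : (w.setNat 5 0 K).nat 4 0 = E := by simp [hw 4 (by decide), hE']
    have e5 : (w.setNat 5 0 K).nat 5 0 = K := by simp
    generalize w.setNat 5 0 K = z at h2' e4 e5
    have hz : (Prog.ifLe (var 3) (var 4) .skip tryAppend).exec z =
        if L.length ≤ E then z else tryAppend.exec z := by
      simp only [Prog.exec, NatExpr.eval, h2'.count, e4]
    rw [hz, expand]
    split_ifs with h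
    · rw [List.getElem?_eq_none h]
      exact h2'
    · rw [List.getElem?_eq_getElem (by omega)]
      exact tryAppend_records h1 h2' (List.getElem?_eq_getElem (by omega)) e4 (by simpa using e5)

end Alg

end Search

end CrossGramian

namespace CrossGramian

open Matrix

/-! ### Correctness of the output -/

section Output

variable {𝕜 : Type*} [RCLike 𝕜] {r n : ℕ} {G : Matrix (Fin n × Fin r) (Fin n × Fin r) 𝕜}

theorem length_pathWord (p : List (Fin n)) : (pathWord p).length = p.length - 1 := by
  induction p with
  | nil => rfl
  | cons a l ih =>
    match l, ih with
    | [], _ => rfl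
    | b :: l, ih => rw [pathWord, List.length_cons, ih]; simp

theorem getElem?_pathWord {p : List (Fin n)} {c : ℕ} {a b : Fin n} (ha : p[c]? = some a)
    (hb : p[c + 1]? = some b) : (pathWord p)[c]? = some (a, b) := by
  induction p generalizing c with
  | nil => simp at ha
  | cons a' l ih =>
    rcases l with _ | ⟨b', l⟩
    · simp at hb
    · rcases c with _ | c
      · simp_all [pathWord]
      · rw [pathWord, List.getElem?_cons_succ]
        exact ih (by simpa using ha) (by simpa using hb)

theorem pathWord_append (l l' : List (Fin n)) (a b : Fin n) :
    pathWord ((l ++ [a]) ++ b :: l') = pathWord (l ++ [a]) ++ (a, b) :: pathWord (b :: l') := by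
  induction l with
  | nil => rfl
  | cons c l ih =>
    match l, ih with
    | [], ih => simp_all [pathWord]
    | d :: l, ih =>
      simp only [List.cons_append, pathWord] at ih ⊢
      rw [ih]

theorem adjWord_pathWord (p : List (Fin n)) : adjWord (pathWord p) = pathWord p.reverse := by
  induction p with
  | nil => rfl
  | cons a l ih =>
    match l, ih with
    | [], _ => rfl
    | b :: l, ih =>
      have h := pathWord_append l.reverse [] b a
      rw [pathWord, adjWord, List.map_cons, List.reverse_cons, ← adjWord, ih]
      simpa [pathWord] using h.symm

/-- The word made of the adjoint of the word of `s`, a joining letter, and the word of `t`. -/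
def pairWord (s t : List (Fin n)) : Word n := pathWord (s.reverse ++ t)

theorem pairWord_cons (a b : Fin n) (s t : List (Fin n)) :
    pairWord (a :: s) (b :: t) =
      adjWord (pathWord (a :: s)) ++ (a, b) :: pathWord (b :: t) := by
  rw [pairWord, List.reverse_cons, pathWord_append, adjWord_pathWord, List.reverse_cons]

/-- The two projections in the joining letter are absorbed by the neighbouring words. Hence the
trace of this long word can be computed from `G` and the two stored block columns. -/
theorem evalWord_pairWord (hG : IsCross G) {s t : List (Fin n)} (hs : 2 ≤ s.length)
    (ht : 2 ≤ t.length) : evalWord G (pairWord s t) =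
      (evalWord G (pathWord s))ᴴ * G * evalWord G (pathWord t) := by
  match s, t, hs, ht with
  | a :: a' :: s, b :: b' :: t, _, _ =>
    rw [pairWord_cons, evalWord_append, evalWord_cons, evalWord_adjWord hG, crossBlock]
    have h1 := blockProj_mul_evalWord_pathWord (𝕜 := 𝕜) (G := G) (a := a) (l := a' :: s) (by simp)
    have h2 := blockProj_mul_evalWord_pathWord (𝕜 := 𝕜) (G := G) (a := b) (l := b' :: t) (by simp)
    have h3 := congrArg conjTranspose h1
    rw [conjTranspose_mul, blockProj_isHermitian] at h3
    simp only [Matrix.mul_assoc, h2]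
    simp only [← Matrix.mul_assoc, h3]

/-- The letters of a word, as they appear on the output tape. -/
def letters (𝕜 : Type*) {n : ℕ} (w : Word n) : List (ℕ ⊕ 𝕜) :=
  w.flatMap fun x => [Sum.inl (x.1 : ℕ), Sum.inl (x.2 : ℕ)]

omit [RCLike 𝕜] in
theorem letters_append (v w : Word n) : letters 𝕜 (v ++ w) = letters 𝕜 v ++ letters 𝕜 w := by
  simp [letters]

omit [RCLike 𝕜] in
theorem letters_singleton (x : Fin n × Fin n) :
    letters 𝕜 [x] = [Sum.inl (x.1 : ℕ), Sum.inl (x.2 : ℕ)] := by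
  simp [letters]

omit [RCLike 𝕜] in
theorem encode_append (L L' : List (Word n × 𝕜)) : encode (L ++ L') = encode L ++ encode L' := by
  simp [encode]

omit [RCLike 𝕜] in
theorem encode_singleton (w : Word n) (t : 𝕜) : encode [(w, t)] = letters 𝕜 w ++ [Sum.inr t] := by
  simp [encode, letters]

/-- A word together with its trace. -/
def entry (G : Matrix (Fin n × Fin r) (Fin n × Fin r) 𝕜) (w : Word n) : Word n × 𝕜 :=
  (w, (evalWord G w).trace)

/-- The output for the `t`-th path. -/
def pathReport (G : Matrix (Fin n × Fin r) (Fin n × Fin r) 𝕜) (L : List (List (Fin n)))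
    (t : List (Fin n)) : List (Word n × 𝕜) :=
  entry G (pathWord t) :: L.map fun s => entry G (pairWord s t)

/-- The output of the program. -/
noncomputable def fullReport (G : Matrix (Fin n × Fin r) (Fin n × Fin r) 𝕜) :
    List (Word n × 𝕜) :=
  (List.finRange n).flatMap fun i =>
    (searchPaths G i (n * r * r)).flatMap (pathReport G (searchPaths G i (n * r * r)))

namespace Alg

variable {i : Fin n} {L : List (List (Fin n))}

/-- Since paths are stored backwards, the word is read off by descending indices and its adjoint, in
`outAdjWord_spec`, by ascending ones. -/
theorem outWord_spec (hL : IsPathList G i L) {m : Mem 𝕜} (hm : Records G i L m) {e : NatExpr}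
    {E : ℕ} (he : ∀ t : Mem 𝕜, (∀ b, b ≠ 14 → t.nat b = m.nat b) → e.eval t.nat = E)
    {p : List (Fin n)} (hp : L[E]? = some p) :
    ((outWord e).exec m).out = m.out ++ letters 𝕜 (pathWord p) := by
  have hlen := hm.len E p hp
  have hle := hL.length_le E p hp
  have hcard := hL.length_le_card
  have hEL : E < L.length := (List.getElem?_eq_some_iff.1 hp).1
  have key := Prog.exec_loop_guard (m := m) (a := 14) (e := eS) (c := .get 11 e)
    (p := .seq (.outNat (.get 12 (.minus (pathIx e (.get 11 e)) (var 14))))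
      (.outNat (.get 12 (.minus (pathIx e (.get 11 e)) (.plus (var 14) (.const 1))))))
    (n * r * r + 2) (m.nat 11 E) (by simp [hm.sized.rank, hm.sized.num]) (by omega)
    (fun t ht => by
      have : ∀ b, b ≠ 14 → t.nat b = m.nat b := fun b hb => ht b (by
        simp [Prog.writesNat, hb.symm])
      simp [he t this, this 11 (by decide)])
    (fun c t => t.out = m.out ++ letters 𝕜 ((pathWord p).take c)) (by simp [letters])
    (fun _ _ _ h => h) ?_
  · rwa [List.take_of_length_le (by rw [length_pathWord]; omega)] at key
  · intro c hc t ht _ _ htc hout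
    have ht' : ∀ b, b ≠ 14 → t.nat b = m.nat b := fun b hb => ht b (by
        simp [Prog.writesNat, hb.symm])
    have h1 : p[c]? = some (p[c]'(by omega)) := List.getElem?_eq_getElem _
    have h2 : p[c + 1]? = some (p[c + 1]'(by omega)) := List.getElem?_eq_getElem _
    have g1 := hm.path E p hp (m.nat 11 E - c) p[c] (by
      rw [List.getElem?_reverse (by omega), ← h1]; congr 1; omega)
    have g2 := hm.path E p hp (m.nat 11 E - (c + 1)) p[c + 1] (by
      rw [List.getElem?_reverse (by omega), ← h2]; congr 1; omega)
    rw [List.take_add_one, getElem?_pathWord h1 h2, Option.toList_some, letters_append,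
      letters_singleton, ← List.append_assoc, ← hout, Prog.exec_seq, Prog.exec_outNat,
      Prog.exec_outNat]
    simp only [Mem.emit_out, Mem.emit_nat, NatExpr.eval, he t ht', ht' 12 (by decide),
      ht' 11 (by decide), ht' 0 (by decide), ht' 1 (by decide), hm.sized.rank, hm.sized.num, htc,
      List.append_assoc]
    rw [Nat.add_sub_assoc (by omega), Nat.add_sub_assoc (by omega), g1, g2]
    rfl

theorem outAdjWord_spec (hL : IsPathList G i L) {m : Mem 𝕜} (hm : Records G i L m) {e : NatExpr}
    {E : ℕ} (he : ∀ t : Mem 𝕜, (∀ b, b ≠ 14 → t.nat b = m.nat b) → e.eval t.nat = E)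
    {p : List (Fin n)} (hp : L[E]? = some p) :
    ((outAdjWord e).exec m).out = m.out ++ letters 𝕜 (adjWord (pathWord p)) := by
  have hlen := hm.len E p hp
  have hle := hL.length_le E p hp
  have hcard := hL.length_le_card
  have hEL : E < L.length := (List.getElem?_eq_some_iff.1 hp).1
  rw [adjWord_pathWord]
  have key := Prog.exec_loop_guard (m := m) (a := 14) (e := eS) (c := .get 11 e)
    (p := .seq (.outNat (.get 12 (pathIx e (var 14))))
      (.outNat (.get 12 (pathIx e (.plus (var 14) (.const 1))))))
    (n * r * r + 2) (m.nat 11 E) (by simp [hm.sized.rank, hm.sized.num]) (by omega)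
    (fun t ht => by
      have : ∀ b, b ≠ 14 → t.nat b = m.nat b := fun b hb => ht b (by
        simp [Prog.writesNat, hb.symm])
      simp [he t this, this 11 (by decide)])
    (fun c t => t.out = m.out ++ letters 𝕜 ((pathWord p.reverse).take c)) (by simp [letters])
    (fun _ _ _ h => h) ?_
  · rwa [List.take_of_length_le (by rw [length_pathWord, List.length_reverse]; omega)] at key
  · intro c hc t ht _ _ htc hout
    have ht' : ∀ b, b ≠ 14 → t.nat b = m.nat b := fun b hb => ht b (by
        simp [Prog.writesNat, hb.symm])
    have h1 : p.reverse[c]? = some (p.reverse[c]'(by rw [List.length_reverse]; omega)) :=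
      List.getElem?_eq_getElem _
    have h2 : p.reverse[c + 1]? = some (p.reverse[c + 1]'(by rw [List.length_reverse]; omega)) :=
      List.getElem?_eq_getElem _
    have g1 := hm.path E p hp c _ h1
    have g2 := hm.path E p hp (c + 1) _ h2
    rw [List.take_add_one, getElem?_pathWord h1 h2, Option.toList_some, letters_append,
      letters_singleton, ← List.append_assoc, ← hout, Prog.exec_seq, Prog.exec_outNat,
      Prog.exec_outNat]
    simp only [Mem.emit_out, Mem.emit_nat, NatExpr.eval, he t ht', ht' 12 (by decide),
      ht' 0 (by decide), ht' 1 (by decide), hm.sized.rank, hm.sized.num, htc, List.append_assoc]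
    rw [g1, g2]
    rfl

/-- As `Y` ends in `Π_i`, only the diagonal entries of block `i` contribute. This leaves the triple
sum, with `n² r³` terms, that `tracePair` evaluates. -/
theorem trace_conjTranspose_mul_mul {i : Fin n} (X G : Matrix (Fin n × Fin r) (Fin n × Fin r) 𝕜)
    {Y : Matrix (Fin n × Fin r) (Fin n × Fin r) 𝕜} (hY : Y * blockProj 𝕜 i = Y) :
    (Xᴴ * G * Y).trace = ∑ a, ∑ b, ∑ c, star (X a (i, c)) * G a b * Y b (i, c) := by
  have h : (Xᴴ * G * Y).trace = ∑ c, (Xᴴ * G * Y) (i, c) (i, c) := by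
    rw [← hY, ← Matrix.mul_assoc, trace, Fintype.sum_prod_type, Finset.sum_eq_single i]
    · refine Finset.sum_congr rfl fun c _ => ?_
      rw [diag_apply]
    · intro j _ hj
      simp [blockProj, hj]
    · simp
  rw [h, Matrix.mul_assoc]
  simp only [Matrix.mul_apply, conjTranspose_apply, Finset.mul_sum]
  rw [Finset.sum_comm]
  refine Finset.sum_congr rfl fun a _ => ?_
  rw [Finset.sum_comm]
  simp only [mul_assoc]

theorem traceWord_spec (hL : IsPathList G i L) {m : Mem 𝕜} (hm : Records G i L m) {E : ℕ}
    (he : m.nat 4 0 = E) {p : List (Fin n)} (hp : L[E]? = some p) :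
    (traceWord.exec m).fld 7 0 = (evalWord G (pathWord p)).trace := by
  have hpL : p ∈ L := List.mem_of_getElem? hp
  simp only [traceWord, Prog.exec_seq]
  set m₁ := Prog.exec (.setFld 7 (.const 0) .zero) m with hm₁
  have h₁ : Records G i L m₁ := hm.exec (by decide) (by decide)
  have he₁ : m₁.nat 4 0 = E := he
  have d₁ : m₁.fld 7 0 = 0 := by simp [hm₁, Prog.exec_setFld]
  clear_value m₁
  rw [Prog.exec_loop_add r (by simp [h₁.sized.rank])
    (fun q x => if x = 0 then m₁.fld 1 (E * (n * r * r) + ((i * r + q) * r + q)) else 0)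
    (by intro c hc; simp [Prog.writesFld, hc.symm]) ?_ 0, d₁, zero_add]
  · simp only [if_true]
    rw [← evalWord_pathWord_mul_blockProj (hL.two_le p hpL) (hL.getLast p hpL), trace,
      Fintype.sum_prod_type, Finset.sum_eq_single i, ← Fin.sum_univ_eq_sum_range
        (fun q => m₁.fld 1 (E * (n * r * r) + ((i * r + q) * r + q)))]
    · refine Finset.sum_congr rfl fun q _ => ?_
      have := h₁.col E p hp ((i, q), q)
      rw [colMap_apply] at this
      rw [diag_apply, blockProj, mul_diagonal, if_pos rfl, mul_one]
      exact this
    · intro j _ hj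
      simp [blockProj, hj]
    · simp
  · intro q hq t ht hf htq x
    rw [Prog.exec_setFld_add]
    simp [ht 0 (by decide), ht 1 (by decide), ht 2 (by decide), ht 4 (by decide), htq,
      hf 1 (by decide), h₁.sized.rank, h₁.sized.num, he₁, h₁.vertex]

theorem tracePair_spec {m : Mem 𝕜} (hm : Records G i L m) (hL : IsPathList G i L) {E F : ℕ}
    (he : m.nat 4 0 = E) (hf : m.nat 13 0 = F) {p q : List (Fin n)} (hp : L[E]? = some p)
    (hq : L[F]? = some q) :
    (tracePair.exec m).fld 7 0 =
      ((evalWord G (pathWord q))ᴴ * G * evalWord G (pathWord p)).trace := by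
  have hpL : p ∈ L := List.mem_of_getElem? hp
  simp only [tracePair, Prog.exec_seq]
  set m₁ := Prog.exec (.setFld 7 (.const 0) .zero) m with hm₁
  have h₁ : Records G i L m₁ := hm.exec (by decide) (by decide)
  have he₁ : m₁.nat 4 0 = E := he
  have hf₁ : m₁.nat 13 0 = F := hf
  have d₁ : m₁.fld 7 0 = 0 := by simp [hm₁, Prog.exec_setFld]
  clear_value m₁
  rw [Prog.exec_loop_add (n * r) (by simp [h₁.sized.rank, h₁.sized.num])
    (fun a x => ∑ b ∈ Finset.range (n * r), ∑ c ∈ Finset.range r,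
      if x = 0 then star (m₁.fld 1 (F * (n * r * r) + (a * r + c))) *
        m₁.fld 0 (a * (n * r) + b) * m₁.fld 1 (E * (n * r * r) + (b * r + c)) else 0)
    (by intro c hc; simp [Prog.writesFld, hc.symm]) ?_ 0, d₁, zero_add]
  · simp only [if_true]
    have hcol : ∀ (E : ℕ) (p : List (Fin n)), L[E]? = some p → ∀ (a : Fin n × Fin r) (c : Fin r),
        m₁.fld 1 (E * (n * r * r) + (rowIdx a * r + c)) = evalWord G (pathWord p) a (i, c) :=
      fun E p hp a c => h₁.col E p hp (a, c)
    rw [trace_conjTranspose_mul_mul _ _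
      (evalWord_pathWord_mul_blockProj (hL.two_le p hpL) (hL.getLast p hpL)), sum_range_rowIdx]
    refine Finset.sum_congr rfl fun a _ => ?_
    rw [sum_range_rowIdx]
    refine Finset.sum_congr rfl fun b _ => ?_
    rw [Finset.sum_range]
    refine Finset.sum_congr rfl fun c _ => ?_
    rw [← hcol F q hq, ← hcol E p hp, h₁.gram]
  · intro a ha t ht hft hta
    have hs_t := h₁.sized.of_eq (ht 0 (by decide)) (ht 1 (by decide))
    refine Prog.exec_loop_add (m := t) (n * r) (by simp [hs_t.rank, hs_t.num]) _
      (by intro c hc; simp [Prog.writesFld, hc.symm]) ?_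
    intro b hb u hu hfu hub
    have hs_u := hs_t.of_eq (hu 0 (by decide)) (hu 1 (by decide))
    refine Prog.exec_loop_add (m := u) r (by simp [hs_u.rank]) _
      (by intro c hc; simp [Prog.writesFld, hc.symm]) ?_
    intro c hc w hw hfw hwc x
    have hs_w := hs_u.of_eq (hw 0 (by decide)) (hw 1 (by decide))
    rw [Prog.exec_setFld_add]
    have g13 : w.nat 13 0 = F := by
      rw [hw 13 (by decide), hu 13 (by decide), ht 13 (by decide), hf₁]
    have g4 : w.nat 4 0 = E := by
      rw [hw 4 (by decide), hu 4 (by decide), ht 4 (by decide), he₁]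
    have g8 : w.nat 8 0 = a := by rw [hw 8 (by decide), hu 8 (by decide), hta]
    have g10 : w.nat 10 0 = b := by rw [hw 10 (by decide), hub]
    have gf0 : w.fld 0 = m₁.fld 0 := by
      rw [hfw 0 (by decide), hfu 0 (by decide), hft 0 (by decide)]
    have gf1 : w.fld 1 = m₁.fld 1 := by
      rw [hfw 1 (by decide), hfu 1 (by decide), hft 1 (by decide)]
    simp [hs_w.rank, hs_w.num, g13, g4, g8, g10, hwc, gf0, gf1]

end Alg

end Output

end CrossGramian

/-! ### The output tape and the cost of the whole program -/

namespace CrossGramian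

open Matrix

namespace Alg

variable {𝕜 : Type*} [RCLike 𝕜] {r n : ℕ} {G : Matrix (Fin n × Fin r) (Fin n × Fin r) 𝕜}
  {i : Fin n} {L : List (List (Fin n))}

theorem outSingle_spec (hL : IsPathList G i L) {m : Mem 𝕜} (hm : Records G i L m) {E : ℕ}
    (he : m.nat 4 0 = E) {p : List (Fin n)} (hp : L[E]? = some p) :
    (outSingle.exec m).out = m.out ++ encode [entry G (pathWord p)] := by
  simp only [outSingle, Prog.exec_seq]
  have h₁ := outWord_spec hL hm (e := var 4) (fun t ht => by simp [ht 4 (by decide), he]) hp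
  set m₁ := (outWord (var 4)).exec m with hm₁
  have g₁ : Records G i L m₁ := hm.exec (by decide) (by decide)
  have he₁ : m₁.nat 4 0 = E := by rw [hm₁, Prog.exec_nat_of_not_writes (by decide), he]
  clear_value m₁
  have h₂ := traceWord_spec hL g₁ he₁ hp
  rw [Prog.exec_outFld, Mem.emit_out, Prog.exec_out_of_not_writes (by decide), h₁, entry,
    encode_singleton, FldExpr.eval, NatExpr.eval, h₂, List.append_assoc]

theorem outPair_spec (hG : IsCross G) (hL : IsPathList G i L) {m : Mem 𝕜} (hm : Records G i L m)
    {E F : ℕ} (he : m.nat 4 0 = E) (hf : m.nat 13 0 = F) {p q : List (Fin n)}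
    (hp : L[E]? = some p) (hq : L[F]? = some q) :
    (outPair.exec m).out = m.out ++ encode [entry G (pairWord q p)] := by
  have hpL : p ∈ L := List.mem_of_getElem? hp
  have hqL : q ∈ L := List.mem_of_getElem? hq
  simp only [outPair, Prog.exec_seq]
  have h₁ := outAdjWord_spec hL hm (e := var 13) (fun t ht => by simp [ht 13 (by decide), hf]) hq
  set m₁ := (outAdjWord (var 13)).exec m with hm₁
  have g₁ : Records G i L m₁ := hm.exec (by decide) (by decide)
  have he₁ : m₁.nat 4 0 = E := by rw [hm₁, Prog.exec_nat_of_not_writes (by decide), he]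
  have hf₁ : m₁.nat 13 0 = F := by rw [hm₁, Prog.exec_nat_of_not_writes (by decide), hf]
  clear_value m₁
  simp only [Prog.exec_outNat, Mem.emit_nat]
  set m₂ := (m₁.emit (Sum.inl (NatExpr.eval m₁.nat (.get 12 (pathIx (var 13)
    (.get 11 (var 13))))))).emit (Sum.inl (NatExpr.eval m₁.nat (.get 12 (pathIx (var 4)
    (.get 11 (var 4)))))) with hm₂
  have g₂ : Records G i L m₂ := g₁.of_eq rfl rfl rfl rfl rfl rfl rfl rfl rfl
  have he₂ : m₂.nat 4 0 = E := he₁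
  have hf₂ : m₂.nat 13 0 = F := hf₁
  obtain ⟨a, p', rfl⟩ := List.exists_cons_of_ne_nil (l := p)
    (List.ne_nil_of_length_pos (by have := hL.two_le p hpL; omega))
  obtain ⟨b, q', rfl⟩ := List.exists_cons_of_ne_nil (l := q)
    (List.ne_nil_of_length_pos (by have := hL.two_le q hqL; omega))
  have lp := g₁.len E _ hp
  have lq := g₁.len F _ hq
  -- In a record stored backwards, the first vertex of the path has the number of letters as its
  -- index.
  have vp := g₁.path E _ hp (m₁.nat 11 E) a (by
    rw [List.length_cons] at lp
    rw [List.reverse_cons, List.getElem?_append_right (by simp; omega)]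
    simp [show m₁.nat 11 E = p'.length by omega])
  have vq := g₁.path F _ hq (m₁.nat 11 F) b (by
    rw [List.length_cons] at lq
    rw [List.reverse_cons, List.getElem?_append_right (by simp; omega)]
    simp [show m₁.nat 11 F = q'.length by omega])
  have h₂ : m₂.out = m₁.out ++ letters 𝕜 [(b, a)] := by
    simp [hm₂, letters_singleton, he₁, hf₁, g₁.sized.rank, g₁.sized.num, vp, vq]
  clear_value m₂
  have h₃ := outWord_spec hL g₂ (e := var 4) (fun t ht => by simp [ht 4 (by decide), he₂]) hp
  set m₃ := (outWord (var 4)).exec m₂ with hm₃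
  have g₃ : Records G i L m₃ := g₂.exec (by decide) (by decide)
  have he₃ : m₃.nat 4 0 = E := by rw [hm₃, Prog.exec_nat_of_not_writes (by decide), he₂]
  have hf₃ : m₃.nat 13 0 = F := by rw [hm₃, Prog.exec_nat_of_not_writes (by decide), hf₂]
  clear_value m₃
  have h₄ := tracePair_spec g₃ hL he₃ hf₃ hp hq
  rw [Prog.exec_outFld, Mem.emit_out, Prog.exec_out_of_not_writes (by decide), h₃, h₂, h₁, entry,
    encode_singleton, FldExpr.eval, NatExpr.eval, h₄,
    evalWord_pairWord hG (hL.two_le _ hqL) (hL.two_le _ hpL), pairWord_cons,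
    show (b, a) :: pathWord (a :: p') = [(b, a)] ++ pathWord (a :: p') from rfl, letters_append,
    letters_append]
  simp only [List.append_assoc]

theorem report_spec (hG : IsCross G) (hL : IsPathList G i L) {m : Mem 𝕜} (hm : Records G i L m) :
    (report.exec m).out = m.out ++ encode (L.flatMap (pathReport G L)) := by
  have key := Prog.exec_loop_guard (m := m) (a := 4) (e := eM) (c := var 3)
    (p := .seq outSingle (.loop 13 eM (.ifLe (var 3) (var 13) .skip outPair)))
    (n * r * r) L.length (by simp [hm.sized.rank, hm.sized.num]) hL.length_le_card
    (fun t ht => by simp [ht 3 (by decide), hm.count])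
    (fun K t => Records G i L t ∧ t.out = m.out ++ encode ((L.take K).flatMap (pathReport G L)))
    ⟨hm, by simp [encode]⟩ (fun _ _ _ h => ⟨h.1.setNat (by decide) _ _, h.2⟩) ?_
  · rw [List.take_length] at key
    exact key.2
  rintro E hE t - - - he ⟨h1, h2⟩
  have hp : L[E]? = some L[E] := List.getElem?_eq_getElem hE
  rw [Prog.exec_seq, List.take_add_one, hp, Option.toList_some, List.flatMap_append,
    List.flatMap_singleton, encode_append, ← List.append_assoc, ← h2]
  have h₁ := outSingle_spec hL h1 he hp
  set t₁ := outSingle.exec t with ht₁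
  have g₁ : Records G i L t₁ := h1.exec (by decide) (by decide)
  have he₁ : t₁.nat 4 0 = E := by rw [ht₁, Prog.exec_nat_of_not_writes (by decide), he]
  clear_value t₁
  have key := Prog.exec_loop_guard (m := t₁) (a := 13) (e := eM) (c := var 3) (p := outPair)
    (n * r * r) L.length (by simp [g₁.sized.rank, g₁.sized.num]) hL.length_le_card
    (fun t ht => by simp [ht 3 (by decide), g₁.count])
    (fun K s => Records G i L s ∧ s.nat 4 0 = E ∧
      s.out = t₁.out ++ encode ((L.take K).map fun s => entry G (pairWord s L[E])))
    ⟨g₁, he₁, by simp [encode]⟩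
    (fun _ _ _ h => ⟨h.1.setNat (by decide) _ _, by simpa using h.2.1, h.2.2⟩) ?_
  · rw [List.take_length] at key
    refine ⟨key.1, ?_⟩
    rw [key.2.2, h₁, List.append_assoc, ← encode_append]
    rfl
  · rintro F hF s - - - hf ⟨k1, k2, k3⟩
    have hq : L[F]? = some L[F] := List.getElem?_eq_getElem hF
    refine ⟨k1.exec (by decide) (by decide), ?_, ?_⟩
    · rw [Prog.exec_nat_of_not_writes (by decide), k2]
    · rw [outPair_spec hG hL k1 k2 hf hp hq, k3, List.take_add_one, hq, Option.toList_some,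
        List.map_append, encode_append, List.append_assoc]
      rfl

theorem main_spec (hG : IsCross G) (hr : 1 ≤ r) {m : Mem 𝕜} (hm : Sized r n m)
    (hg : HoldsMat (m.fld 0) G) : (main.exec m).out = m.out ++ encode (fullReport G) := by
  have key := Prog.exec_loop (m := m) (a := 2) (e := var 1) (p := .seq start (.seq search report))
    n (by simp [hm.num]) (fun K t => t.out = m.out ++
      encode (((List.finRange n).take K).flatMap fun i =>
        (searchPaths G i (n * r * r)).flatMap (pathReport G (searchPaths G i (n * r * r)))))
    (by simp [encode]) ?_
  · rw [List.take_of_length_le (by simp)] at key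
    exact key
  intro K hK t ht hf _ hout
  have hK' : K < (List.finRange n).length := by simpa using hK
  rw [List.take_add_one, List.getElem?_eq_getElem hK', Option.toList_some, List.flatMap_append,
    List.flatMap_singleton, encode_append, ← List.append_assoc, ← hout]
  simp only [List.getElem_finRange, Prog.exec_seq]
  have hs : Sized r n (t.setNat 2 0 K) :=
    (hm.of_eq (ht 0 (by decide)) (ht 1 (by decide))).of_eq (Mem.setNat_nat_of_ne _ _ _ (by decide))
      (Mem.setNat_nat_of_ne _ _ _ (by decide))
  have h1 := start_records hG hs (i := ⟨K, hK⟩) (by simp)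
    (by rw [Mem.setNat_fld, hf 0 (by decide)]; exact hg)
  have h2 := search_records hG hr h1
  have h3 := report_spec hG (searchPaths_spec hG hr _ _).1 h2
  rw [h3, Prog.exec_out_of_not_writes (p := search) (by decide),
    Prog.exec_out_of_not_writes (p := start) (by decide)]
  rfl

theorem holdsMat_input (G : Matrix (Fin n × Fin r) (Fin n × Fin r) 𝕜) :
    HoldsMat ((input r n G).fld 0) G := by
  intro p q
  have hp : rowIdx p * (n * r) + rowIdx q = (finProdFinEquiv (finProdFinEquiv p, finProdFinEquiv q) :
      ℕ) := by
    rw [finProdFinEquiv_apply_val, rowIdx_eq, rowIdx_eq]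
    ring
  have hlt : (0 = 0 ∧ rowIdx p * (n * r) + rowIdx q < (n * r) * (n * r)) :=
    ⟨rfl, hp ▸ (finProdFinEquiv (finProdFinEquiv p, finProdFinEquiv q)).2⟩
  have hfin : (⟨rowIdx p * (n * r) + rowIdx q, hlt.2⟩ : Fin ((n * r) * (n * r))) =
      finProdFinEquiv (finProdFinEquiv p, finProdFinEquiv q) := Fin.ext hp
  refine (dif_pos hlt).trans ?_
  rw [hfin]
  simp

theorem run_main (hG : IsCross G) (hr : 1 ≤ r) (hn : 1 ≤ n) :
    (main.run (input r n G)).out = encode (fullReport G) ∧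
      (main.run (input r n G)).time ≤ 10000 * (r ^ 8 * n ^ 5 + r ^ 9 * n ^ 3) := by
  have hs : Sized r n (input r n G).mem := ⟨by simp [input, State.mem], by simp [input, State.mem]⟩
  constructor
  · have := congrArg Mem.out (Prog.run_mem main (input r n G))
    rw [main_spec hG hr hs (holdsMat_input G)] at this
    simpa [State.mem, input] using this
  · have := (Prog.time_run_le static_main (input r n G).nat (input r n G) fun _ _ => rfl).2
    refine this.trans ?_
    have hb := bound_main_le (input r n G).nat hs.rank hs.num hr hn
    simpa [input] using hb

end Alg

end CrossGramian

namespace CrossGramian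

/-! ### Representations with equal traces -/

section Specht

open Module LinearMap
open scoped InnerProductSpace

variable {𝕜 : Type*} [RCLike 𝕜]

theorem exists_real_eigenvector {E : Type*} [NormedAddCommGroup E] [InnerProductSpace 𝕜 E]
    [FiniteDimensional 𝕜 E] {T : E →ₗ[𝕜] E} (hT : T.IsSymmetric) {V : Submodule 𝕜 E}
    (hV : ∀ v ∈ V, T v ∈ V) (h0 : V ≠ ⊥) : ∃ v ∈ V, v ≠ 0 ∧ ∃ c : ℝ, T v = (c : 𝕜) • v := by
  have : Nontrivial V := Submodule.nontrivial_iff_ne_bot.2 h0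
  obtain ⟨v, hv⟩ :=
    (hT.restrict_invariant hV).hasEigenvalue_iSup_of_finiteDimensional.exists_hasEigenvector
  refine ⟨v, v.2, fun h => hv.2 (Subtype.ext h), _, congrArg Subtype.val hv.apply_eq_smul⟩

/-- Equal norms force equal kernels, so sending `Φ x` to `Ψ x` is well defined. It is used for
cyclic subspaces of representations and for matrices with equal Gramians. -/
theorem exists_linearIsometryEquiv_range {R E F : Type*} [AddCommGroup R] [Module 𝕜 R]
    [NormedAddCommGroup E] [NormedSpace 𝕜 E] [NormedAddCommGroup F] [NormedSpace 𝕜 F]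
    (Φ : R →ₗ[𝕜] E) (Ψ : R →ₗ[𝕜] F) (h : ∀ x, ‖Φ x‖ = ‖Ψ x‖) :
    ∃ U : range Φ ≃ₗᵢ[𝕜] range Ψ, ∀ x, U (Φ.rangeRestrict x) = Ψ.rangeRestrict x := by
  have hker : ker Φ = ker Ψ := by
    ext x
    rw [mem_ker, mem_ker, ← norm_eq_zero, h, norm_eq_zero]
  let e : range Φ ≃ₗ[𝕜] range Ψ :=
    Φ.quotKerEquivRange.symm ≪≫ₗ Submodule.quotEquivOfEq _ _ hker ≪≫ₗ Ψ.quotKerEquivRange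
  have he : ∀ x, e (Φ.rangeRestrict x) = Ψ.rangeRestrict x := by
    intro x
    have : Φ.rangeRestrict x = Φ.quotKerEquivRange (Submodule.Quotient.mk x) := rfl
    rw [this]
    simp only [e, LinearEquiv.trans_apply, LinearEquiv.symm_apply_apply,
      Submodule.quotEquivOfEq_mk]
    rfl
  refine ⟨⟨e, ?_⟩, he⟩
  rintro ⟨_, x, rfl⟩
  have := he x
  change ‖e (Φ.rangeRestrict x)‖ = _
  rw [this]
  exact (h x).symm

/-- The representations `π` and `ρ` have a common adjoint operation. -/
def HasAdjoints {R E F : Type*} [Ring R] [Algebra 𝕜 R] [NormedAddCommGroup E]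
    [InnerProductSpace 𝕜 E] [NormedAddCommGroup F] [InnerProductSpace 𝕜 F]
    (π : R →ₐ[𝕜] End 𝕜 E) (ρ : R →ₐ[𝕜] End 𝕜 F) : Prop :=
  ∀ x, ∃ y, (∀ u v, ⟪π y u, v⟫_𝕜 = ⟪u, π x v⟫_𝕜) ∧ ∀ u v, ⟪ρ y u, v⟫_𝕜 = ⟪u, ρ x v⟫_𝕜

section

variable {R E F : Type*} [Ring R] [Algebra 𝕜 R] [NormedAddCommGroup E]
    [InnerProductSpace 𝕜 E] [NormedAddCommGroup F] [InnerProductSpace 𝕜 F]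
    {π : R →ₐ[𝕜] End 𝕜 E} {ρ : R →ₐ[𝕜] End 𝕜 F}

theorem HasAdjoints.symm (h : HasAdjoints π ρ) : HasAdjoints ρ π := fun x =>
  (h x).imp fun _ hy => ⟨hy.2, hy.1⟩

/-- If `y` acts as the adjoint of `x`, then the trace of `ρ (y * x)` is the sum of the squared norms
of `ρ x` on an orthonormal basis, and it equals the trace of `π (y * x) = 0`. -/
theorem HasAdjoints.eq_zero_of_eq_zero [FiniteDimensional 𝕜 F] (h : HasAdjoints π ρ)
    (htr : ∀ x, trace 𝕜 E (π x) = trace 𝕜 F (ρ x)) {x : R} (hx : π x = 0) : ρ x = 0 := by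
  obtain ⟨y, -, hy⟩ := h x
  have h0 : trace 𝕜 F (ρ (y * x)) = 0 := by rw [← htr, map_mul, hx, mul_zero, map_zero]
  let b := stdOrthonormalBasis 𝕜 F
  rw [trace_eq_sum_inner _ b] at h0
  have h1 : ∀ i, ⟪b i, ρ (y * x) (b i)⟫_𝕜 = ((‖ρ x (b i)‖ ^ 2 : ℝ) : 𝕜) := by
    intro i
    rw [← inner_conj_symm, map_mul, Module.End.mul_apply, hy, inner_conj_symm,
      inner_self_eq_norm_sq_to_K]
    norm_cast
  simp only [h1] at h0
  rw [← RCLike.ofReal_sum, RCLike.ofReal_eq_zero,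
    Finset.sum_eq_zero_iff_of_nonneg (fun _ _ => by positivity)] at h0
  refine b.toBasis.ext fun i => ?_
  simpa using h0 i (Finset.mem_univ i)

/-- There is an element of `R` acting as a minimal projection. -/
theorem exists_minimal_projection [FiniteDimensional 𝕜 E] [Nontrivial E] (h : HasAdjoints π ρ) :
    ∃ p, π p ≠ 0 ∧ π (p * p) = π p ∧ (π p).IsSymmetric ∧
      ∀ x, (π (p * x * p)).IsSymmetric → ∃ c : ℝ, π (p * x * p) = π ((c : 𝕜) • p) := by
  classical
  -- The projection is a multiple of `x₀* x₀`, where `π x₀` has the least nonzero rank.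
  have hex : ∃ N, ∃ x, π x ≠ 0 ∧ finrank 𝕜 (range (π x)) = N :=
    ⟨_, 1, by rw [map_one]; exact one_ne_zero, rfl⟩
  obtain ⟨x₀, hx₀, hN⟩ := Nat.find_spec hex
  have hmin : ∀ x, finrank 𝕜 (range (π x)) < finrank 𝕜 (range (π x₀)) → π x = 0 := by
    intro x hx
    by_contra h0
    rw [hN] at hx
    exact Nat.find_min hex hx ⟨x, h0, rfl⟩
  obtain ⟨y₀, hy₀, -⟩ := h x₀
  set q := y₀ * x₀ with hq
  have hqs : (π q).IsSymmetric := by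
    intro u v
    rw [hq, map_mul, Module.End.mul_apply, Module.End.mul_apply, hy₀,
      ← inner_conj_symm u (π y₀ (π x₀ v)), hy₀, inner_conj_symm]
  have hkerq : ∀ u, π x₀ u = 0 → π q u = 0 := fun u hu => by
    rw [hq, map_mul, Module.End.mul_apply, hu, map_zero]
  -- The range of the symmetric operator `π q` meets its kernel trivially. So if `π x` vanishes on
  -- the kernel and at a nonzero vector of the range, its rank is below the minimum.
  have hker : ∀ x, (∀ u, π q u = 0 → π x u = 0) → ∀ v ∈ range (π q), v ≠ 0 → π x v = 0 →
      π x = 0 := by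
    intro x hx v hv hv0 hxv
    refine hmin x ?_
    have hlt : ker (π x₀) < ker (π x) := by
      refine SetLike.lt_iff_le_and_exists.2 ⟨fun u hu => hx u (hkerq u hu), v, hxv, fun hv' => ?_⟩
      obtain ⟨w, rfl⟩ := hv
      have := hkerq _ hv'
      refine hv0 (inner_self_eq_zero (𝕜 := 𝕜).1 ?_)
      rw [hqs w, this, inner_zero_right]
    have h1 := Submodule.finrank_lt_finrank_of_lt hlt
    have h2 := finrank_range_add_finrank_ker (π x)
    have h3 := finrank_range_add_finrank_ker (π x₀)
    omega
  have hq0 : π q ≠ 0 := by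
    intro h0
    refine hx₀ (LinearMap.ext fun u => inner_self_eq_zero (𝕜 := 𝕜).1 ?_)
    rw [← hy₀, ← Module.End.mul_apply, ← map_mul, ← hq, h0, LinearMap.zero_apply, inner_zero_left]
  clear_value q
  have hV0 : range (π q) ≠ ⊥ := fun h0 => hq0 (range_eq_bot.1 h0)
  obtain ⟨v, hv, hv0, c, hc⟩ := exists_real_eigenvector hqs (V := range (π q))
    (fun u _ => mem_range_self _ _) hV0
  have hc0 : (c : 𝕜) ≠ 0 := by
    intro h0
    rw [h0, zero_smul] at hc
    obtain ⟨w, rfl⟩ := hv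
    refine hv0 (inner_self_eq_zero (𝕜 := 𝕜).1 ?_)
    rw [hqs w, hc, inner_zero_right]
  -- The element `q² - c q` kills the kernel of `π q` and the eigenvector `v`.
  have hqq : π (q * q) = (c : 𝕜) • π q := by
    have := hker (q * q - (c : 𝕜) • q) (fun u hu => by simp [hu]) v hv hv0 (by
      simp [hc])
    rwa [map_sub, map_smul, sub_eq_zero] at this
  have hpr : ∀ u, π ((c : 𝕜)⁻¹ • q) u = (c : 𝕜)⁻¹ • π q u := fun u => by
    rw [map_smul, LinearMap.smul_apply]
  refine ⟨(c : 𝕜)⁻¹ • q, ?_, ?_, ?_, ?_⟩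
  · rw [map_smul]
    exact smul_ne_zero (inv_ne_zero hc0) hq0
  · rw [smul_mul_smul_comm, map_smul, hqq, map_smul, smul_smul, mul_assoc, inv_mul_cancel₀ hc0,
      mul_one]
  · intro u w
    rw [hpr, hpr, inner_smul_left, inner_smul_right, hqs u w]
    simp
  · intro x hx
    -- The same argument for `p x p - d p`. Only symmetric `π (p x p)` are treated, because over the
    -- reals the compressed algebra need not consist of scalars.
    obtain ⟨w, hw, hw0, d, hd⟩ := exists_real_eigenvector hx (V := range (π q)) (by
      intro u _
      rw [map_mul, map_mul, Module.End.mul_apply, Module.End.mul_apply, hpr]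
      exact Submodule.smul_mem _ _ (mem_range_self _ _)) hV0
    refine ⟨d, ?_⟩
    have hpw : π ((c : 𝕜)⁻¹ • q) w = w := by
      obtain ⟨w, rfl⟩ := hw
      rw [hpr, ← Module.End.mul_apply, ← map_mul, hqq, LinearMap.smul_apply, smul_smul,
        inv_mul_cancel₀ hc0, one_smul]
    have := hker ((c : 𝕜)⁻¹ • q * x * (c : 𝕜)⁻¹ • q - (d : 𝕜) • (c : 𝕜)⁻¹ • q)
      (fun u hu => by
        rw [map_sub, LinearMap.sub_apply, map_mul, Module.End.mul_apply, map_smul π (d : 𝕜),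
          LinearMap.smul_apply, hpr, hu]
        simp) w hw hw0 (by
        rw [map_sub, LinearMap.sub_apply, hd, map_smul π (d : 𝕜), LinearMap.smul_apply, hpw,
          sub_self])
    rwa [map_sub, sub_eq_zero] at this

/-- There are unit vectors such that all elements of `R` send them to vectors of equal norm. -/
theorem exists_norm_eq [FiniteDimensional 𝕜 E] [Nontrivial E] [FiniteDimensional 𝕜 F]
    (h : HasAdjoints π ρ) (htr : ∀ x, trace 𝕜 E (π x) = trace 𝕜 F (ρ x)) :
    ∃ (v : E) (w : F), v ≠ 0 ∧ ∀ x, ‖π x v‖ = ‖ρ x w‖ := by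
  obtain ⟨p, hp0, hpp, hps, hpx⟩ := exists_minimal_projection h
  have hρ : ∀ x y, π x = π y → ρ x = ρ y := fun x y hxy => by
    rw [← sub_eq_zero, ← map_sub] at hxy ⊢
    exact h.eq_zero_of_eq_zero htr hxy
  have hπ : ∀ x, ρ x = 0 → π x = 0 := fun x hx =>
    h.symm.eq_zero_of_eq_zero (fun x => (htr x).symm) hx
  -- The two representations have the same kernel, so relations that hold under `π`, such as
  -- self-adjointness and idempotence of `p`, also hold under `ρ`.
  have hρps : (ρ p).IsSymmetric := by
    obtain ⟨y, hy1, hy2⟩ := h p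
    have : π y = π p := LinearMap.ext fun u => ext_inner_right 𝕜 fun v => by rw [hy1, hps u v]
    rw [← hρ _ _ this] at hy2 ⊢
    exact hy2
  obtain ⟨v', hv'⟩ : ∃ v', π p v' ≠ 0 := by
    by_contra! h0
    exact hp0 (LinearMap.ext h0)
  obtain ⟨w', hw'⟩ : ∃ w', ρ p w' ≠ 0 := by
    by_contra! h0
    exact hp0 (hπ p (LinearMap.ext h0))
  set v := ((‖π p v'‖⁻¹ : ℝ) : 𝕜) • π p v' with hv
  set w := ((‖ρ p w'‖⁻¹ : ℝ) : 𝕜) • ρ p w' with hw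
  have hv1 : ‖v‖ = 1 := by
    rw [hv, norm_smul, RCLike.norm_ofReal, abs_inv, abs_norm,
      inv_mul_cancel₀ (norm_ne_zero_iff.2 hv')]
  have hw1 : ‖w‖ = 1 := by
    rw [hw, norm_smul, RCLike.norm_ofReal, abs_inv, abs_norm,
      inv_mul_cancel₀ (norm_ne_zero_iff.2 hw')]
  have hpv : π p v = v := by
    rw [hv, map_smul, ← Module.End.mul_apply, ← map_mul, hpp]
  have hpw : ρ p w = w := by
    rw [hw, map_smul, ← Module.End.mul_apply, ← map_mul, hρ _ _ hpp]
  clear_value v w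
  refine ⟨v, w, fun h0 => by simp [h0] at hv1, fun x => ?_⟩
  obtain ⟨y, hy1, hy2⟩ := h x
  have e1 : ∀ u u', ⟪π (p * (y * x) * p) u, u'⟫_𝕜 = ⟪π x (π p u), π x (π p u')⟫_𝕜 := by
    intro u u'
    rw [map_mul, map_mul, map_mul, Module.End.mul_apply, Module.End.mul_apply, Module.End.mul_apply,
      hps, hy1]
  have e2 : ∀ u u', ⟪ρ (p * (y * x) * p) u, u'⟫_𝕜 = ⟪ρ x (ρ p u), ρ x (ρ p u')⟫_𝕜 := by
    intro u u'
    rw [map_mul, map_mul, map_mul, Module.End.mul_apply, Module.End.mul_apply, Module.End.mul_apply,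
      hρps, hy2]
  -- With `y` adjoint to `x`, the symmetric element `p y x p` acts as `c p` in both representations,
  -- and `c` is the squared norm of both `π x v` and `ρ x w`.
  obtain ⟨c, hc⟩ := hpx (y * x) fun u u' => by
    rw [e1, ← inner_conj_symm u, e1, inner_conj_symm]
  have hc' := hρ _ _ hc
  have n1 : ⟪π x v, π x v⟫_𝕜 = (c : 𝕜) := by
    have := e1 v v
    rw [hpv, hc, map_smul, LinearMap.smul_apply, hpv, inner_smul_left, inner_self_eq_norm_sq_to_K,
      hv1] at this
    simpa using this.symm
  have n2 : ⟪ρ x w, ρ x w⟫_𝕜 = (c : 𝕜) := by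
    have := e2 w w
    rw [hpw, hc', map_smul, LinearMap.smul_apply, hpw, inner_smul_left, inner_self_eq_norm_sq_to_K,
      hw1] at this
    simpa using this.symm
  rw [norm_eq_sqrt_re_inner (𝕜 := 𝕜), norm_eq_sqrt_re_inner (𝕜 := 𝕜), n1, n2]

/-- The restriction of a representation to an invariant subspace. -/
def restrictRep (π : R →ₐ[𝕜] End 𝕜 E) (V : Submodule 𝕜 E) (hV : ∀ x, ∀ v ∈ V, π x v ∈ V) :
    R →ₐ[𝕜] End 𝕜 V :=
  AlgHom.ofLinearMap
    { toFun := fun x => (π x).restrict (hV x)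
      map_add' := fun x y => by ext; simp
      map_smul' := fun c x => by ext; simp }
    (by ext; simp) (fun x y => by ext; simp)

theorem restrictRep_apply (V : Submodule 𝕜 E) (hV : ∀ x, ∀ v ∈ V, π x v ∈ V) (x : R) (v : V) :
    (restrictRep π V hV x v : E) = π x v := rfl

theorem HasAdjoints.mem_orthogonal (h : HasAdjoints π ρ) {V : Submodule 𝕜 E}
    (hV : ∀ x, ∀ v ∈ V, π x v ∈ V) (x : R) (v : E) (hv : v ∈ Vᗮ) : π x v ∈ Vᗮ := by
  obtain ⟨y, hy, -⟩ := h x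
  rw [Submodule.mem_orthogonal] at hv ⊢
  intro u hu
  rw [← hy]
  exact hv _ (hV y u hu)

theorem trace_eq_add_trace_restrictRep [FiniteDimensional 𝕜 E] (V : Submodule 𝕜 E)
    (hV : ∀ x, ∀ v ∈ V, π x v ∈ V) (hV' : ∀ x, ∀ v ∈ Vᗮ, π x v ∈ Vᗮ) (x : R) :
    trace 𝕜 E (π x) = trace 𝕜 V (restrictRep π V hV x) +
      trace 𝕜 Vᗮ (restrictRep π Vᗮ hV' x) := by
  let e := V.prodEquivOfIsCompl Vᗮ V.isCompl_orthogonal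
  rw [← trace_prodMap', ← trace_conj' _ e]
  congr 1
  ext u
  obtain ⟨⟨a, b⟩, rfl⟩ := e.surjective u
  simp [e, LinearEquiv.conj_apply, restrictRep_apply]

end

/-- By `exists_norm_eq`, sending `π x v` to `ρ x w` is an isometry of cyclic subspaces that
intertwines the representations. The orthogonal complements are invariant, their traces agree by
subtraction, and induction on the dimension applies to them. -/
theorem exists_intertwiner_of_finrank {R : Type*} [Ring R] [Algebra 𝕜 R] (N : ℕ) :
    ∀ {E F : Type*} [NormedAddCommGroup E] [InnerProductSpace 𝕜 E] [NormedAddCommGroup F]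
      [InnerProductSpace 𝕜 F] [FiniteDimensional 𝕜 E] [FiniteDimensional 𝕜 F]
      {π : R →ₐ[𝕜] End 𝕜 E} {ρ : R →ₐ[𝕜] End 𝕜 F}, finrank 𝕜 E ≤ N → HasAdjoints π ρ →
      (∀ x, trace 𝕜 E (π x) = trace 𝕜 F (ρ x)) →
      ∃ U : E ≃ₗᵢ[𝕜] F, ∀ x v, U (π x v) = ρ x (U v) := by
  induction N with
  | zero =>
    intro E F _ _ _ _ _ _ π ρ hN h htr
    have hE := finrank_zero_iff.1 (Nat.le_zero.1 hN)
    -- The trace of the identity is the dimension.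
    have hF : finrank 𝕜 F = 0 := by
      have := htr 1
      rw [map_one π, map_one ρ, trace_one, trace_one, Nat.le_zero.1 hN] at this
      exact_mod_cast this.symm
    have hF := finrank_zero_iff.1 hF
    exact ⟨⟨0, fun v => by simp [Subsingleton.elim v 0]⟩, fun _ _ => Subsingleton.elim _ _⟩
  | succ N ih =>
    intro E F _ _ _ _ _ _ π ρ hN h htr
    rcases subsingleton_or_nontrivial E with hE | hE
    · exact ih (by rw [finrank_zero_of_subsingleton]; omega) h htr
    obtain ⟨v, w, hv0, hvw⟩ := exists_norm_eq h htr
    let Φ : R →ₗ[𝕜] E := (LinearMap.applyₗ v).comp π.toLinearMap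
    let Ψ : R →ₗ[𝕜] F := (LinearMap.applyₗ w).comp ρ.toLinearMap
    obtain ⟨U₁, hU₁⟩ := exists_linearIsometryEquiv_range Φ Ψ hvw
    have hΦ : ∀ x, ∀ u ∈ range Φ, π x u ∈ range Φ := by
      rintro x _ ⟨y, rfl⟩
      exact ⟨x * y, by simp [Φ]⟩
    have hΨ : ∀ x, ∀ u ∈ range Ψ, ρ x u ∈ range Ψ := by
      rintro x _ ⟨y, rfl⟩
      exact ⟨x * y, by simp [Ψ]⟩
    have hΦ' := h.mem_orthogonal hΦ
    have hΨ' := h.symm.mem_orthogonal hΨ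
    have hcomm : ∀ x (u : range Φ), U₁ (restrictRep π _ hΦ x u) = restrictRep ρ _ hΨ x (U₁ u) := by
      rintro x ⟨_, y, rfl⟩
      have h1 : restrictRep π _ hΦ x ⟨Φ y, mem_range_self _ _⟩ = Φ.rangeRestrict (x * y) :=
        Subtype.ext (by simp [restrictRep_apply, Φ])
      have h2 : U₁ ⟨Φ y, mem_range_self _ _⟩ = Ψ.rangeRestrict y := hU₁ y
      rw [h1, hU₁, h2]
      exact Subtype.ext (by simp [restrictRep_apply, Ψ])
    have htr₁ : ∀ x, trace 𝕜 _ (restrictRep π _ hΦ x) = trace 𝕜 _ (restrictRep ρ _ hΨ x) := by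
      intro x
      rw [← trace_conj' _ U₁.toLinearEquiv]
      congr 1
      ext u : 1
      rw [LinearEquiv.conj_apply_apply]
      exact (hcomm x _).trans (by simp)
    obtain ⟨U₂, hU₂⟩ := ih (E := (range Φ)ᗮ) (F := (range Ψ)ᗮ) (π := restrictRep π _ hΦ')
      (ρ := restrictRep ρ _ hΨ') (by
        have h1 := Submodule.finrank_add_finrank_orthogonal (range Φ)
        have h2 : 0 < finrank 𝕜 (range Φ) := by
          rw [finrank_pos_iff, Submodule.nontrivial_iff_ne_bot]
          intro h0
          have : Φ 1 ∈ range Φ := mem_range_self _ _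
          rw [h0, Submodule.mem_bot] at this
          exact hv0 (by simpa [Φ] using this)
        omega)
      (fun x => (h x).imp fun y hy => ⟨fun u u' => hy.1 u u', fun u u' => hy.2 u u'⟩)
      (fun x => by
        have := htr x
        rw [trace_eq_add_trace_restrictRep _ hΦ hΦ', trace_eq_add_trace_restrictRep _ hΨ hΨ',
          htr₁] at this
        exact add_left_cancel this)
    let U : E ≃ₗᵢ[𝕜] F := (range Φ).orthogonalDecomposition.trans
      ((LinearIsometryEquiv.withLpProdCongr 2 U₁ U₂).trans
        (range Ψ).orthogonalDecomposition.symm)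
    have hUsum : ∀ (a : range Φ) (b : (range Φ)ᗮ), U (a + b) = U₁ a + U₂ b := by
      intro a b
      have : (a + b : E) = (range Φ).orthogonalDecomposition.symm (WithLp.toLp 2 (a, b)) := by
        simp
      rw [this]
      simp only [U, LinearIsometryEquiv.trans_apply, LinearIsometryEquiv.apply_symm_apply]
      simp
    refine ⟨U, fun x u => ?_⟩
    obtain ⟨⟨a, b⟩, rfl⟩ :=
      ((range Φ).prodEquivOfIsCompl _ (range Φ).isCompl_orthogonal).surjective u
    have h1 := hUsum (restrictRep π _ hΦ x a) (restrictRep π _ hΦ' x b)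
    rw [hcomm, hU₂] at h1
    simp only [Submodule.coe_prodEquivOfIsCompl', map_add (π x)]
    rw [hUsum, map_add (ρ x)]
    exact h1

/-- Two representations by operators on inner product spaces, which are closed under adjoints
and have the same traces, are unitarily equivalent. -/
theorem exists_intertwiner {R E F : Type*} [Ring R] [Algebra 𝕜 R] [NormedAddCommGroup E]
    [InnerProductSpace 𝕜 E] [NormedAddCommGroup F] [InnerProductSpace 𝕜 F] [FiniteDimensional 𝕜 E]
    [FiniteDimensional 𝕜 F] {π : R →ₐ[𝕜] End 𝕜 E} {ρ : R →ₐ[𝕜] End 𝕜 F} (h : HasAdjoints π ρ)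
    (htr : ∀ x, trace 𝕜 E (π x) = trace 𝕜 F (ρ x)) :
    ∃ U : E ≃ₗᵢ[𝕜] F, ∀ x v, U (π x v) = ρ x (U v) :=
  exists_intertwiner_of_finrank _ le_rfl h htr

end Specht

end CrossGramian

namespace CrossGramian

open Matrix

/-! ### Unitary equivalence of tuples of subspaces -/

section Orbits

variable {𝕜 : Type*} [RCLike 𝕜]

theorem exists_mem_unitaryGroup_of_linearIsometryEquiv {κ : Type*} [Fintype κ] [DecidableEq κ]
    (e : EuclideanSpace 𝕜 κ ≃ₗᵢ[𝕜] EuclideanSpace 𝕜 κ) :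
    ∃ g ∈ unitaryGroup κ 𝕜, ∀ v, e (WithLp.toLp 2 v) = WithLp.toLp 2 (g *ᵥ v) := by
  let u := Unitary.linearIsometryEquiv.symm e
  let T := (toEuclideanCLM (n := κ) (𝕜 := 𝕜)).symm
  refine ⟨T (u : EuclideanSpace 𝕜 κ →L[𝕜] EuclideanSpace 𝕜 κ), ?_, fun v => ?_⟩
  · exact Unitary.map_mem T u.2
  · have : toEuclideanCLM (n := κ) (𝕜 := 𝕜)
        (T (u : EuclideanSpace 𝕜 κ →L[𝕜] EuclideanSpace 𝕜 κ)) = u :=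
      StarAlgEquiv.apply_symm_apply _ _
    rw [← toEuclideanCLM_toLp, this]
    rfl

theorem norm_toEuclideanLin_eq {m κ : Type*} [Fintype m] [Fintype κ] [DecidableEq m]
    [DecidableEq κ] {X Y : Matrix m κ 𝕜} (h : Xᴴ * X = Yᴴ * Y) (v : EuclideanSpace 𝕜 κ) :
    ‖toEuclideanLin X v‖ = ‖toEuclideanLin Y v‖ := by
  have key : ∀ Z : Matrix m κ 𝕜, inner 𝕜 (toEuclideanLin Z v) (toEuclideanLin Z v) =
      inner 𝕜 v (toEuclideanLin (Zᴴ * Z) v) := by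
    intro Z
    rw [← LinearMap.adjoint_inner_right, ← toEuclideanLin_conjTranspose_eq_adjoint]
    congr 1
    simp [toEuclideanLin, toLpLin_apply, mulVec_mulVec]
  rw [norm_eq_sqrt_re_inner (𝕜 := 𝕜), norm_eq_sqrt_re_inner (𝕜 := 𝕜), key, key, h]

/-- Equal Gramians make `X v ↦ Y v` an isometry between the column spaces, and it extends to the
whole space. -/
theorem exists_mul_eq_of_conjTranspose_mul_self_eq {m κ : Type*} [Fintype m] [Fintype κ]
    [DecidableEq m] [DecidableEq κ] {X Y : Matrix m κ 𝕜} (h : Xᴴ * X = Yᴴ * Y) :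
    ∃ g ∈ unitaryGroup m 𝕜, g * X = Y := by
  obtain ⟨U, hU⟩ := exists_linearIsometryEquiv_range (toEuclideanLin X) (toEuclideanLin Y)
    (norm_toEuclideanLin_eq h)
  let S := (LinearMap.range (toEuclideanLin Y)).subtypeₗᵢ.comp U.toLinearIsometry
  obtain ⟨g, hg, hgv⟩ := exists_mem_unitaryGroup_of_linearIsometryEquiv
    (S.extend.toLinearIsometryEquiv rfl)
  refine ⟨g, hg, ?_⟩
  refine ext_of_mulVec_single fun j => ?_
  have h1 := hgv (X *ᵥ Pi.single j 1)
  have h2 := S.extend_apply ((toEuclideanLin X).rangeRestrict (WithLp.toLp 2 (Pi.single j 1)))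
  have h3 : S ((toEuclideanLin X).rangeRestrict (WithLp.toLp 2 (Pi.single j 1))) =
      toEuclideanLin Y (WithLp.toLp 2 (Pi.single j 1)) :=
    congrArg Subtype.val (hU _)
  rw [h3] at h2
  have h4 : WithLp.toLp 2 (g *ᵥ (X *ᵥ Pi.single j 1)) =
      toEuclideanLin Y (WithLp.toLp 2 (Pi.single j 1)) := h1.symm.trans h2
  rw [← mulVec_mulVec]
  exact congrArg WithLp.ofLp h4

variable {r n d : ℕ} {A B : Fin n → Matrix (Fin d) (Fin r) 𝕜} {V W : Fin n → Gr 𝕜 r d}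

theorem gramian_apply (p q : Fin n × Fin r) :
    gramian A p q = ((A p.1)ᴴ * A q.1) p.2 q.2 := rfl

theorem IsOrthobasis.isCross (hA : IsOrthobasis A V) : IsCross (gramian A) := by
  refine ⟨isHermitian_conjTranspose_mul_self _, fun i => ?_⟩
  ext p q
  rw [crossBlock, blockProj, mul_diagonal, diagonal_mul, gramian_apply, diagonal_apply]
  by_cases hp : p.1 = i
  · by_cases hq : q.1 = i
    · rw [hp, hq, (hA i).1, one_apply]
      simp [hp, hq, Prod.ext_iff]
    · have : p ≠ q := fun h => hq (h ▸ hp)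
      simp [hq, this]
  · simp [hp]

/-- The block diagonal matrix with blocks `Q i`. -/
def blockDiag (Q : Fin n → Matrix (Fin r) (Fin r) 𝕜) :
    Matrix (Fin n × Fin r) (Fin n × Fin r) 𝕜 :=
  of fun p q => if p.1 = q.1 then Q q.1 p.2 q.2 else 0

theorem concat_mul_blockDiag (Q : Fin n → Matrix (Fin r) (Fin r) 𝕜) :
    concat B * blockDiag Q = concat fun i => B i * Q i := by
  ext k q
  rw [Matrix.mul_apply, Fintype.sum_prod_type, Finset.sum_eq_single q.1]
  · simp [concat, blockDiag, Matrix.mul_apply]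
  · intro i _ hi
    simp [blockDiag, hi]
  · simp

theorem blockDiag_conjTranspose_mul (Q : Fin n → Matrix (Fin r) (Fin r) 𝕜) :
    (blockDiag Q)ᴴ * blockDiag Q = blockDiag fun i => (Q i)ᴴ * Q i := by
  ext p q
  rw [Matrix.mul_apply, Fintype.sum_prod_type, Finset.sum_eq_single q.1]
  · by_cases h : p.1 = q.1
    · simp [blockDiag, Matrix.mul_apply, h]
    · simp [blockDiag, h, Ne.symm h]
  · intro i _ hi
    simp [blockDiag, hi]
  · simp

theorem blockDiag_one : blockDiag (fun _ => 1 : Fin n → Matrix (Fin r) (Fin r) 𝕜) = 1 := by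
  ext p q
  by_cases h : p.1 = q.1 <;> simp [blockDiag, one_apply, h, Prod.ext_iff]

theorem isBlockDiagonal_blockDiag (Q : Fin n → Matrix (Fin r) (Fin r) 𝕜) :
    IsBlockDiagonal (blockDiag Q) := fun p q h => by simp [blockDiag, h]

theorem IsBlockDiagonal.eq_blockDiag {U : Matrix (Fin n × Fin r) (Fin n × Fin r) 𝕜}
    (hU : IsBlockDiagonal U) : U = blockDiag fun i => of fun a b => U (i, a) (i, b) := by
  ext p q
  by_cases h : p.1 = q.1
  · obtain ⟨i, a⟩ := p
    obtain ⟨j, b⟩ := q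
    obtain rfl : i = j := h
    simp [blockDiag]
  · simp [blockDiag, h, hU p q h]

theorem isBlockDiagonal_iff {U : Matrix (Fin n × Fin r) (Fin n × Fin r) 𝕜} :
    IsBlockDiagonal U ↔ ∀ i, U * blockProj 𝕜 i = blockProj 𝕜 i * U := by
  refine ⟨fun h i => ?_, fun h p q hpq => ?_⟩
  · ext p q
    rw [blockProj, mul_diagonal, diagonal_mul]
    by_cases hpq : p.1 = q.1
    · rw [hpq, mul_comm]
    · rw [h p q hpq, zero_mul, mul_zero]
  · have := congrFun (congrFun (h p.1) p) q
    rw [blockProj, mul_diagonal, diagonal_mul] at this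
    simpa [Ne.symm hpq] using this.symm

theorem sum_crossBlock (G : Matrix (Fin n × Fin r) (Fin n × Fin r) 𝕜) :
    ∑ i, ∑ j, crossBlock G i j = G := by
  simp only [crossBlock, ← Finset.mul_sum, ← Finset.sum_mul, sum_blockProj, Matrix.one_mul,
    Matrix.mul_one]

/-- The case `i = j` says that `U` commutes with `Π_i`, since the diagonal cross blocks of both
Gramians are `Π_i`; summing over all `i` and `j` gives the whole Gramians. -/
theorem conj_crossBlock_iff {G G' U : Matrix (Fin n × Fin r) (Fin n × Fin r) 𝕜} (hG : IsCross G)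
    (hG' : IsCross G') (hU : U ∈ unitaryGroup (Fin n × Fin r) 𝕜) :
    (∀ i j, U * crossBlock G i j * Uᴴ = crossBlock G' i j) ↔
      IsBlockDiagonal U ∧ U * G * Uᴴ = G' := by
  have h1 : Uᴴ * U = 1 := mem_unitaryGroup_iff'.1 hU
  have h2 : U * Uᴴ = 1 := mem_unitaryGroup_iff.1 hU
  refine ⟨fun h => ⟨isBlockDiagonal_iff.2 fun i => ?_, ?_⟩, fun h i j => ?_⟩
  · have := h i i
    rw [hG.diag, hG'.diag] at this
    nth_rw 2 [← this]
    rw [Matrix.mul_assoc, h1, Matrix.mul_one]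
  · rw [← sum_crossBlock G, ← sum_crossBlock G']
    simp only [Finset.mul_sum, Finset.sum_mul, h]
  · have hc := isBlockDiagonal_iff.1 h.1
    have hc' : blockProj 𝕜 j * Uᴴ = Uᴴ * blockProj 𝕜 j := by
      have := congrArg conjTranspose (hc j)
      rwa [conjTranspose_mul, conjTranspose_mul, blockProj_isHermitian] at this
    rw [crossBlock, crossBlock, ← h.2]
    simp only [Matrix.mul_assoc, hc']
    simp only [← Matrix.mul_assoc, hc]

theorem IsOrthobasis.smul (hA : IsOrthobasis A V) (g : UGroup 𝕜 d) :
    IsOrthobasis (fun i => (g : Matrix (Fin d) (Fin d) 𝕜) * A i) (g • V) := by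
  have hg : (g : Matrix (Fin d) (Fin d) 𝕜)ᴴ * g = 1 := mem_unitaryGroup_iff'.1 g.2
  refine fun i => ⟨?_, ?_⟩
  · rw [conjTranspose_mul, Matrix.mul_assoc, ← Matrix.mul_assoc _ _ (A i), hg, Matrix.one_mul,
      (hA i).1]
  · change (V i).carrier.map _ = _
    rw [(hA i).2, mulVecLin_mul, LinearMap.range_comp]

theorem gramian_unitary_mul (g : UGroup 𝕜 d) :
    gramian (fun i => (g : Matrix (Fin d) (Fin d) 𝕜) * A i) = gramian A := by
  have hg : (g : Matrix (Fin d) (Fin d) 𝕜)ᴴ * g = 1 := mem_unitaryGroup_iff'.1 g.2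
  ext p q
  rw [gramian_apply, gramian_apply, conjTranspose_mul, Matrix.mul_assoc,
    ← Matrix.mul_assoc _ _ (A q.1), hg, Matrix.one_mul]

/-- `X Xᴴ` is the orthogonal projection onto the range of `X`. -/
theorem mul_conjTranspose_mul_of_range_le {m κ κ' : Type*} [Fintype m] [Fintype κ] [Fintype κ']
    [DecidableEq κ] [DecidableEq κ'] {X : Matrix m κ 𝕜} {Y : Matrix m κ' 𝕜} (hX : Xᴴ * X = 1)
    (h : LinearMap.range Y.mulVecLin ≤ LinearMap.range X.mulVecLin) : X * (Xᴴ * Y) = Y := by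
  refine ext_of_mulVec_single fun j => ?_
  obtain ⟨v, hv⟩ := h ⟨Pi.single j 1, rfl⟩
  rw [mulVecLin_apply, mulVecLin_apply] at hv
  rw [← mulVec_mulVec, ← mulVec_mulVec, ← hv, mulVec_mulVec _ Xᴴ, hX, one_mulVec]

/-- Two orthobases of the same tuple differ by a block diagonal unitary matrix. -/
theorem IsOrthobasis.exists_unitary (hA : IsOrthobasis A V) (hB : IsOrthobasis B V) :
    ∃ U ∈ unitaryGroup (Fin n × Fin r) 𝕜, ∀ i j,
      U * crossBlock (gramian A) i j * Uᴴ = crossBlock (gramian B) i j := by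
  have hBA : ∀ i, B i * ((B i)ᴴ * A i) = A i := fun i =>
    mul_conjTranspose_mul_of_range_le (hB i).1 ((hA i).2.symm.trans (hB i).2).le
  have hQ : ∀ i, ((B i)ᴴ * A i)ᴴ * ((B i)ᴴ * A i) = 1 := fun i => by
    rw [conjTranspose_mul, conjTranspose_conjTranspose, Matrix.mul_assoc, hBA, (hA i).1]
  set U := blockDiag fun i => (B i)ᴴ * A i with hUdef
  have hU1 : Uᴴ * U = 1 := by
    rw [hUdef, blockDiag_conjTranspose_mul, ← blockDiag_one]
    simp only [hQ]
  have hU : U ∈ unitaryGroup (Fin n × Fin r) 𝕜 := mem_unitaryGroup_iff'.2 hU1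
  have hU2 : U * Uᴴ = 1 := mem_unitaryGroup_iff.1 hU
  refine ⟨U, hU, (conj_crossBlock_iff hA.isCross hB.isCross hU).2
    ⟨isBlockDiagonal_blockDiag _, ?_⟩⟩
  have hc : concat A = concat B * U := by
    rw [hUdef, concat_mul_blockDiag]
    simp only [hBA]
  rw [gramian, hc, conjTranspose_mul]
  simp only [Matrix.mul_assoc, hU2, Matrix.mul_one]
  simp only [← Matrix.mul_assoc, hU2, Matrix.one_mul]
  rfl

/-- In one direction, `g A_i` is an orthobasis of `g V` with the Gramian of `A`, and two orthobases
of one tuple differ by a block diagonal unitary. In the other, `A` and `B U` have equal Gramians, so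
`g A_i = B_i Q_i` for some unitary `g` and the diagonal blocks `Q_i` of `U`; thus `g V_i ≤ W_i`,
with equality by dimension. -/
theorem exists_smul_eq_iff (hA : IsOrthobasis A V) (hB : IsOrthobasis B W) :
    (∃ g : UGroup 𝕜 d, g • V = W) ↔ ∃ U ∈ unitaryGroup (Fin n × Fin r) 𝕜, ∀ i j,
      U * crossBlock (gramian A) i j * Uᴴ = crossBlock (gramian B) i j := by
  constructor
  · rintro ⟨g, rfl⟩
    have := (hA.smul g).exists_unitary hB
    rwa [gramian_unitary_mul] at this
  · rintro ⟨U, hU, h⟩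
    obtain ⟨hbd, hUG⟩ := (conj_crossBlock_iff hA.isCross hB.isCross hU).1 h
    have h1 : Uᴴ * U = 1 := mem_unitaryGroup_iff'.1 hU
    have hgram : (concat A)ᴴ * concat A = (concat B * U)ᴴ * (concat B * U) := by
      have : (concat B * U)ᴴ * (concat B * U) = Uᴴ * gramian B * U := by
        rw [conjTranspose_mul, gramian]
        simp only [Matrix.mul_assoc]
      rw [this, ← hUG]
      simp only [Matrix.mul_assoc, h1, Matrix.mul_one]
      rw [← Matrix.mul_assoc, h1, Matrix.one_mul]
      rfl
    obtain ⟨g, hg, hgA⟩ := exists_mul_eq_of_conjTranspose_mul_self_eq hgram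
    set Q : Fin n → Matrix (Fin r) (Fin r) 𝕜 := fun i => of fun a b => U (i, a) (i, b)
    have hUQ : U = blockDiag Q := hbd.eq_blockDiag
    have hblock : ∀ i, g * A i = B i * Q i := by
      intro i
      ext k a
      have := congrFun (congrFun hgA k) (i, a)
      rw [hUQ, concat_mul_blockDiag] at this
      exact this
    refine ⟨⟨g, hg⟩, funext fun i => Gr.ext ?_⟩
    have hS := hA.smul ⟨g, hg⟩ i
    have hle : (((⟨g, hg⟩ : UGroup 𝕜 d) • V) i).carrier ≤ (W i).carrier := by
      rw [hS.2, (hB i).2]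
      simp only [hblock]
      rw [mulVecLin_mul]
      exact LinearMap.range_comp_le_range _ _
    exact Submodule.eq_of_le_of_finrank_eq hle (by rw [Gr.finrank_eq, Gr.finrank_eq])

/-- Every tuple of subspaces has an orthobasis. -/
theorem exists_isOrthobasis (V : Fin n → Gr 𝕜 r d) : ∃ A, IsOrthobasis A V := by
  suffices ∀ S : Gr 𝕜 r d, ∃ X : Matrix (Fin d) (Fin r) 𝕜, Xᴴ * X = 1 ∧
      S.carrier = LinearMap.range X.mulVecLin by
    choose A hA using this
    exact ⟨fun i => A (V i), fun i => hA (V i)⟩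
  intro S
  let e := (WithLp.linearEquiv 2 𝕜 (Fin d → 𝕜)).symm
  let T : Submodule 𝕜 (EuclideanSpace 𝕜 (Fin d)) := S.carrier.map e.toLinearMap
  have hT : Module.finrank 𝕜 T = r := (LinearEquiv.finrank_map_eq e _).trans S.finrank_eq
  let b := (stdOrthonormalBasis 𝕜 T).reindex (finCongr hT)
  let X : Matrix (Fin d) (Fin r) 𝕜 := of fun k a => (b a : EuclideanSpace 𝕜 (Fin d)) k
  have hX : Xᴴ * X = 1 := by
    ext a a'
    have := orthonormal_iff_ite.1 b.orthonormal a a'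
    rw [Submodule.coe_inner, EuclideanSpace.inner_eq_star_dotProduct, dotProduct_comm] at this
    rw [one_apply, ← this]
    rfl
  refine ⟨X, hX, (Submodule.eq_of_le_of_finrank_eq ?_ ?_).symm⟩
  · rw [range_mulVecLin, Submodule.span_le]
    rintro _ ⟨a, rfl⟩
    obtain ⟨v, hv, hva⟩ := (b a).2
    have : X.col a = v := by
      have h := congrArg WithLp.ofLp hva
      exact h.symm
    rw [this]
    exact hv
  · have hinj : Function.Injective X.mulVecLin := by
      intro u v huv
      have := congrArg (Xᴴ *ᵥ ·) huv
      simpa [mulVec_mulVec, hX] using this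
    rw [LinearMap.finrank_range_of_inj hinj, S.finrank_eq]
    simp

end Orbits

end CrossGramian

namespace CrossGramian

open Matrix
open scoped ComplexOrder

/-! ### The output is a complete invariant -/

section Invariant

variable {𝕜 : Type*} [RCLike 𝕜] {r n : ℕ} {G G' : Matrix (Fin n × Fin r) (Fin n × Fin r) 𝕜}

theorem evalWord_conj {U : Matrix (Fin n × Fin r) (Fin n × Fin r) 𝕜}
    (hU : U ∈ unitaryGroup (Fin n × Fin r) 𝕜)
    (h : ∀ i j, U * crossBlock G i j * Uᴴ = crossBlock G' i j) (w : Word n) :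
    U * evalWord G w * Uᴴ = evalWord G' w := by
  have h1 : Uᴴ * U = 1 := mem_unitaryGroup_iff'.1 hU
  have h2 : U * Uᴴ = 1 := mem_unitaryGroup_iff.1 hU
  induction w with
  | nil => simp [evalWord, h2]
  | cons x w ih =>
    rw [evalWord_cons, evalWord_cons, ← ih, ← h]
    simp only [← Matrix.mul_assoc]
    rw [Matrix.mul_assoc _ Uᴴ U, h1, Matrix.mul_one]

theorem trace_evalWord_conj {U : Matrix (Fin n × Fin r) (Fin n × Fin r) 𝕜}
    (hU : U ∈ unitaryGroup (Fin n × Fin r) 𝕜)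
    (h : ∀ i j, U * crossBlock G i j * Uᴴ = crossBlock G' i j) (w : Word n) :
    (evalWord G w).trace = (evalWord G' w).trace := by
  have h1 : Uᴴ * U = 1 := mem_unitaryGroup_iff'.1 hU
  rw [← evalWord_conj hU h, trace_mul_comm, ← Matrix.mul_assoc, h1, Matrix.one_mul]

theorem evalWord_mem_pathSpan_of_conj {U : Matrix (Fin n × Fin r) (Fin n × Fin r) 𝕜}
    (hU : U ∈ unitaryGroup (Fin n × Fin r) 𝕜)
    (h : ∀ i j, U * crossBlock G i j * Uᴴ = crossBlock G' i j) {L : List (List (Fin n))}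
    {w : Word n} (hw : evalWord G w ∈ pathSpan G L) : evalWord G' w ∈ pathSpan G' L := by
  let c : Matrix (Fin n × Fin r) (Fin n × Fin r) 𝕜 →ₗ[𝕜] Matrix (Fin n × Fin r) (Fin n × Fin r) 𝕜 :=
    (LinearMap.mulRight 𝕜 Uᴴ).comp (LinearMap.mulLeft 𝕜 U)
  have hc : ∀ v, c (evalWord G v) = evalWord G' v := evalWord_conj hU h
  have : pathSpan G L ≤ (pathSpan G' L).comap c := by
    refine Submodule.span_le.2 ?_
    rintro _ ⟨p, hp, rfl⟩
    change c _ ∈ pathSpan G' L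
    rw [hc]
    exact mem_pathSpan hp
  rw [← hc]
  exact this hw

theorem conj_symm {U : Matrix (Fin n × Fin r) (Fin n × Fin r) 𝕜}
    (hU : U ∈ unitaryGroup (Fin n × Fin r) 𝕜)
    (h : ∀ i j, U * crossBlock G i j * Uᴴ = crossBlock G' i j) (i j : Fin n) :
    Uᴴ * crossBlock G' i j * Uᴴᴴ = crossBlock G i j := by
  have h1 : Uᴴ * U = 1 := mem_unitaryGroup_iff'.1 hU
  rw [← h, conjTranspose_conjTranspose]
  simp only [← Matrix.mul_assoc, h1, Matrix.one_mul]
  rw [Matrix.mul_assoc, h1, Matrix.mul_one]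

/-- Conjugation carries words to words and preserves spans and traces, so every independence test of
the search has the same outcome. In particular the report does not depend on the orthobasis. -/
theorem fullReport_eq_of_conj {U : Matrix (Fin n × Fin r) (Fin n × Fin r) 𝕜}
    (hU : U ∈ unitaryGroup (Fin n × Fin r) 𝕜)
    (h : ∀ i j, U * crossBlock G i j * Uᴴ = crossBlock G' i j) :
    fullReport G = fullReport G' := by
  have hU' : Uᴴ ∈ unitaryGroup (Fin n × Fin r) 𝕜 := Unitary.star_mem hU
  have h1 : extend G = extend G' := by
    ext1 L
    ext1 p
    have : evalWord G (pathWord p) ∈ pathSpan G L ↔ evalWord G' (pathWord p) ∈ pathSpan G' L :=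
      ⟨evalWord_mem_pathSpan_of_conj hU h, evalWord_mem_pathSpan_of_conj hU' (conj_symm hU h)⟩
    rw [extend, extend]
    by_cases hp : evalWord G (pathWord p) ∈ pathSpan G L
    · rw [if_pos hp, if_pos (this.1 hp)]
    · rw [if_neg hp, if_neg fun hp' => hp (this.2 hp')]
  have h2 : expand G = expand G' := by
    ext1 e
    ext1 L
    ext1 k
    rw [expand, expand, h1]
  have h3 : ∀ i E, searchPaths G i E = searchPaths G' i E := by
    intro i E
    induction E with
    | zero => rfl
    | succ E ih => rw [searchPaths, searchPaths, h2, ih]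
  have h4 : entry G = entry G' := by
    ext1 w
    rw [entry, entry, trace_evalWord_conj hU h]
  have h5 : pathReport G = pathReport G' := by
    ext1 L
    ext1 t
    rw [pathReport, pathReport, h4]
  simp only [fullReport, h3, h5]

theorem mem_fullReport {e : Word n × 𝕜} : e ∈ fullReport G ↔ ∃ i,
    ∃ t ∈ searchPaths G i (n * r * r), e = entry G (pathWord t) ∨
      ∃ s ∈ searchPaths G i (n * r * r), e = entry G (pairWord s t) := by
  simp [fullReport, pathReport, eq_comm]

theorem eq_entry_of_mem_fullReport {e : Word n × 𝕜} (he : e ∈ fullReport G) :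
    e = entry G e.1 := by
  obtain ⟨i, t, -, rfl | ⟨s, -, rfl⟩⟩ := mem_fullReport.1 he <;> rfl

theorem crossBlock_mul_evalWord_pathWord (k j : Fin n) {p : List (Fin n)} (hp : 2 ≤ p.length) :
    crossBlock G k j * evalWord G (pathWord p) =
      if p.head? = some j then evalWord G (pathWord (k :: p)) else 0 := by
  match p, hp with
  | a :: b :: l, _ =>
    have h1 := blockProj_mul_evalWord_pathWord (𝕜 := 𝕜) (G := G) (a := a) (l := b :: l) (by simp)
    rw [List.head?_cons, crossBlock, Matrix.mul_assoc]
    split_ifs with h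
    · obtain rfl := Option.some.inj h
      rw [h1]
      exact (evalWord_pathWord_cons k (by simp)).symm
    · rw [← h1, ← Matrix.mul_assoc (blockProj 𝕜 j),
        blockProj_mul_of_ne fun h' => h (congrArg some h'.symm), Matrix.zero_mul, Matrix.mul_zero]

/-- Paths with different first vertices have orthogonal ranges. If both start at `a`, then `G` can
be inserted because `Π_a = Π_a G Π_a`. So the trace of every such product is zero or a reported
number. -/
theorem conjTranspose_mul_evalWord_pathWord (hG : IsCross G) {s t : List (Fin n)}
    (hs : 2 ≤ s.length) (ht : 2 ≤ t.length) :
    (evalWord G (pathWord s))ᴴ * evalWord G (pathWord t) =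
      if s.head? = t.head? then evalWord G (pairWord s t) else 0 := by
  match s, t, hs, ht with
  | a :: a' :: s, b :: b' :: t, hs, ht =>
    have h1 := blockProj_mul_evalWord_pathWord (𝕜 := 𝕜) (G := G) (a := a) (l := a' :: s) (by simp)
    have h2 := blockProj_mul_evalWord_pathWord (𝕜 := 𝕜) (G := G) (a := b) (l := b' :: t) (by simp)
    rw [List.head?_cons, List.head?_cons, evalWord_pairWord hG hs ht]
    generalize evalWord G (pathWord (a :: a' :: s)) = X at h1
    generalize evalWord G (pathWord (b :: b' :: t)) = Y at h2
    rw [← h1, ← h2, conjTranspose_mul, blockProj_isHermitian]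
    split_ifs with h
    · obtain rfl := Option.some.inj h
      have h3 : (blockProj 𝕜 a * blockProj 𝕜 a : Matrix (Fin n × Fin r) _ 𝕜) =
          blockProj 𝕜 a * G * blockProj 𝕜 a := by
        rw [blockProj_mul_self]
        exact (hG.diag a).symm
      rw [Matrix.mul_assoc, ← Matrix.mul_assoc (blockProj 𝕜 a), h3]
      simp only [Matrix.mul_assoc]
    · rw [Matrix.mul_assoc, ← Matrix.mul_assoc (blockProj 𝕜 a),
        blockProj_mul_of_ne fun h' => h (congrArg some h'), Matrix.zero_mul, Matrix.mul_zero]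

/-- The action of a letter needs no further traces: the product is zero or the word of `s` and `k ::
t`, in which the middle letter `x_{kk} = Π_k` can be dropped. -/
theorem conjTranspose_mul_crossBlock_mul (hG : IsCross G) (k j : Fin n) {s t : List (Fin n)}
    (hs : 2 ≤ s.length) (ht : 2 ≤ t.length) :
    (evalWord G (pathWord s))ᴴ * (crossBlock G k j * evalWord G (pathWord t)) =
      if t.head? = some j ∧ s.head? = some k then evalWord G (pairWord s t) else 0 := by
  have ht' : 2 ≤ (k :: t).length := by
    rw [List.length_cons]
    omega
  rw [crossBlock_mul_evalWord_pathWord k j ht]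
  by_cases hj : t.head? = some j
  · rw [if_pos hj, conjTranspose_mul_evalWord_pathWord hG hs ht', List.head?_cons]
    by_cases hk : s.head? = some k
    · rw [if_pos hk, if_pos ⟨hj, hk⟩]
      match s, hs with
      | a :: a' :: s, hs =>
        obtain rfl := Option.some.inj hk
        rw [evalWord_pairWord hG hs ht, evalWord_pairWord hG hs ht',
          evalWord_pathWord_cons _ ht]
        have h1 := congrArg conjTranspose
          (blockProj_mul_evalWord_pathWord (𝕜 := 𝕜) (G := G) (a := a) (l := a' :: s) (by simp))
        rw [conjTranspose_mul, blockProj_isHermitian] at h1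
        have h3 := hG.diag a
        rw [crossBlock] at h3
        rw [← h1]
        simp only [← Matrix.mul_assoc]
        congr 2
        rw [Matrix.mul_assoc _ G, Matrix.mul_assoc _ (blockProj 𝕜 a), ← Matrix.mul_assoc _ G, h3]
    · rw [if_neg hk, if_neg fun h => hk h.2]
  · rw [if_neg hj, if_neg fun h => hj h.1, Matrix.mul_zero]

theorem crossBlock_mul_mem_pathSpan (hG : IsCross G) (hr : 1 ≤ r) (i k j : Fin n)
    {X : Matrix (Fin n × Fin r) (Fin n × Fin r) 𝕜}
    (hX : X ∈ pathSpan G (searchPaths G i (n * r * r))) :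
    crossBlock G k j * X ∈ pathSpan G (searchPaths G i (n * r * r)) := by
  obtain ⟨hL, hcl⟩ := searchPaths_spec hG hr i (n * r * r)
  induction hX using Submodule.span_induction with
  | mem x hx =>
    obtain ⟨p, hp, rfl⟩ := hx
    rw [crossBlock_mul_evalWord_pathWord k j (hL.two_le p hp)]
    split_ifs
    · obtain ⟨e, he, rfl⟩ := List.mem_iff_getElem.1 hp
      -- There are at most `n r r` paths, so all of them have been treated by the search.
      exact hcl e (he.trans_le hL.length_le_card) _ (List.getElem?_eq_getElem he) k
    · exact Submodule.zero_mem _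
  | zero => simp
  | add x y _ _ hx hy =>
    rw [Matrix.mul_add]
    exact Submodule.add_mem _ hx hy
  | smul c x _ hx =>
    rw [Matrix.mul_smul]
    exact Submodule.smul_mem _ _ hx

theorem evalWord_pathWord_root (hG : IsCross G) (i : Fin n) :
    evalWord G (pathWord [i, i]) = blockProj 𝕜 i := by
  simp [pathWord, evalWord, hG.diag]

theorem evalWord_mul_blockProj_mem_pathSpan (hG : IsCross G) (hr : 1 ≤ r) (i : Fin n)
    (w : Word n) :
    evalWord G w * blockProj 𝕜 i ∈ pathSpan G (searchPaths G i (n * r * r)) := by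
  induction w with
  | nil =>
    rw [evalWord, List.map_nil, List.prod_nil, Matrix.one_mul, ← evalWord_pathWord_root hG]
    exact mem_pathSpan (searchPaths_spec hG hr i _).1.root
  | cons x w ih =>
    rw [evalWord_cons, Matrix.mul_assoc]
    exact crossBlock_mul_mem_pathSpan hG hr i _ _ ih

theorem pathSpan_le_pathSpan_searchPaths (hG : IsCross G) (hr : 1 ≤ r) {i : Fin n}
    {L : List (List (Fin n))} (h2 : ∀ p ∈ L, 2 ≤ p.length) (hi : ∀ p ∈ L, p.getLast? = some i) :
    pathSpan G L ≤ pathSpan G (searchPaths G i (n * r * r)) := by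
  refine Submodule.span_le.2 ?_
  rintro _ ⟨p, hp, rfl⟩
  rw [SetLike.mem_coe, ← evalWord_pathWord_mul_blockProj (h2 p hp) (hi p hp)]
  exact evalWord_mul_blockProj_mem_pathSpan hG hr i _

theorem sum_evalWord_mul_blockProj (w : Word n) :
    ∑ i, evalWord G w * blockProj 𝕜 i = evalWord G w := by
  rw [← Finset.mul_sum, sum_blockProj, Matrix.mul_one]

theorem evalWord_mem_crossAlgebra (w : Word n) : evalWord G w ∈ crossAlgebra G := by
  refine Subalgebra.list_prod_mem _ fun x hx => ?_
  obtain ⟨y, -, rfl⟩ := List.mem_map.1 hx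
  exact Algebra.subset_adjoin ⟨y.1, y.2, rfl⟩

/-- The algebra is spanned by all words. Since the `Π_i` sum to `1`, a word is the sum of its
products with the `Π_i`, each in the span of the recorded paths ending at `i`. -/
theorem crossAlgebra_eq_span (hG : IsCross G) (hr : 1 ≤ r) :
    Subalgebra.toSubmodule (crossAlgebra G) =
      Submodule.span 𝕜 {M | ∃ e ∈ fullReport G, M = evalWord G e.1} := by
  apply le_antisymm
  · rw [crossAlgebra, Algebra.adjoin_eq_span, Submodule.span_le]
    intro X hX
    obtain ⟨w, rfl⟩ : ∃ w, X = evalWord G w := by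
      induction hX using Submonoid.closure_induction with
      | mem x hx =>
        obtain ⟨i, j, rfl⟩ := hx
        exact ⟨[(i, j)], by simp [evalWord]⟩
      | one => exact ⟨[], rfl⟩
      | mul x y _ _ hx hy =>
        obtain ⟨v, rfl⟩ := hx
        obtain ⟨w, rfl⟩ := hy
        exact ⟨v ++ w, (evalWord_append v w).symm⟩
    rw [SetLike.mem_coe, ← sum_evalWord_mul_blockProj]
    refine Submodule.sum_mem _ fun i _ => ?_
    refine Submodule.span_mono ?_ (evalWord_mul_blockProj_mem_pathSpan hG hr i w)
    rintro _ ⟨p, hp, rfl⟩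
    exact ⟨entry G (pathWord p), mem_fullReport.2 ⟨i, p, hp, .inl rfl⟩, rfl⟩
  · refine Submodule.span_le.2 ?_
    rintro _ ⟨e, -, rfl⟩
    exact evalWord_mem_crossAlgebra e.1

/-- The span of the pairs of evaluations of the words of a list of paths. -/
def pairSpan (G G' : Matrix (Fin n × Fin r) (Fin n × Fin r) 𝕜) (L : List (List (Fin n))) :
    Submodule 𝕜 (Matrix (Fin n × Fin r) (Fin n × Fin r) 𝕜 ×
      Matrix (Fin n × Fin r) (Fin n × Fin r) 𝕜) :=
  Submodule.span 𝕜 {x | ∃ p ∈ L, x = (evalWord G (pathWord p), evalWord G' (pathWord p))}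

theorem map_fst_pairSpan (L : List (List (Fin n))) :
    (pairSpan G G' L).map (LinearMap.fst 𝕜 _ _) = pathSpan G L := by
  rw [pairSpan, Submodule.map_span, pathSpan]
  congr 1
  ext X
  constructor
  · rintro ⟨_, ⟨p, hp, rfl⟩, rfl⟩
    exact ⟨p, hp, rfl⟩
  · rintro ⟨p, hp, rfl⟩
    exact ⟨_, ⟨p, hp, rfl⟩, rfl⟩

theorem map_snd_pairSpan (L : List (List (Fin n))) :
    (pairSpan G G' L).map (LinearMap.snd 𝕜 _ _) = pathSpan G' L := by
  rw [pairSpan, Submodule.map_span, pathSpan]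
  congr 1
  ext X
  constructor
  · rintro ⟨_, ⟨p, hp, rfl⟩, rfl⟩
    exact ⟨p, hp, rfl⟩
  · rintro ⟨p, hp, rfl⟩
    exact ⟨_, ⟨p, hp, rfl⟩, rfl⟩

theorem trace_conjTranspose_mul_eq_of_mem_pairSpan {L : List (List (Fin n))}
    (f f' : Matrix (Fin n × Fin r) (Fin n × Fin r) 𝕜 →ₗ[𝕜]
      Matrix (Fin n × Fin r) (Fin n × Fin r) 𝕜)
    (h : ∀ s ∈ L, ∀ t ∈ L, ((evalWord G (pathWord s))ᴴ * f (evalWord G (pathWord t))).trace =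
      ((evalWord G' (pathWord s))ᴴ * f' (evalWord G' (pathWord t))).trace)
    {x y : Matrix (Fin n × Fin r) (Fin n × Fin r) 𝕜 × Matrix (Fin n × Fin r) (Fin n × Fin r) 𝕜}
    (hx : x ∈ pairSpan G G' L) (hy : y ∈ pairSpan G G' L) :
    (x.1ᴴ * f y.1).trace = (x.2ᴴ * f' y.2).trace := by
  induction hx, hy using Submodule.span_induction₂ with
  | mem_mem x y hx hy =>
    obtain ⟨s, hs, rfl⟩ := hx
    obtain ⟨t, ht, rfl⟩ := hy
    exact h s hs t ht
  | zero_left y _ => simp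
  | zero_right x _ => simp
  | add_left x y z _ _ _ h1 h2 => simp [Matrix.add_mul, h1, h2]
  | add_right x y z _ _ _ h1 h2 => simp [Matrix.mul_add, h1, h2]
  | smul_left c x y _ _ h => simp [h]
  | smul_right c x y _ _ h => simp [h]

/-- The traces that determine the linear relations among the words of a list of paths. -/
def SameTraces (G G' : Matrix (Fin n × Fin r) (Fin n × Fin r) 𝕜) (L : List (List (Fin n))) :
    Prop :=
  ∀ s ∈ L, ∀ t ∈ L, (evalWord G (pairWord s t)).trace = (evalWord G' (pairWord s t)).trace

theorem SameTraces.trace_eq (hG : IsCross G) (hG' : IsCross G') {L : List (List (Fin n))}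
    (h : SameTraces G G' L) (h2 : ∀ p ∈ L, 2 ≤ p.length)
    {x y : Matrix (Fin n × Fin r) (Fin n × Fin r) 𝕜 × Matrix (Fin n × Fin r) (Fin n × Fin r) 𝕜}
    (hx : x ∈ pairSpan G G' L) (hy : y ∈ pairSpan G G' L) :
    (x.1ᴴ * y.1).trace = (x.2ᴴ * y.2).trace := by
  refine trace_conjTranspose_mul_eq_of_mem_pairSpan LinearMap.id LinearMap.id
    (fun s hs t ht => ?_) hx hy
  rw [LinearMap.id_apply, LinearMap.id_apply,
    conjTranspose_mul_evalWord_pathWord hG (h2 s hs) (h2 t ht),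
    conjTranspose_mul_evalWord_pathWord hG' (h2 s hs) (h2 t ht)]
  split_ifs
  · exact h s hs t ht
  · rfl

theorem SameTraces.trace_crossBlock_eq (hG : IsCross G) (hG' : IsCross G')
    {L : List (List (Fin n))} (h : SameTraces G G' L) (h2 : ∀ p ∈ L, 2 ≤ p.length) (k j : Fin n)
    {x y : Matrix (Fin n × Fin r) (Fin n × Fin r) 𝕜 × Matrix (Fin n × Fin r) (Fin n × Fin r) 𝕜}
    (hx : x ∈ pairSpan G G' L) (hy : y ∈ pairSpan G G' L) :
    (x.1ᴴ * (crossBlock G k j * y.1)).trace = (x.2ᴴ * (crossBlock G' k j * y.2)).trace := by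
  refine trace_conjTranspose_mul_eq_of_mem_pairSpan (LinearMap.mulLeft 𝕜 (crossBlock G k j))
    (LinearMap.mulLeft 𝕜 (crossBlock G' k j)) (fun s hs t ht => ?_) hx hy
  rw [LinearMap.mulLeft_apply, LinearMap.mulLeft_apply,
    conjTranspose_mul_crossBlock_mul hG k j (h2 s hs) (h2 t ht),
    conjTranspose_mul_crossBlock_mul hG' k j (h2 s hs) (h2 t ht)]
  split_ifs
  · exact h s hs t ht
  · rfl

/-- `pairSpan` is the graph of an isometry: the trace form is definite, so one component of a pair
vanishes exactly when the other does, and both projections are injective. -/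
theorem SameTraces.finrank_pathSpan_eq (hG : IsCross G) (hG' : IsCross G')
    {L : List (List (Fin n))} (h : SameTraces G G' L) (h2 : ∀ p ∈ L, 2 ≤ p.length) :
    Module.finrank 𝕜 (pathSpan G L) = Module.finrank 𝕜 (pathSpan G' L) := by
  have key : ∀ x ∈ pairSpan G G' L, x.1 = 0 ↔ x.2 = 0 := fun x hx => by
    rw [← trace_conjTranspose_mul_self_eq_zero_iff, h.trace_eq hG hG' h2 hx hx,
      trace_conjTranspose_mul_self_eq_zero_iff]
  have h1 : Module.finrank 𝕜 (pathSpan G L) = Module.finrank 𝕜 (pairSpan G G' L) := by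
    rw [← map_fst_pairSpan (G' := G'), ← LinearMap.range_domRestrict,
      LinearMap.finrank_range_of_inj]
    refine (injective_iff_map_eq_zero _).2 fun x hx => ?_
    have hx0 : x.1.1 = 0 := hx
    exact Subtype.ext (Prod.ext hx0 ((key x x.2).1 hx0))
  have h1' : Module.finrank 𝕜 (pathSpan G' L) = Module.finrank 𝕜 (pairSpan G G' L) := by
    rw [← map_snd_pairSpan (G := G), ← LinearMap.range_domRestrict,
      LinearMap.finrank_range_of_inj]
    refine (injective_iff_map_eq_zero _).2 fun x hx => ?_
    have hx0 : x.1.2 = 0 := hx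
    exact Subtype.ext (Prod.ext ((key x x.2).2 hx0) hx0)
  rw [h1, h1']

theorem trace_eq_of_fullReport_eq (h : fullReport G = fullReport G') {w : Word n}
    (hw : entry G w ∈ fullReport G) : (evalWord G w).trace = (evalWord G' w).trace := by
  rw [h] at hw
  exact congrArg Prod.snd (eq_entry_of_mem_fullReport hw)

theorem sameTraces_of_fullReport_eq (h : fullReport G = fullReport G') (i : Fin n) :
    SameTraces G G' (searchPaths G i (n * r * r)) := fun s hs t ht =>
  trace_eq_of_fullReport_eq h (mem_fullReport.2 ⟨i, t, ht, .inr ⟨s, hs, rfl⟩⟩)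

/-- The paths found for `G` are not assumed to be those found for `G'`. Their words for `G'` span a
subspace of the full span, and transporting both dimensions to `G` gives the reverse inequality. -/
theorem pathSpan_eq_of_fullReport_eq (hG : IsCross G) (hG' : IsCross G') (hr : 1 ≤ r)
    (h : fullReport G = fullReport G') (i : Fin n) :
    pathSpan G' (searchPaths G i (n * r * r)) = pathSpan G' (searchPaths G' i (n * r * r)) := by
  have hL := (searchPaths_spec hG hr i (n * r * r)).1
  have hL' := (searchPaths_spec hG' hr i (n * r * r)).1
  refine Submodule.eq_of_le_of_finrank_le
    (pathSpan_le_pathSpan_searchPaths hG' hr hL.two_le hL.getLast) ?_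
  rw [← (sameTraces_of_fullReport_eq h i).finrank_pathSpan_eq hG hG' hL.two_le,
    (sameTraces_of_fullReport_eq h.symm i).finrank_pathSpan_eq hG' hG hL'.two_le]
  exact Submodule.finrank_mono
    (pathSpan_le_pathSpan_searchPaths hG hr hL'.two_le hL'.getLast)

/-- The isometry between the spans commutes with the letters: lift the first component to a pair `z`
and show that the discrepancy in the second component is zero. -/
theorem crossBlock_mul_mem_pairSpan (hG : IsCross G) (hG' : IsCross G') (hr : 1 ≤ r)
    (h : fullReport G = fullReport G') (i k j : Fin n)
    {x : Matrix (Fin n × Fin r) (Fin n × Fin r) 𝕜 × Matrix (Fin n × Fin r) (Fin n × Fin r) 𝕜}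
    (hx : x ∈ pairSpan G G' (searchPaths G i (n * r * r))) :
    (crossBlock G k j * x.1, crossBlock G' k j * x.2) ∈
      pairSpan G G' (searchPaths G i (n * r * r)) := by
  have hL := (searchPaths_spec hG hr i (n * r * r)).1
  have hs := sameTraces_of_fullReport_eq h i
  set L := searchPaths G i (n * r * r)
  have h1 : crossBlock G k j * x.1 ∈ pathSpan G L := by
    refine crossBlock_mul_mem_pathSpan hG hr i k j ?_
    rw [← map_fst_pairSpan (G' := G')]
    exact ⟨x, hx, rfl⟩
  have h2 : crossBlock G' k j * x.2 ∈ pathSpan G' L := by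
    rw [pathSpan_eq_of_fullReport_eq hG hG' hr h i]
    refine crossBlock_mul_mem_pathSpan hG' hr i k j ?_
    rw [← pathSpan_eq_of_fullReport_eq hG hG' hr h i, ← map_snd_pairSpan (G := G)]
    exact ⟨x, hx, rfl⟩
  rw [← map_fst_pairSpan (G' := G')] at h1
  obtain ⟨z, hz, hz1⟩ := h1
  change z.1 = _ at hz1
  have h3 : crossBlock G' k j * x.2 - z.2 ∈ pathSpan G' L := by
    refine Submodule.sub_mem _ h2 ?_
    rw [← map_snd_pairSpan (G := G)]
    exact ⟨z, hz, rfl⟩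
  rw [← map_snd_pairSpan (G := G)] at h3
  obtain ⟨y, hy, hy2⟩ := h3
  change y.2 = _ at hy2
  -- The discrepancy is `y.2`. Its inner products with `x_{kj} x.2` and with `z.2` equal those of
  -- `y.1` with `x_{kj} x.1` and with `z.1`, which coincide.
  have h4 : (y.2ᴴ * y.2).trace = 0 := by
    nth_rw 2 [hy2]
    rw [Matrix.mul_sub, trace_sub, ← hs.trace_crossBlock_eq hG hG' hL.two_le k j hy hx,
      ← hs.trace_eq hG hG' hL.two_le hy hz, hz1, sub_self]
  rw [trace_conjTranspose_mul_self_eq_zero_iff, hy2, sub_eq_zero] at h4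
  rw [h4, ← hz1]
  exact hz

theorem evalWord_mul_blockProj_mem_pairSpan (hG : IsCross G) (hG' : IsCross G') (hr : 1 ≤ r)
    (h : fullReport G = fullReport G') (i : Fin n) (w : Word n) :
    (evalWord G w * blockProj 𝕜 i, evalWord G' w * blockProj 𝕜 i) ∈
      pairSpan G G' (searchPaths G i (n * r * r)) := by
  induction w with
  | nil =>
    refine Submodule.subset_span ⟨[i, i], (searchPaths_spec hG hr i _).1.root, ?_⟩
    rw [evalWord_pathWord_root hG, evalWord_pathWord_root hG']
    simp [evalWord]
  | cons x w ih =>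
    rw [evalWord_cons, evalWord_cons, Matrix.mul_assoc, Matrix.mul_assoc]
    exact crossBlock_mul_mem_pairSpan hG hG' hr h i _ _ ih

/-- Cut a word into its products with the `Π_i`. These give pairs in `pairSpan`, where the traces of
the components agree because they agree on the generators. -/
theorem trace_evalWord_eq_of_fullReport_eq (hG : IsCross G) (hG' : IsCross G') (hr : 1 ≤ r)
    (h : fullReport G = fullReport G') (w : Word n) :
    (evalWord G w).trace = (evalWord G' w).trace := by
  have key : ∀ i, ∀ x ∈ pairSpan G G' (searchPaths G i (n * r * r)), x.1.trace = x.2.trace := by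
    intro i x hx
    induction hx using Submodule.span_induction with
    | mem x hx =>
      obtain ⟨p, hp, rfl⟩ := hx
      exact trace_eq_of_fullReport_eq h (mem_fullReport.2 ⟨i, p, hp, .inl rfl⟩)
    | zero => rfl
    | add x y _ _ hx hy => rw [Prod.fst_add, Prod.snd_add, trace_add, trace_add, hx, hy]
    | smul c x _ hx => rw [Prod.smul_fst, Prod.smul_snd, trace_smul, trace_smul, hx]
  rw [← sum_evalWord_mul_blockProj (G := G), ← sum_evalWord_mul_blockProj (G := G'), trace_sum,
    trace_sum]
  exact Finset.sum_congr rfl fun i _ =>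
    key i _ (evalWord_mul_blockProj_mem_pairSpan hG hG' hr h i w)

/-- The representation of the free algebra that sends the letter `x_{ij}` to `Π_i G Π_j`. -/
noncomputable def freeRep (G : Matrix (Fin n × Fin r) (Fin n × Fin r) 𝕜) :
    MonoidAlgebra 𝕜 (FreeMonoid (Fin n × Fin n)) →ₐ[𝕜]
      Matrix (Fin n × Fin r) (Fin n × Fin r) 𝕜 :=
  MonoidAlgebra.lift 𝕜 _ _ (FreeMonoid.lift fun x => crossBlock G x.1 x.2)

theorem freeRep_single (w : FreeMonoid (Fin n × Fin n)) (c : 𝕜) :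
    freeRep G (MonoidAlgebra.single w c) = c • evalWord G w.toList := by
  rw [freeRep, MonoidAlgebra.lift_single, FreeMonoid.lift_apply]
  rfl

theorem exists_freeRep_eq_conjTranspose (hG : IsCross G) (hG' : IsCross G')
    (x : MonoidAlgebra 𝕜 (FreeMonoid (Fin n × Fin n))) :
    ∃ y, freeRep G y = (freeRep G x)ᴴ ∧ freeRep G' y = (freeRep G' x)ᴴ := by
  induction x using MonoidAlgebra.induction_linear with
  | zero => exact ⟨0, by simp⟩
  | add x y hx hy =>
    obtain ⟨x', hx1, hx2⟩ := hx
    obtain ⟨y', hy1, hy2⟩ := hy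
    exact ⟨x' + y', by simp [hx1, hy1], by simp [hx2, hy2]⟩
  | single w c =>
    refine ⟨MonoidAlgebra.single (FreeMonoid.ofList (adjWord w.toList)) (star c), ?_, ?_⟩
    · rw [freeRep_single, freeRep_single, conjTranspose_smul, ← evalWord_adjWord hG]
      rfl
    · rw [freeRep_single, freeRep_single, conjTranspose_smul, ← evalWord_adjWord hG']
      rfl

theorem trace_freeRep_eq (h : ∀ w, (evalWord G w).trace = (evalWord G' w).trace)
    (x : MonoidAlgebra 𝕜 (FreeMonoid (Fin n × Fin n))) :
    (freeRep G x).trace = (freeRep G' x).trace := by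
  induction x using MonoidAlgebra.induction_linear with
  | zero => simp
  | add x y hx hy => rw [map_add, map_add, trace_add, trace_add, hx, hy]
  | single w c => rw [freeRep_single, freeRep_single, trace_smul, trace_smul, h]

theorem trace_toEuclideanLin {κ : Type*} [Fintype κ] [DecidableEq κ] (M : Matrix κ κ 𝕜) :
    LinearMap.trace 𝕜 _ (toEuclideanLin M) = M.trace := by
  rw [toEuclideanLin_eq_toLin_orthonormal, trace_toLin_eq]

/-- Gramians whose words have the same traces are equivalent. -/
theorem exists_conj_of_trace_eq (hG : IsCross G) (hG' : IsCross G')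
    (h : ∀ w, (evalWord G w).trace = (evalWord G' w).trace) :
    ∃ U ∈ unitaryGroup (Fin n × Fin r) 𝕜, ∀ i j,
      U * crossBlock G i j * Uᴴ = crossBlock G' i j := by
  let E := (toLpLinAlgEquiv (n := Fin n × Fin r) (R := 𝕜) 2).toAlgHom
  have hE : ∀ M, E M = toEuclideanLin M := fun _ => rfl
  have hadj : ∀ (M : Matrix (Fin n × Fin r) (Fin n × Fin r) 𝕜) u v,
      inner 𝕜 (toEuclideanLin Mᴴ u) v = inner 𝕜 u (toEuclideanLin M v) := fun M u v => by
    rw [toEuclideanLin_conjTranspose_eq_adjoint, LinearMap.adjoint_inner_left]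
  -- The free algebra acts through both Gramians, so no homomorphism between the two cross Gramian
  -- algebras has to be constructed beforehand.
  obtain ⟨U, hU⟩ := exists_intertwiner (π := E.comp (freeRep G)) (ρ := E.comp (freeRep G'))
    (fun x => by
      obtain ⟨y, hy, hy'⟩ := exists_freeRep_eq_conjTranspose hG hG' x
      refine ⟨y, fun u v => ?_, fun u v => ?_⟩
      · rw [AlgHom.comp_apply, AlgHom.comp_apply, hy]
        exact hadj _ u v
      · rw [AlgHom.comp_apply, AlgHom.comp_apply, hy']
        exact hadj _ u v)
    (fun x => by
      rw [AlgHom.comp_apply, AlgHom.comp_apply, hE, hE, trace_toEuclideanLin,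
        trace_toEuclideanLin, trace_freeRep_eq h])
  obtain ⟨g, hg, hgv⟩ := exists_mem_unitaryGroup_of_linearIsometryEquiv U
  refine ⟨g, hg, fun i j => ?_⟩
  have key : g * crossBlock G i j = crossBlock G' i j * g := by
    refine ext_of_mulVec_single fun k => ?_
    have h1 := hU (MonoidAlgebra.single (FreeMonoid.of (i, j)) 1)
      (WithLp.toLp 2 (Pi.single k 1))
    rw [AlgHom.comp_apply, AlgHom.comp_apply, freeRep_single, freeRep_single, one_smul, one_smul,
      hE, hE, hgv (Pi.single k 1)] at h1
    have h2 : ∀ H : Matrix (Fin n × Fin r) (Fin n × Fin r) 𝕜,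
        evalWord H (FreeMonoid.of (i, j)).toList = crossBlock H i j := fun H => by
      simp [evalWord]
    rw [h2, h2] at h1
    have h3 : U (WithLp.toLp 2 (crossBlock G i j *ᵥ Pi.single k 1)) =
      WithLp.toLp 2 (crossBlock G' i j *ᵥ (g *ᵥ Pi.single k 1)) := h1
    rw [hgv] at h3
    rw [← mulVec_mulVec, ← mulVec_mulVec]
    exact congrArg WithLp.ofLp h3
  rw [key, Matrix.mul_assoc]
  have h1 : g * gᴴ = 1 := mem_unitaryGroup_iff.1 hg
  rw [h1, Matrix.mul_one]

end Invariant

end CrossGramian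

open CrossGramian in
theorem mainTheorem4 {𝕜 : Type*} [RCLike 𝕜] :
    (∀ (r n d : ℕ) (V W : Fin n → Gr 𝕜 r d) (A B : Fin n → Matrix (Fin d) (Fin r) 𝕜),
      IsOrthobasis A V → IsOrthobasis B W →
        (∀ U ∈ Matrix.unitaryGroup (Fin n × Fin r) 𝕜,
          (∀ i j, U * crossBlock (gramian A) i j * U.conjTranspose =
              crossBlock (gramian B) i j) ↔
            IsBlockDiagonal U ∧ U * gramian A * U.conjTranspose = gramian B) ∧
        ((∃ g : UGroup 𝕜 d, g • V = W) ↔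
          ∃ U ∈ Matrix.unitaryGroup (Fin n × Fin r) 𝕜, ∀ i j,
            U * crossBlock (gramian A) i j * U.conjTranspose = crossBlock (gramian B) i j)) ∧
    ∃ (P : Prog) (C : ℕ), ∀ r n d : ℕ, 1 ≤ r → 1 ≤ n →
      ∃ f : (Fin n → Gr 𝕜 r d) → List (Word n × 𝕜),
        IsInjectiveInvariant (UGroup 𝕜 d) f ∧
        ∀ (V : Fin n → Gr 𝕜 r d) (A : Fin n → Matrix (Fin d) (Fin r) 𝕜),
          IsOrthobasis A V →
            (∀ e ∈ f V, e.2 = (evalWord (gramian A) e.1).trace) ∧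
            Subalgebra.toSubmodule (crossAlgebra (gramian A)) =
              Submodule.span 𝕜 {M | ∃ e ∈ f V, M = evalWord (gramian A) e.1} ∧
            (P.run (input r n (gramian A))).out = encode (f V) ∧
            (P.run (input r n (gramian A))).time ≤ C * (r ^ 8 * n ^ 5 + r ^ 9 * n ^ 3) := by
  refine ⟨fun r n d V W A B hA hB => ⟨fun U hU => conj_crossBlock_iff hA.isCross hB.isCross hU,
    exists_smul_eq_iff hA hB⟩, Alg.main, 10000, fun r n d hr hn => ?_⟩
  -- The invariant is defined by an arbitrary choice of orthobasis; `fullReport_eq_of_conj` shows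
  -- that any other choice gives the same value.
  choose A hA using fun V : Fin n → Gr 𝕜 r d => exists_isOrthobasis V
  refine ⟨fun V => fullReport (gramian (A V)), ⟨fun g V => ?_, fun V W h => ?_⟩,
    fun V B hB => ?_⟩
  · obtain ⟨U, hU, h⟩ := (exists_smul_eq_iff (hA V) (hA (g • V))).1 ⟨g, rfl⟩
    exact (fullReport_eq_of_conj hU h).symm
  · have hV := (hA V).isCross
    have hW := (hA W).isCross
    exact (exists_smul_eq_iff (hA V) (hA W)).2 (exists_conj_of_trace_eq hV hW
      (trace_evalWord_eq_of_fullReport_eq hV hW hr h))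
  · obtain ⟨U, hU, h⟩ := (hA V).exists_unitary hB
    simp only [fullReport_eq_of_conj hU h]
    exact ⟨fun e he => congrArg Prod.snd (eq_entry_of_mem_fullReport he),
      crossAlgebra_eq_span hB.isCross hr, Alg.run_main hB.isCross hr hn⟩
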